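/- **Lemma (Scaling of conditional entropy in the infinite-time limit under diffusion).** Let $A$ and $B$ consist of $m$ and $n$ bosonic modes with mode operators $R=(Q_1,P_1,\ldots,Q_{m+n},P_{m+n})$, $[Q_j,P_k]=i\delta_{jk}$, acting on $L^2(\mathbb{R}^{m+n})=L^2(\mathbb{R}^m)\otimes L^2(\mathbb{R}^n)$. Let $\rho_{AB}$ be a Gaussian state, i.e. a positive operator of trace one for which there are a real symmetric matrix $M$ and a vector $d$ with $\mathrm{tr}(\rho_{AB}\,e^{iu\cdot R})=\exp\left(iu\cdot d-\tfrac14 u^TMu\right)$ for all $u\in\mathbb{R}^{2(m+n)}$. For $t\ge 0$ let $$\rho_{AB}(t)=(e^{t\mathcal{L}_A}\otimes I_B)(\rho_{AB})=\int_{\mathbb{R}^{2m}} W(\xi,0)\,\rho_{AB}\,W(\xi,0)^\dagger\,d\gamma_{t/2}(\xi)$$ be the state obtained by diffusion for time $t$ on the modes of $A$. Here $W(\xi)$ is the unitary displacement operator with $W(\xi)^\dagger R_kW(\xi)=R_k+\xi_k$, and $\gamma_{s}$ is the law of $2m$ independent centred normal variables of variance $s$; on Gaussian states this evolution is $(M,d)\mapsto(M+t(I_A\oplus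 0_B),d)$. Let $S(\rho)=-\mathrm{tr}(\rho\log\rho)$ with the natural logarithm, $S(A|B)_\rho=S(\rho)-S(\mathrm{tr}_A\rho)$, and $g(x)=(x+1)\log(x+1)-x\log x$. Then $S(\rho_{AB}(t))$ and $S(\mathrm{tr}_A\,\rho_{AB}(t))$ are finite for all $t\ge 0$, and $$\lim_{t\to\infty}\left|S(A|B)_{\rho_{AB}(t)}-m\cdot g\left(\frac{t-1}{2}\right)\right|=0 .$$ -/

import Mathlib

open MeasureTheory ProbabilityTheory Filter Topology
open scoped ENNReal Matrix

noncomputable section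

/-! ### The Hilbert space of finitely many bosonic modes -/

/-- The Hilbert space `L²(ℝ^ι)` of bosonic modes labelled by `ι`, in the Schrödinger representation:
`Q_k` is multiplication by the `k`-th coordinate and `P_k = -i ∂_k`, so that `[Q_k, P_k] = i`. -/
abbrev ModeSpace (ι : Type) [Fintype ι] : Type :=
  Lp ℂ 2 (volume : Measure (ι → ℝ))

/-- Bounded operators on the Hilbert space of the modes `ι`. -/
abbrev ModeOp (ι : Type) [Fintype ι] : Type :=
  ModeSpace ι →L[ℂ] ModeSpace ι

/-- Vectors of the phase space `ℝ^{2N}`. The component `(k, 0)` belongs to `Q_k` and the component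
`(k, 1)` to `P_k`. -/
abbrev PhaseSpace (ι : Type) : Type := ι × Fin 2 → ℝ

/-! ### Displacement operators -/

/-- The phase `exp (i ∑ p_k (x_k - q_k / 2))` in the displacement operator of `ξ = (q, p)`. -/
def displacementPhase {ι : Type} [Fintype ι] (ξ : PhaseSpace ι) (x : ι → ℝ) : ℂ :=
  Complex.exp (((∑ k, ξ (k, 1) * (x k - ξ (k, 0) / 2) : ℝ) : ℂ) * Complex.I)

lemma norm_displacementPhase {ι : Type} [Fintype ι] (ξ : PhaseSpace ι) (x : ι → ℝ) :
    ‖displacementPhase ξ x‖ = 1 :=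
  Complex.norm_exp_ofReal_mul_I _

lemma continuous_displacementPhase {ι : Type} [Fintype ι] (ξ : PhaseSpace ι) :
    Continuous (displacementPhase ξ) := by
  unfold displacementPhase
  fun_prop

lemma measurePreserving_shift {ι : Type} [Fintype ι] (q : ι → ℝ) :
    MeasurePreserving (fun x : ι → ℝ => x - q) volume volume :=
  measurePreserving_sub_right volume q

lemma memLp_displacement {ι : Type} [Fintype ι] (ξ : PhaseSpace ι) (ψ : ModeSpace ι) :
    MemLp (fun x : ι → ℝ => displacementPhase ξ x * ψ (x - fun k => ξ (k, 0))) 2 volume := by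
  have h : MemLp (fun x : ι → ℝ => ψ (x - fun k => ξ (k, 0))) 2 volume :=
    (Lp.memLp ψ).comp_measurePreserving (measurePreserving_shift fun k => ξ (k, 0))
  refine h.of_le ((continuous_displacementPhase ξ).aestronglyMeasurable.mul h.1) ?_
  exact ae_of_all _ fun x => by rw [norm_mul, norm_displacementPhase, one_mul]

/-- The displacement (Weyl) operator `W(ξ) = exp (i ∑ (p_k Q_k - q_k P_k))` of `ξ = (q, p)`, that is,
`(W(ξ) ψ)(x) = exp (i ∑ p_k (x_k - q_k / 2)) ψ (x - q)`. It satisfies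
`W(ξ)† R_k W(ξ) = R_k + ξ_k`. -/
def displacement {ι : Type} [Fintype ι] (ξ : PhaseSpace ι) : ModeOp ι :=
  LinearMap.mkContinuous
    { toFun := fun ψ => (memLp_displacement ξ ψ).toLp
      map_add' := fun ψ φ => by
        rw [← MemLp.toLp_add]
        refine MemLp.toLp_congr _ _ ?_
        filter_upwards [(measurePreserving_shift fun k => ξ (k, 0)).quasiMeasurePreserving.ae_eq_comp
          (Lp.coeFn_add ψ φ)] with x hx
        simp only [Function.comp_apply, Pi.add_apply] at hx ⊢
        rw [hx, mul_add]
      map_smul' := fun c ψ => by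
        rw [RingHom.id_apply, ← MemLp.toLp_const_smul]
        refine MemLp.toLp_congr _ _ ?_
        filter_upwards [(measurePreserving_shift fun k => ξ (k, 0)).quasiMeasurePreserving.ae_eq_comp
          (Lp.coeFn_smul c ψ)] with x hx
        simp only [Function.comp_apply, Pi.smul_apply, smul_eq_mul] at hx ⊢
        rw [hx, mul_left_comm] }
    1 (fun ψ => by
      simp only [LinearMap.coe_mk, AddHom.coe_mk, one_mul]
      rw [Lp.norm_toLp, Lp.norm_def]
      refine (congrArg ENNReal.toReal ?_).le
      rw [← eLpNorm_comp_measurePreserving (Lp.aestronglyMeasurable ψ)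
        (measurePreserving_shift fun k => ξ (k, 0))]
      refine eLpNorm_congr_norm_ae (ae_of_all _ fun x => ?_)
      simp [norm_displacementPhase])

/-- The exponential `exp (i ∑ u_j R_j)` of a linear combination of the mode operators
`R = (Q_1, P_1, …)`, which is the displacement operator of `q = -u_P`, `p = u_Q`. -/
def modeExp {ι : Type} [Fintype ι] (u : PhaseSpace ι) : ModeOp ι :=
  displacement fun k => ![-u (k.1, 1), u (k.1, 0)] k.2

/-! ### Trace, density operators, entropy -/

/-- The index set of an orthonormal basis, which is fixed once and for all. -/
def basisSet (H : Type) [NormedAddCommGroup H] [InnerProductSpace ℂ H] [CompleteSpace H] : Set H :=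
  (exists_hilbertBasis ℂ H).choose

/-- An orthonormal basis of the Hilbert space `H`, which is fixed once and for all. -/
def stdBasis (H : Type) [NormedAddCommGroup H] [InnerProductSpace ℂ H] [CompleteSpace H] :
    HilbertBasis (basisSet H) ℂ H :=
  (exists_hilbertBasis ℂ H).choose_spec.choose

section Trace

variable {H : Type} [NormedAddCommGroup H] [InnerProductSpace ℂ H] [CompleteSpace H]

/-- The trace `∑ ⟨e_i, T e_i⟩`. For a trace class operator the sum converges absolutely and does not
depend on the orthonormal basis. -/
def opTrace (T : H →L[ℂ] H) : ℂ :=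
  ∑' i, inner ℂ (stdBasis H i) (T (stdBasis H i))

/-- The trace `∑ ⟨e_i, T e_i⟩ ∈ [0, ∞]` of a positive operator; it does not depend on the orthonormal
basis, and it is finite if and only if `T` is trace class. -/
def posTrace (T : H →L[ℂ] H) : ℝ≥0∞ :=
  ∑' i, ENNReal.ofReal (inner ℂ (stdBasis H i) (T (stdBasis H i))).re

/-- A density operator (quantum state): a positive operator of trace one. -/
def IsDensityOperator (ρ : H →L[ℂ] H) : Prop :=
  ρ.IsPositive ∧ posTrace ρ = 1

/-- The von Neumann entropy `S(ρ) = -tr (ρ log ρ) ∈ [0, ∞]` of a density operator, in nats; the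
operator `-ρ log ρ` is given by the continuous functional calculus of `x ↦ -x log x`. -/
def vonNeumannEntropy (ρ : H →L[ℂ] H) : ℝ≥0∞ :=
  posTrace (cfc Real.negMulLog ρ)

end Trace

/-! ### Gaussian states -/

/-- The density operator `ρ` is the Gaussian state `ρ_{M,d}`: its characteristic function is
`tr (ρ exp (i u · R)) = exp (i u · d - uᵀ M u / 4)`. Then `d_k = tr (ρ R_k)` and
`M_{jk} = tr (ρ {R_j - d_j, R_k - d_k})`; so the vacuum has `M = I`. -/
def IsGaussianStateWith {ι : Type} [Fintype ι] (ρ : ModeOp ι)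
    (M : Matrix (ι × Fin 2) (ι × Fin 2) ℝ) (d : PhaseSpace ι) : Prop :=
  IsDensityOperator ρ ∧ M.IsSymm ∧
    ∀ u : PhaseSpace ι, opTrace (ρ ∘L modeExp u) =
      Complex.exp (((u ⬝ᵥ d : ℝ) : ℂ) * Complex.I - ((u ⬝ᵥ (M *ᵥ u) : ℝ) : ℂ) / 4)

/-- `ρ` is a Gaussian state. -/
def IsGaussianState {ι : Type} [Fintype ι] (ρ : ModeOp ι) : Prop :=
  ∃ (M : Matrix (ι × Fin 2) (ι × Fin 2) ℝ) (d : PhaseSpace ι), IsGaussianStateWith ρ M d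

/-! ### Bipartite systems -/

/-- The function `(φ ⊗ ψ)(x, y) = φ(x) ψ(y)`. -/
def tensorFun {α β : Type} [Fintype α] [Fintype β] (φ : ModeSpace α) (ψ : ModeSpace β)
    (z : α ⊕ β → ℝ) : ℂ :=
  φ (fun a => z (Sum.inl a)) * ψ (fun b => z (Sum.inr b))

lemma measurePreserving_split (α β : Type) [Fintype α] [Fintype β] :
    MeasurePreserving (fun z : α ⊕ β → ℝ => ((fun a => z (Sum.inl a)), fun b => z (Sum.inr b)))
      volume (volume.prod volume) :=
  volume_measurePreserving_sumPiEquivProdPi fun _ : α ⊕ β => ℝ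

lemma aestronglyMeasurable_tensorProd {α β : Type} [Fintype α] [Fintype β]
    (φ : ModeSpace α) (ψ : ModeSpace β) :
    AEStronglyMeasurable (fun w : (α → ℝ) × (β → ℝ) => φ w.1 * ψ w.2) (volume.prod volume) :=
  (Lp.aestronglyMeasurable φ).comp_fst.mul (Lp.aestronglyMeasurable ψ).comp_snd

lemma eLpNorm_tensorFun {α β : Type} [Fintype α] [Fintype β]
    (φ : ModeSpace α) (ψ : ModeSpace β) :
    eLpNorm (tensorFun φ ψ) 2 volume = eLpNorm φ 2 volume * eLpNorm ψ 2 volume := by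
  have h : eLpNorm (tensorFun φ ψ) 2 volume
      = eLpNorm (fun w : (α → ℝ) × (β → ℝ) => φ w.1 * ψ w.2) 2 (volume.prod volume) :=
    eLpNorm_comp_measurePreserving (g := fun w : (α → ℝ) × (β → ℝ) => φ w.1 * ψ w.2)
      (f := fun z : α ⊕ β → ℝ => ((fun a => z (Sum.inl a)), fun b => z (Sum.inr b)))
      (aestronglyMeasurable_tensorProd φ ψ) (measurePreserving_split α β)
  rw [h]
  simp only [eLpNorm_eq_lintegral_rpow_enorm_toReal two_ne_zero ENNReal.ofNat_ne_top, enorm_mul]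
  rw [← ENNReal.mul_rpow_of_nonneg _ _ (by positivity)]
  congr 1
  rw [← lintegral_prod_mul]
  · refine lintegral_congr fun w => ?_
    rw [ENNReal.mul_rpow_of_nonneg _ _ (by positivity)]
  · exact (Lp.aestronglyMeasurable φ).enorm.pow_const _
  · exact (Lp.aestronglyMeasurable ψ).enorm.pow_const _

lemma memLp_tensorFun {α β : Type} [Fintype α] [Fintype β]
    (φ : ModeSpace α) (ψ : ModeSpace β) : MemLp (tensorFun φ ψ) 2 volume := by
  have h : AEStronglyMeasurable (tensorFun φ ψ) volume :=
    AEStronglyMeasurable.comp_measurePreserving (g := fun w : (α → ℝ) × (β → ℝ) => φ w.1 * ψ w.2)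
      (f := fun z : α ⊕ β → ℝ => ((fun a => z (Sum.inl a)), fun b => z (Sum.inr b)))
      (aestronglyMeasurable_tensorProd φ ψ) (measurePreserving_split α β)
  refine ⟨h, ?_⟩
  rw [eLpNorm_tensorFun]
  exact ENNReal.mul_lt_top (Lp.memLp φ).2 (Lp.memLp ψ).2

lemma ae_split_snd {α β : Type} [Fintype α] [Fintype β] {f g : (β → ℝ) → ℂ}
    (h : f =ᵐ[volume] g) :
    ∀ᵐ z : α ⊕ β → ℝ, f (fun b => z (Sum.inr b)) = g (fun b => z (Sum.inr b)) :=
  (measurePreserving_split α β).quasiMeasurePreserving.ae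
    ((Measure.quasiMeasurePreserving_snd (μ := (volume : Measure (α → ℝ)))).ae h)

/-- The map `ψ ↦ φ ⊗ ψ` from the Hilbert space of the system `β` to that of the composite system
`α ⊕ β`. -/
def tensorLeft {α β : Type} [Fintype α] [Fintype β] (φ : ModeSpace α) :
    ModeSpace β →L[ℂ] ModeSpace (α ⊕ β) :=
  LinearMap.mkContinuous
    { toFun := fun ψ => (memLp_tensorFun φ ψ).toLp
      map_add' := fun ψ χ => by
        rw [← MemLp.toLp_add]
        refine MemLp.toLp_congr _ _ ?_
        filter_upwards [ae_split_snd (α := α) (Lp.coeFn_add ψ χ)] with z hz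
        simp only [tensorFun, Pi.add_apply] at hz ⊢
        rw [hz, mul_add]
      map_smul' := fun c ψ => by
        rw [RingHom.id_apply, ← MemLp.toLp_const_smul]
        refine MemLp.toLp_congr _ _ ?_
        filter_upwards [ae_split_snd (α := α) (Lp.coeFn_smul c ψ)] with z hz
        simp only [tensorFun, Pi.smul_apply, smul_eq_mul] at hz ⊢
        rw [hz, mul_left_comm] }
    ‖φ‖ (fun ψ => by
      simp only [LinearMap.coe_mk, AddHom.coe_mk]
      rw [Lp.norm_toLp, eLpNorm_tensorFun, ENNReal.toReal_mul, Lp.norm_def, Lp.norm_def])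

/-- The partial trace `tr_A ρ = ∑ (⟨e_i| ⊗ 1) ρ (|e_i⟩ ⊗ 1)` over the left subsystem, `e_i` running
through an orthonormal basis of its Hilbert space. For trace class `ρ` the series converges
absolutely in the operator norm. -/
def partialTraceLeft {α β : Type} [Fintype α] [Fintype β] (ρ : ModeOp (α ⊕ β)) : ModeOp β :=
  ∑' i, (tensorLeft (stdBasis (ModeSpace α) i)).adjoint ∘L ρ ∘L tensorLeft (stdBasis (ModeSpace α) i)

/-- The conditional entropy `S(A|B)_ρ = S(ρ_AB) - S(ρ_B)` of a state whose entropies are finite. -/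
def conditionalEntropy {α β : Type} [Fintype α] [Fintype β] (ρ : ModeOp (α ⊕ β)) : ℝ :=
  (vonNeumannEntropy ρ).toReal - (vonNeumannEntropy (partialTraceLeft ρ)).toReal

/-! ### Diffusion -/

/-- The phase space vector `(ξ, 0)` of the composite system. -/
def extendByZero {α β : Type} (ξ : PhaseSpace α) : PhaseSpace (α ⊕ β) :=
  fun k => Sum.elim (fun a => ξ (a, k.2)) (fun _ => 0) k.1

/-- Diffusion `(exp (t 𝓛_A) ⊗ id_B) ρ` for time `t ≥ 0` on the subsystem `A = α`, where
`𝓛_A ρ = -(1/4) ∑_j [R_j, [R_j, ρ]]` is summed over the mode operators of `A`. It is the mixture of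
`W(ξ, 0) ρ W(ξ, 0)†` over a random displacement `ξ` of `A` with independent centred normal
components of variance `t / 2`, so it multiplies the characteristic function at `u` by
`exp (-t |u_A|² / 4)`, and it maps `ρ_{M,d}` to `ρ_{M',d}` with `M' = M + t (I_A ⊕ 0_B)`. -/
def diffuseLeft {α β : Type} [Fintype α] [Fintype β] (t : ℝ) (ρ : ModeOp (α ⊕ β)) :
    ModeOp (α ⊕ β) :=
  ∫ ξ : PhaseSpace α,
    displacement (extendByZero ξ) ∘L ρ ∘L (displacement (extendByZero ξ)).adjoint
    ∂(Measure.pi fun _ : α × Fin 2 => gaussianReal 0 (t / 2).toNNReal)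

/-! ### The entropy of a thermal mode -/

/-- The entropy `g(x) = (x + 1) log (x + 1) - x log x` of a Gaussian mode of mean photon number
`x`. -/
def gFun (x : ℝ) : ℝ := (x + 1) * Real.log (x + 1) - x * Real.log x

end

/-!
No normal form of the Gaussian state is needed: the conditional entropy of `R = ρ(t)` is squeezed
between two elementary bounds, both of which agree with `m g((t - 1) / 2)` in the limit. Throughout,
`ρ_B` is the reduced state of `B`, which the diffusion does not change
(`partialTraceLeft_diffuseLeft`), `f_j` is an eigenbasis of `ρ_B` with eigenvalues `q_j`, and `μ` is
Lebesgue measure on the phase space of `A` divided by `(2π)^m`, so that the displaced copies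
`W(ξ)|0⟩` of the vacuum resolve the identity. The latter is Moyal's identity
`∫ |⟨W(ξ)φ, ψ⟩|² dμ = ‖φ‖² ‖ψ‖²` (`lintegral_enorm_inner_displacement_sq`), a consequence of
Plancherel's theorem.

*Upper bound* (`vonNeumannEntropy_le_add_husimiMoment`). The vectors `W(ξ)|0⟩ ⊗ f_j` resolve the
identity of the composite system. Klein's inequality for this resolution
(`vonNeumannEntropy_le_lintegral`), with the reference density `q_j (2/T)^m exp (-|ξ|² / T)`, yields
`S(R) ≤ S(ρ_B) + m log (T/2) + M(R) / T`, where `M` is the sum of the second moments of the Husimi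
function of `A`. The diffusion convolves the Husimi function with the normal law, so
`M(R) = M(ρ) + m t` (`husimiMoment_diffuseLeft`). Finiteness of `M(ρ)` is where the Gaussian
hypothesis enters: the characteristic function of the Husimi function is controlled near the origin
by that of `ρ` (`lintegral_exp_sub_one_mul_expect_le`), and Fatou's lemma turns a quadratic bound
there into a bound on second moments (`lintegral_sq_mul_expect_displacement_ne_top`). The same
argument on `B` alone shows that `S(ρ_B)` is finite. For `T = t` the bound reads
`S(A|B) ≤ m (1 + log (t/2)) + M(ρ) / t`.

*Lower bound* (`le_vonNeumannEntropy_diffuseLeft`). The map `f ↦ ∫ f(ξ) W(ξ,0) ρ W(ξ,0)† dμ` sends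
the Gaussian density `r` to `R` and the constant `1` to `1 ⊗ ρ_B`
(`lintegral_expect_displaced`, which rests on the orthogonality of matrix coefficients).
Monotonicity of the relative entropy gives `-S(R) - tr R log (1 ⊗ ρ_B) ≤ ∫ r log r dμ`, that is,
`S(R) - S(ρ_B) ≥ -∫ r log r dμ = m (1 + log (t/2))`. As `μ` is infinite and `1 ⊗ ρ_B` is not trace
class, monotonicity is proved directly in the form needed (`log_add_tsum_le`): the logarithm is an
integral of the functions `x ↦ x² / (1 + s x)`, for which it is a variational statement about finite
sums (`sum_le_lintegral_of_mixture`).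

Finally `g((t - 1) / 2) - (1 + log (t/2)) → 0` (`tendsto_gFun_sub`).
-/

noncomputable section

set_option linter.unusedSectionVars false

/-! ### Positive trace class operators and their entropy -/

section Hilbert

variable {H : Type} [NormedAddCommGroup H] [InnerProductSpace ℂ H]

lemma HilbertBasis.hasSum_norm_inner_sq {κ : Type*} (b : HilbertBasis κ ℂ H) (x : H) :
    HasSum (fun i => ‖inner ℂ (b i) x‖ ^ 2) (‖x‖ ^ 2) := by
  have h := Complex.hasSum_re (b.hasSum_inner_mul_inner x x)
  rw [inner_self_eq_norm_sq_to_K] at h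
  convert h using 1
  · ext i
    rw [← inner_conj_symm x (b i), ← Complex.normSq_eq_conj_mul_self, Complex.ofReal_re,
      Complex.normSq_eq_norm_sq]
  · norm_cast

lemma HilbertBasis.tsum_enorm_inner_sq {κ : Type*} (b : HilbertBasis κ ℂ H) (x : H) :
    ∑' i, ‖inner ℂ (b i) x‖ₑ ^ 2 = ‖x‖ₑ ^ 2 := by
  have h2 := b.hasSum_norm_inner_sq x
  have h4 : ∀ y : ℂ, ‖y‖ₑ ^ 2 = ENNReal.ofReal (‖y‖ ^ 2) := fun y => by
    rw [ENNReal.ofReal_pow (norm_nonneg _), ofReal_norm]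
  simp_rw [h4]
  rw [← ENNReal.ofReal_tsum_of_nonneg (fun _ => by positivity) h2.summable, h2.tsum_eq,
    ENNReal.ofReal_pow (norm_nonneg _), ofReal_norm]

/-- The expectation `⟨v, T v⟩ ∈ [0, ∞)` of a positive operator. -/
def expect (T : H →L[ℂ] H) (v : H) : ℝ≥0∞ := ENNReal.ofReal (inner ℂ v (T v)).re

lemma HasSum.of_forall_eq {κ E : Type*} [AddCommMonoid E] [TopologicalSpace E] {f g : κ → E} {a : E}
    (h : HasSum f a) (hfg : ∀ i, g i = f i) : HasSum g a :=
  (funext hfg : g = f) ▸ h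

lemma HilbertBasis.eq_zero_of_inner {κ : Type*} (b : HilbertBasis κ ℂ H) {x : H}
    (h : ∀ k, inner ℂ (b k) x = 0) : x = 0 := by
  have h1 := b.tsum_enorm_inner_sq x
  simp only [h, enorm_zero, ne_eq, OfNat.ofNat_ne_zero, not_false_eq_true, zero_pow,
    tsum_zero] at h1
  simpa using h1.symm

lemma expect_smul_of_norm_eq_one (T : H →L[ℂ] H) (x : H) {c : ℂ} (hc : ‖c‖ = 1) :
    expect T (c • x) = expect T x := by
  rw [expect, map_smul, inner_smul_left, inner_smul_right, ← mul_assoc,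
    ← Complex.normSq_eq_conj_mul_self, Complex.normSq_eq_norm_sq, hc]
  simp [expect]

/-- The functional `T ↦ ⟨x, T y⟩` on bounded operators. -/
def innerApply (x y : H) : (H →L[ℂ] H) →L[ℂ] ℂ :=
  (innerSL ℂ x) ∘L (ContinuousLinearMap.apply ℂ H y)

lemma innerApply_apply (x y : H) (T : H →L[ℂ] H) : innerApply x y T = inner ℂ x (T y) := rfl

lemma continuous_rankOne_self {X : Type*} [TopologicalSpace X] {v : X → H} (hv : Continuous v) :
    Continuous fun x => InnerProductSpace.rankOne ℂ (v x) (v x) :=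
  (ContinuousLinearMap.smulRightL ℂ H H).continuous₂.comp
    (((innerSL ℂ (E := H)).continuous.comp hv).prodMk hv)

lemma HilbertBasis.countable {κ : Type*} [TopologicalSpace.SeparableSpace H]
    (b : HilbertBasis κ ℂ H) : Countable κ := by
  refine Pairwise.countable_of_isOpen_disjoint (s := fun i => Metric.ball (b i) (1 / 2))
    (fun i j hij => ?_) (fun _ => Metric.isOpen_ball) (fun i => ⟨b i, by simp⟩)
  refine Metric.ball_disjoint_ball ?_
  have h1 : ‖b i - b j‖ ^ 2 = 2 := by
    have hb := b.orthonormal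
    have := norm_sub_sq (𝕜 := ℂ) (b i) (b j)
    rw [hb.1 i, hb.1 j, hb.2 hij] at this
    rw [this]
    norm_num
  rw [dist_eq_norm]
  nlinarith [norm_nonneg (b i - b j)]

variable [CompleteSpace H]

lemma exists_sqrt {T : H →L[ℂ] H} (hT : T.IsPositive) :
    ∃ S : H →L[ℂ] H, IsSelfAdjoint S ∧ S * S = T := by
  have h0 : 0 ≤ T := (ContinuousLinearMap.nonneg_iff_isPositive T).2 hT
  exact ⟨CFC.sqrt T, (CFC.sqrt_nonneg T).isSelfAdjoint, CFC.sqrt_mul_sqrt_self T h0⟩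

lemma inner_sq_apply {S : H →L[ℂ] H} (hS : IsSelfAdjoint S) (x y : H) :
    inner ℂ x ((S * S) y) = inner ℂ (S x) (S y) := by
  rw [mul_apply_eq_comp, ← ContinuousLinearMap.adjoint_inner_left, hS.adjoint_eq]

lemma expect_sq {S : H →L[ℂ] H} (hS : IsSelfAdjoint S) (x : H) :
    expect (S * S) x = ‖S x‖ₑ ^ 2 := by
  rw [expect, inner_sq_apply hS, ← ofReal_norm, ← ENNReal.ofReal_pow (norm_nonneg _),
    inner_self_eq_norm_sq_to_K]
  norm_cast

lemma inner_apply_self_eq_re {T : H →L[ℂ] H} (hT : T.IsPositive) (x : H) :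
    inner ℂ x (T x) = ((inner ℂ x (T x)).re : ℂ) := by
  refine (Complex.conj_eq_iff_re.1 ?_).symm
  rw [inner_conj_symm, hT.inner_left_eq_inner_right]

lemma inner_apply_self_re_nonneg {T : H →L[ℂ] H} (hT : T.IsPositive) (x : H) :
    0 ≤ (inner ℂ x (T x)).re :=
  hT.re_inner_nonneg_right x

lemma expect_adjoint_conj {K : Type} [NormedAddCommGroup K] [InnerProductSpace ℂ K]
    [CompleteSpace K] (T : H →L[ℂ] H) (V : K →L[ℂ] H) (x : K) :
    expect (V.adjoint ∘L T ∘L V) x = expect T (V x) := by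
  rw [expect, ContinuousLinearMap.comp_apply, ContinuousLinearMap.adjoint_inner_right]
  rfl

lemma eq_of_expect_eq {S T : H →L[ℂ] H} (hS : S.IsPositive) (hT : T.IsPositive)
    (h : ∀ x, expect S x = expect T x) : S = T := by
  refine ContinuousLinearMap.coe_injective ((ext_inner_map _ _).1 fun x => ?_)
  have h1 := (ENNReal.ofReal_eq_ofReal_iff (inner_apply_self_re_nonneg hS x)
    (inner_apply_self_re_nonneg hT x)).1 (h x)
  change inner ℂ (S x) x = inner ℂ (T x) x
  rw [hS.inner_left_eq_inner_right, hT.inner_left_eq_inner_right, inner_apply_self_eq_re hS,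
    inner_apply_self_eq_re hT, h1]

lemma tsum_expect_eq_tsum_expect {T : H →L[ℂ] H} (hT : T.IsPositive) {κ κ' : Type*}
    (b : HilbertBasis κ ℂ H) (b' : HilbertBasis κ' ℂ H) :
    ∑' i, expect T (b i) = ∑' i, expect T (b' i) := by
  obtain ⟨S, hS, rfl⟩ := exists_sqrt hT
  simp_rw [expect_sq hS]
  calc ∑' i, ‖S (b i)‖ₑ ^ 2 = ∑' i, ∑' j, ‖inner ℂ (b' j) (S (b i))‖ₑ ^ 2 := by
        simp_rw [b'.tsum_enorm_inner_sq]
    _ = ∑' j, ∑' i, ‖inner ℂ (b' j) (S (b i))‖ₑ ^ 2 := ENNReal.tsum_comm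
    _ = ∑' j, ∑' i, ‖inner ℂ (b i) (S (b' j))‖ₑ ^ 2 := by
        refine tsum_congr fun j => tsum_congr fun i => ?_
        rw [← ContinuousLinearMap.adjoint_inner_left, hS.adjoint_eq, ← inner_conj_symm,
          RCLike.enorm_conj]
    _ = ∑' j, ‖S (b' j)‖ₑ ^ 2 := by simp_rw [b.tsum_enorm_inner_sq]

lemma posTrace_eq_tsum_expect {T : H →L[ℂ] H} (hT : T.IsPositive) {κ : Type*}
    (b : HilbertBasis κ ℂ H) : posTrace T = ∑' i, expect T (b i) :=
  tsum_expect_eq_tsum_expect hT (stdBasis H) b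

/-- With `S² = T`, the operator `T` is the norm convergent sum of the rank one operators
`|S e_i⟩⟨S e_i|`. -/
lemma isCompactOperator_of_posTrace_ne_top {T : H →L[ℂ] H} (hT : T.IsPositive)
    (h : posTrace T ≠ ∞) : IsCompactOperator T := by
  let e := stdBasis H
  obtain ⟨S, hS, rfl⟩ := exists_sqrt hT
  have hsum : Summable fun i => ‖S (e i)‖ ^ 2 := by
    rw [posTrace_eq_tsum_expect hT e] at h
    simp_rw [expect_sq hS] at h
    have := ENNReal.summable_toReal h
    simpa using this
  have hs2 : Summable fun i => InnerProductSpace.rankOne ℂ (S (e i)) (S (e i)) := by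
    refine Summable.of_norm (hsum.congr fun i => ?_)
    rw [InnerProductSpace.norm_rankOne, sq]
  have heq : S * S = ∑' i, InnerProductSpace.rankOne ℂ (S (e i)) (S (e i)) := by
    refine ContinuousLinearMap.ext fun x => ?_
    have h1 := hs2.hasSum.mapL (ContinuousLinearMap.apply ℂ H x)
    have h2 := (e.hasSum_repr (S x)).mapL S
    refine h2.unique ?_
    refine h1.of_forall_eq fun i => ?_
    rw [map_smul, HilbertBasis.repr_apply_apply, ContinuousLinearMap.apply_apply,
      InnerProductSpace.rankOne_apply, ← ContinuousLinearMap.adjoint_inner_left S, hS.adjoint_eq]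
  rw [heq]
  refine isClosed_setOfPred_isCompactOperator.mem_of_tendsto hs2.hasSum
    (Eventually.of_forall fun s => ?_)
  refine (compactOperator (RingHom.id ℂ) H H).sum_mem fun i _ => ?_
  change IsCompactOperator _
  rw [InnerProductSpace.rankOne_def']
  exact (isCompactOperator_of_locallyCompactSpace_rng
    (ContinuousLinearMap.toSpanSingleton ℂ (S (e i)))).comp_clm _

/-- An orthonormal basis `b` of eigenvectors of the operator `T`, with eigenvalues `p ≥ 0`. -/
structure IsEigenbasis {κ : Type*} (T : H →L[ℂ] H) (b : HilbertBasis κ ℂ H) (p : κ → ℝ) : Prop where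
  nonneg : ∀ k, 0 ≤ p k
  apply_eq : ∀ k, T (b k) = (p k : ℂ) • b k

/-- The spectral theorem for positive trace class operators. -/
lemma exists_isEigenbasis {T : H →L[ℂ] H} (hT : T.IsPositive) (h : posTrace T ≠ ∞) :
    ∃ (κ : Type) (b : HilbertBasis κ ℂ H) (p : κ → ℝ), IsEigenbasis T b p := by
  have hc := isCompactOperator_of_posTrace_ne_top hT h
  have hbot := ContinuousLinearMap.orthogonalComplement_iSup_eigenspaces_eq_bot hc hT.isSymmetric
  have horth := hT.isSymmetric.orthogonalFamily_eigenspaces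
  have : ∀ μ : ℂ, IsClosed (Module.End.eigenspace (T : Module.End ℂ H) μ : Set H) := fun μ => by
    have : (Module.End.eigenspace (T : Module.End ℂ H) μ : Set H) = {x | T x = μ • x} := by
      ext x; simp
    rw [this]
    exact isClosed_eq T.continuous (by fun_prop)
  have hcomp : ∀ μ : ℂ, CompleteSpace (Module.End.eigenspace (T : Module.End ℂ H) μ) := fun μ =>
    (this μ).completeSpace_coe
  choose w bw hbw using fun μ : ℂ =>
    exists_hilbertBasis ℂ (Module.End.eigenspace (T : Module.End ℂ H) μ)
  have hv := horth.orthonormal_sigma_orthonormal (v_family := fun μ => bw μ)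
    (fun μ => (bw μ).orthonormal)
  have hsp : (Submodule.span ℂ (Set.range fun a : Σ μ, w μ =>
      (Module.End.eigenspace (T : Module.End ℂ H) a.1).subtypeₗᵢ (bw a.1 a.2)))ᗮ = ⊥ := by
    rw [eq_bot_iff, ← hbot]
    intro x hx
    rw [Submodule.mem_orthogonal] at hx ⊢
    intro u hu
    induction hu using Submodule.iSup_induction' with
    | mem μ y hy =>
      have h1 := ((bw μ).hasSum_repr ⟨y, hy⟩).mapL
        (Module.End.eigenspace (T : Module.End ℂ H) μ).subtypeL
      have h2 := h1.mapL (innerSL ℂ x)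
      have h3 : inner ℂ x y = 0 := by
        refine h2.unique ?_
        refine hasSum_zero.of_forall_eq fun i => ?_
        have h4 : inner ℂ ((bw μ i : H)) x = 0 := hx _ (Submodule.subset_span ⟨⟨μ, i⟩, rfl⟩)
        have h5 : inner ℂ x ((bw μ i : H)) = 0 := by rw [← inner_conj_symm, h4, map_zero]
        rw [map_smul, map_smul, innerSL_apply_apply]
        exact (congrArg _ h5).trans (smul_zero _)
      rw [← inner_conj_symm, h3, map_zero]
    | zero => simp
    | add y z _ _ hy hz => rw [inner_add_left, hy, hz, add_zero]
  let b := HilbertBasis.mkOfOrthogonalEqBot hv hsp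
  have hb : ∀ a, T (b a) = a.1 • b a := fun a => by
    have : b a = (bw a.1 a.2 : H) := by simp [b]
    rw [this]
    exact Module.End.mem_eigenspace_iff.1 (bw a.1 a.2).2
  have hin : ∀ a, inner ℂ (b a) (T (b a)) = a.1 := fun a => by
    rw [hb, inner_smul_right, inner_self_eq_norm_sq_to_K, b.orthonormal.1]
    simp
  have hpos : ∀ a : (Σ μ, w μ), 0 ≤ a.1.re := fun a => by
    rw [← hin a]; exact hT.re_inner_nonneg_right _
  have him : ∀ a : (Σ μ, w μ), starRingEnd ℂ a.1 = a.1 := fun a => by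
    rw [← hin a, inner_conj_symm, hT.inner_left_eq_inner_right]
  refine ⟨_, b, fun a => a.1.re, hpos, fun a => ?_⟩
  rw [hb a, Complex.conj_eq_iff_re.1 (him a)]

namespace IsEigenbasis

variable {κ : Type*} {T : H →L[ℂ] H} {b : HilbertBasis κ ℂ H} {p : κ → ℝ}

lemma hasSum_apply (h : IsEigenbasis T b p) (x : H) :
    HasSum (fun k => ((p k : ℂ) * inner ℂ (b k) x) • b k) (T x) := by
  refine HasSum.of_forall_eq ((b.hasSum_repr x).mapL T) fun k => ?_
  rw [map_smul, h.apply_eq, HilbertBasis.repr_apply_apply, smul_smul, mul_comm]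

lemma hasSum_inner (h : IsEigenbasis T b p) (x y : H) :
    HasSum (fun k => (p k : ℂ) * (inner ℂ x (b k) * inner ℂ (b k) y)) (inner ℂ x (T y)) := by
  refine HasSum.of_forall_eq ((h.hasSum_apply y).mapL (innerSL ℂ x)) fun k => ?_
  rw [map_smul, innerSL_apply_apply, smul_eq_mul]
  ring

lemma hasSum_re_inner (h : IsEigenbasis T b p) (x : H) :
    HasSum (fun k => p k * ‖inner ℂ (b k) x‖ ^ 2) (inner ℂ x (T x)).re := by
  refine HasSum.of_forall_eq (Complex.hasSum_re (h.hasSum_inner x x)) fun k => ?_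
  rw [← inner_conj_symm x (b k), ← Complex.normSq_eq_conj_mul_self, ← Complex.ofReal_mul,
    Complex.ofReal_re, Complex.normSq_eq_norm_sq]

lemma expect_eq (h : IsEigenbasis T b p) (x : H) :
    expect T x = ∑' k, ENNReal.ofReal (p k) * ‖inner ℂ (b k) x‖ₑ ^ 2 := by
  have h1 := h.hasSum_re_inner x
  rw [expect, ← h1.tsum_eq, ENNReal.ofReal_tsum_of_nonneg _ h1.summable]
  · refine tsum_congr fun k => ?_
    rw [ENNReal.ofReal_mul (h.nonneg k), ENNReal.ofReal_pow (norm_nonneg _), ofReal_norm]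
  · exact fun k => mul_nonneg (h.nonneg k) (by positivity)

lemma expect_self (h : IsEigenbasis T b p) (k : κ) : expect T (b k) = ENNReal.ofReal (p k) := by
  rw [expect, h.apply_eq, inner_smul_right, inner_self_eq_norm_sq_to_K, b.orthonormal.1]
  simp

lemma tsum_eq_posTrace (h : IsEigenbasis T b p) (hT : T.IsPositive) :
    ∑' k, ENNReal.ofReal (p k) = posTrace T := by
  rw [posTrace_eq_tsum_expect hT b]
  exact tsum_congr fun k => (h.expect_self k).symm

lemma tsum_eq_one (h : IsEigenbasis T b p) (hT : IsDensityOperator T) :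
    ∑' k, ENNReal.ofReal (p k) = 1 := by
  rw [h.tsum_eq_posTrace hT.1, hT.2]

lemma hasSum_one (h : IsEigenbasis T b p) (hT : IsDensityOperator T) : HasSum p 1 := by
  have h1 := h.tsum_eq_one hT
  have h2 := ENNReal.hasSum_toReal (f := fun k => ENNReal.ofReal (p k)) (by simp [h1])
  rw [← ENNReal.tsum_toReal_eq (fun _ => ENNReal.ofReal_ne_top), h1] at h2
  simpa [ENNReal.toReal_ofReal (h.nonneg _)] using h2

/-- The trace of `T U` is evaluated in an orthonormal basis of eigenvectors of `T`. -/
lemma hasSum_opTrace (h : IsEigenbasis T b p) (hT : IsDensityOperator T) (U : H →L[ℂ] H) :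
    HasSum (fun k => (p k : ℂ) * inner ℂ (b k) (U (b k))) (opTrace (T ∘L U)) := by
  let e := stdBasis H
  let F : κ × basisSet H → ℂ := fun a =>
    (p a.1 : ℂ) * (inner ℂ (e a.2) (b a.1) * inner ℂ (U.adjoint (b a.1)) (e a.2))
  have hb1 : ∀ k, HasSum (fun i => p k * (‖inner ℂ (e i) (b k)‖ ^ 2
      + ‖inner ℂ (e i) (U.adjoint (b k))‖ ^ 2)) (p k * (‖b k‖ ^ 2 + ‖U.adjoint (b k)‖ ^ 2)) :=
    fun k => ((e.hasSum_norm_inner_sq _).add (e.hasSum_norm_inner_sq _)).mul_left _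
  have hsum : Summable fun a : κ × basisSet H => p a.1 * (‖inner ℂ (e a.2) (b a.1)‖ ^ 2
      + ‖inner ℂ (e a.2) (U.adjoint (b a.1))‖ ^ 2) := by
    refine (summable_prod_of_nonneg fun a => ?_).2 ⟨fun k => (hb1 k).summable, ?_⟩
    · exact mul_nonneg (h.nonneg _) (by positivity)
    · simp_rw [(hb1 _).tsum_eq]
      refine Summable.of_nonneg_of_le (fun k => mul_nonneg (h.nonneg _) (by positivity))
        (fun k => ?_) ((h.hasSum_one hT).summable.mul_right (1 + ‖U.adjoint‖ ^ 2))
      refine mul_le_mul_of_nonneg_left ?_ (h.nonneg k)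
      have := U.adjoint.le_opNorm (b k)
      rw [b.orthonormal.1] at this ⊢
      rw [mul_one] at this
      gcongr
      simp
  have hF : Summable F := by
    refine Summable.of_norm_bounded hsum fun a => ?_
    simp only [F]
    rw [norm_mul, Complex.norm_real, Real.norm_eq_abs, abs_of_nonneg (h.nonneg _), norm_mul,
      ← inner_conj_symm (U.adjoint (b a.1)) (e a.2), RCLike.norm_conj]
    refine mul_le_mul_of_nonneg_left ?_ (h.nonneg _)
    nlinarith [sq_nonneg (‖inner ℂ (e a.2) (b a.1)‖ - ‖inner ℂ (e a.2) (U.adjoint (b a.1))‖),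
      sq_nonneg ‖inner ℂ (e a.2) (b a.1)‖, sq_nonneg ‖inner ℂ (e a.2) (U.adjoint (b a.1))‖]
  have h1 : ∀ k, HasSum (fun i => F (k, i)) ((p k : ℂ) * inner ℂ (b k) (U (b k))) := fun k => by
    rw [← ContinuousLinearMap.adjoint_inner_left U]
    refine ((e.hasSum_inner_mul_inner (U.adjoint (b k)) (b k)).mul_left _).of_forall_eq fun i => ?_
    simp only [F]
    ring
  have h2 : ∀ i, HasSum (fun k => F (k, i)) (inner ℂ (e i) ((T ∘L U) (e i))) := fun i => by
    refine (h.hasSum_inner (e i) (U (e i))).of_forall_eq fun k => ?_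
    simp only [F]
    rw [ContinuousLinearMap.adjoint_inner_left]
  have h3 := hF.hasSum.prod_fiberwise h1
  have h4 := (Equiv.prodComm _ _).hasSum_iff.2 hF.hasSum
  have h5 := HasSum.prod_fiberwise h4 h2
  rw [opTrace, h5.tsum_eq]
  exact h3

lemma le_one (h : IsEigenbasis T b p) (hT : IsDensityOperator T) (k : κ) : p k ≤ 1 :=
  le_hasSum (h.hasSum_one hT) k fun j _ => h.nonneg j

lemma inner_basis_apply (h : IsEigenbasis T b p) (k : κ) (y : H) :
    inner ℂ (b k) (T y) = p k * inner ℂ (b k) y := by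
  refine (h.hasSum_inner (b k) y).unique ?_
  convert hasSum_single (f := fun j => (p j : ℂ) * (inner ℂ (b k) (b j) * inner ℂ (b j) y)) k ?_
    using 1
  · rw [inner_self_eq_norm_sq_to_K, b.orthonormal.1]
    simp
  · intro j hj
    rw [b.orthonormal.2 hj.symm]
    simp

end IsEigenbasis

lemma ofReal_norm_le_posTrace {T : H →L[ℂ] H} (hT : T.IsPositive) :
    ENNReal.ofReal ‖T‖ ≤ posTrace T := by
  rcases eq_or_ne (posTrace T) ∞ with h | h
  · simp [h]
  obtain ⟨κ, b, p, hb⟩ := exists_isEigenbasis hT h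
  rw [← ENNReal.ofReal_toReal h]
  refine ENNReal.ofReal_le_ofReal (T.opNorm_le_bound ENNReal.toReal_nonneg fun x => ?_)
  have h1 : ‖T x‖ₑ ^ 2 ≤ (posTrace T * ‖x‖ₑ) ^ 2 := by
    rw [mul_pow, ← b.tsum_enorm_inner_sq, ← b.tsum_enorm_inner_sq x, ← ENNReal.tsum_mul_left]
    refine ENNReal.tsum_le_tsum fun k => ?_
    rw [← hT.inner_left_eq_inner_right, hb.apply_eq, inner_smul_left, enorm_mul, mul_pow]
    gcongr
    rw [← hb.tsum_eq_posTrace hT]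
    refine le_trans (le_of_eq ?_) (ENNReal.le_tsum k)
    rw [Complex.conj_ofReal, ← ofReal_norm, Complex.norm_real, Real.norm_eq_abs,
      abs_of_nonneg (hb.nonneg k)]
  have h2 := (ENNReal.pow_le_pow_left_iff two_ne_zero).1 h1
  rw [← ofReal_norm, ← ofReal_norm, ← ENNReal.ofReal_toReal h,
    ← ENNReal.ofReal_mul ENNReal.toReal_nonneg] at h2
  exact (ENNReal.ofReal_le_ofReal_iff (by positivity)).1 h2

/-- An eigenvector of a self-adjoint operator is an eigenvector of its continuous functional
calculus. -/
lemma cfc_apply_of_eigenvector {T : H →L[ℂ] H} (hT : IsSelfAdjoint T) {f : ℝ → ℝ}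
    (hf : Continuous f) {x : H} {p : ℝ} (hx : T x = (p : ℂ) • x) :
    cfc f T x = (f p : ℂ) • x := by
  have hpoly : ∀ q : Polynomial ℝ, Polynomial.aeval T q x = ((q.eval p : ℝ) : ℂ) • x := fun q => by
    induction q using Polynomial.induction_on' with
    | add q r hq hr => rw [map_add, add_apply, hq, hr, Polynomial.eval_add,
        Complex.ofReal_add, add_smul]
    | monomial n a =>
      have hn : (T ^ n) x = ((p : ℂ) ^ n) • x := by
        induction n with
        | zero => simp
        | succ n ih => rw [pow_succ, mul_apply_eq_comp, hx, map_smul, ih, smul_smul, pow_succ']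
      rw [Polynomial.aeval_monomial, Polynomial.eval_monomial, mul_apply_eq_comp, hn, map_smul,
        Algebra.algebraMap_eq_smul_one]
      simp only [smul_apply, one_apply_eq_self, Complex.ofReal_mul,
        Complex.ofReal_pow]
      rw [← Complex.coe_smul, smul_smul, mul_comm]
  set M := max ‖T‖ |p|
  refine eq_of_sub_eq_zero (norm_le_zero_iff.1 (le_of_forall_pos_le_add fun ε hε => ?_))
  have hδ : 0 < ε / (2 * (‖x‖ + 1)) := by positivity
  obtain ⟨q, hq⟩ := exists_polynomial_near_of_continuousOn (-M) M f hf.continuousOn _ hδ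
  have h1 : ‖cfc f T - Polynomial.aeval T q‖ ≤ ε / (2 * (‖x‖ + 1)) := by
    rw [← cfc_polynomial q T, ← cfc_sub f q.eval T hf.continuousOn q.continuousOn]
    refine norm_cfc_le hδ.le fun y hy => ?_
    have : Nontrivial H := by
      by_contra hn
      rw [not_nontrivial_iff_subsingleton] at hn
      simp [spectrum.of_subsingleton] at hy
    have hy' : |y| ≤ M := (spectrum.norm_le_norm_of_mem hy).trans (le_max_left _ _)
    rw [norm_sub_rev]
    exact (hq y (abs_le.1 hy')).le
  have h2 : |q.eval p - f p| ≤ ε / (2 * (‖x‖ + 1)) := (hq p (abs_le.1 (le_max_right _ _))).le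
  have h3 : cfc f T x - (f p : ℂ) • x = (cfc f T - Polynomial.aeval T q) x
      + ((q.eval p - f p : ℝ) : ℂ) • x := by
    rw [sub_apply, hpoly, Complex.ofReal_sub, sub_smul]
    abel
  rw [h3, zero_add]
  calc _ ≤ ‖(cfc f T - Polynomial.aeval T q) x‖ + ‖((q.eval p - f p : ℝ) : ℂ) • x‖ :=
        norm_add_le _ _
    _ ≤ ε / (2 * (‖x‖ + 1)) * ‖x‖ + ε / (2 * (‖x‖ + 1)) * ‖x‖ := by
        refine add_le_add ((ContinuousLinearMap.le_opNorm _ _).trans (by gcongr)) ?_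
        rw [norm_smul, Complex.norm_real, Real.norm_eq_abs]
        gcongr
    _ = ε * (‖x‖ / (‖x‖ + 1)) := by field_simp; ring
    _ ≤ ε := mul_le_of_le_one_right hε.le ((div_le_one (by positivity)).2 (by linarith))

/-- The entropy is that of the eigenvalues, since the functional calculus is diagonal in an
eigenbasis. -/
lemma IsDensityOperator.vonNeumannEntropy_eq {T : H →L[ℂ] H} (hT : IsDensityOperator T)
    {κ : Type*} {b : HilbertBasis κ ℂ H} {p : κ → ℝ} (h : IsEigenbasis T b p) :
    vonNeumannEntropy T = ∑' k, ENNReal.ofReal (Real.negMulLog (p k)) := by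
  have hn : ‖T‖ ≤ 1 := by
    have := ofReal_norm_le_posTrace hT.1
    rwa [hT.2, ENNReal.ofReal_le_one] at this
  have hsp : ∀ x ∈ spectrum ℝ T, 0 ≤ Real.negMulLog x := fun x hx => by
    refine Real.negMulLog_nonneg ?_ ?_
    · exact spectrum_nonneg_of_nonneg ((ContinuousLinearMap.nonneg_iff_isPositive T).2 hT.1) hx
    · have : Nontrivial H := by
        by_contra hn
        rw [not_nontrivial_iff_subsingleton] at hn
        simp [spectrum.of_subsingleton] at hx
      exact (le_abs_self x).trans
        ((spectrum.norm_le_norm_of_mem hx).trans hn)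
  have hpos : (cfc Real.negMulLog T).IsPositive :=
    (ContinuousLinearMap.nonneg_iff_isPositive _).1 (cfc_nonneg hsp)
  rw [vonNeumannEntropy, posTrace_eq_tsum_expect hpos b]
  refine tsum_congr fun k => ?_
  rw [expect, cfc_apply_of_eigenvector hT.1.isSelfAdjoint Real.continuous_negMulLog
    (h.apply_eq k), inner_smul_right, inner_self_eq_norm_sq_to_K, b.orthonormal.1]
  simp

end Hilbert

/-! ### Plancherel's theorem for Fourier integrals -/

section Plancherel

open scoped FourierTransform

lemma enorm_sq_eq_lintegral {X : Type*} [MeasurableSpace X] {μ : Measure X} (g : Lp ℂ 2 μ) :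
    ‖g‖ₑ ^ 2 = ∫⁻ x, ‖g x‖ₑ ^ 2 ∂μ := by
  rw [Lp.enorm_def, eLpNorm_eq_lintegral_rpow_enorm_toReal two_ne_zero ENNReal.ofNat_ne_top,
    ← ENNReal.rpow_natCast, ← ENNReal.rpow_mul]
  simp

/-- On `L¹ ∩ L²` the Fourier transform of `L²` is given by the Fourier integral. -/
lemma coeFn_fourier_toLp {V : Type*} [NormedAddCommGroup V] [InnerProductSpace ℝ V]
    [FiniteDimensional ℝ V] [MeasurableSpace V] [BorelSpace V] {f : V → ℂ}
    (hf : Integrable f) (hf2 : MemLp f 2) : (𝓕 (hf2.toLp f) : Lp ℂ 2 (volume : Measure V))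
      =ᵐ[volume] 𝓕 f := by
  refine ae_eq_of_integral_contDiff_smul_eq
    ((Lp.memLp _).locallyIntegrable one_le_two) (Continuous.locallyIntegrable ?_) ?_
  · exact VectorFourier.fourierIntegral_continuous Real.continuous_fourierChar
      (by simpa using continuous_inner) hf
  · intro g hg hgc
    let G : SchwartzMap V ℂ := HasCompactSupport.toSchwartzMap (f := fun x => (g x : ℂ))
      (hgc.comp_left (g := fun x : ℝ => (x : ℂ)) (by simp))
      (Complex.ofRealCLM.contDiff.comp hg)
    have hG : ∀ x, G x = g x := fun x => rfl
    have h1 := congrArg (fun T => T G) (Lp.fourier_toTemperedDistribution_eq (hf2.toLp f))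
    simp only [TemperedDistribution.fourier_apply, Lp.toTemperedDistribution_apply] at h1
    have h2 : ∫ x, g x • (𝓕 (hf2.toLp f) : Lp ℂ 2 (volume : Measure V)) x
        = ∫ x, (𝓕 (G : V → ℂ)) x • f x := by
      rw [← SchwartzMap.fourier_coe]
      calc _ = _ := by simp_rw [← Complex.coe_smul, ← hG]
        _ = _ := h1.symm
        _ = _ := by
          refine integral_congr_ae ?_
          filter_upwards [hf2.coeFn_toLp] with x hx
          rw [hx]
    rw [h2]
    have h3 := VectorFourier.integral_fourierIntegral_smul_eq_flip (μ := volume) (ν := volume)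
      (L := innerₗ V) Real.continuous_fourierChar
      (by simpa using continuous_inner) (SchwartzMap.integrable G) hf
    rw [flip_innerₗ] at h3
    simp_rw [← Complex.coe_smul, ← hG]
    exact h3

lemma lintegral_enorm_fourier_sq {V : Type*} [NormedAddCommGroup V] [InnerProductSpace ℝ V]
    [FiniteDimensional ℝ V] [MeasurableSpace V] [BorelSpace V] {f : V → ℂ}
    (hf : Integrable f) (hf2 : MemLp f 2) :
    ∫⁻ w, ‖𝓕 f w‖ₑ ^ 2 = ∫⁻ x, ‖f x‖ₑ ^ 2 := by
  have h1 := (enorm_sq_eq_lintegral (𝓕 (hf2.toLp f))).symm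
  have h2 := (enorm_sq_eq_lintegral (hf2.toLp f)).symm
  rw [← ofReal_norm, Lp.norm_fourier_eq, ofReal_norm, ← h2] at h1
  calc _ = _ := lintegral_congr_ae ?_
    _ = _ := h1
    _ = _ := lintegral_congr_ae ?_
  · filter_upwards [coeFn_fourier_toLp hf hf2] with x hx
    rw [hx]
  · filter_upwards [hf2.coeFn_toLp] with x hx
    rw [hx]

/-- Plancherel's theorem for the Fourier integral `∫ exp (-i p · x) f x dx` on `ℝ^ι`. -/
lemma lintegral_enorm_integral_exp_sq {ι : Type} [Fintype ι] {f : (ι → ℝ) → ℂ}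
    (hf : Integrable f) (hf2 : MemLp f 2) :
    ∫⁻ p : ι → ℝ, ‖∫ x, Complex.exp (-((∑ k, p k * x k : ℝ) : ℂ) * Complex.I) * f x‖ₑ ^ 2
      = ENNReal.ofReal (2 * Real.pi) ^ Fintype.card ι * ∫⁻ x, ‖f x‖ₑ ^ 2 := by
  have mp := EuclideanSpace.volume_preserving_symm_measurableEquiv_toLp ι
  set F : (ι → ℝ) → ℝ≥0∞ := fun p =>
    ‖∫ x, Complex.exp (-((∑ k, p k * x k : ℝ) : ℂ) * Complex.I) * f x‖ₑ ^ 2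
  have h1 := lintegral_enorm_fourier_sq (mp.integrable_comp_of_integrable hf)
    (hf2.comp_measurePreserving mp)
  have h2 : ∀ w : EuclideanSpace ℝ ι, ‖𝓕 (f ∘ (MeasurableEquiv.toLp 2 (ι → ℝ)).symm) w‖ₑ ^ 2
      = F ((2 * Real.pi) • (MeasurableEquiv.toLp 2 (ι → ℝ)).symm w) := fun w => by
    simp only [F]
    rw [Real.fourier_eq, ← mp.integral_comp (MeasurableEquiv.measurableEmbedding _)
      (fun x => Complex.exp (-((∑ k, ((2 * Real.pi) •
        (MeasurableEquiv.toLp 2 (ι → ℝ)).symm w) k * x k : ℝ) : ℂ) * Complex.I) * f x)]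
    congr 2
    refine integral_congr_ae (ae_of_all _ fun x => ?_)
    simp only [Circle.smul_def, Real.fourierChar_apply, Function.comp_apply, smul_eq_mul]
    congr 3
    rw [PiLp.inner_apply]
    simp only [MeasurableEquiv.coe_toLp_symm, Pi.smul_apply, smul_eq_mul, RCLike.inner_apply,
      conj_trivial]
    push_cast
    rw [mul_neg, Finset.mul_sum]
    simp_rw [mul_assoc]
  simp_rw [h2, Function.comp_apply] at h1
  rw [mp.lintegral_comp_emb (MeasurableEquiv.measurableEmbedding _)
    (fun w => F ((2 * Real.pi) • w)), mp.lintegral_comp_emb (MeasurableEquiv.measurableEmbedding _)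
    (fun x => ‖f x‖ₑ ^ 2)] at h1
  have hpi : 2 * Real.pi ≠ 0 := by positivity
  have h3 := congrArg (fun μ : Measure (ι → ℝ) => ∫⁻ p, F p ∂μ)
    (Measure.map_addHaar_smul (volume : Measure (ι → ℝ)) hpi)
  have hemb : MeasurableEmbedding fun w : ι → ℝ => (2 * Real.pi) • w :=
    (MeasurableEquiv.smul₀ (2 * Real.pi) hpi).measurableEmbedding
  rw [hemb.lintegral_map, h1, lintegral_smul_measure, Module.finrank_fintype_fun_eq_card,
    abs_of_pos (by positivity), ENNReal.ofReal_inv_of_pos (by positivity),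
    ENNReal.ofReal_pow (by positivity), smul_eq_mul] at h3
  rw [h3, ← mul_assoc, ENNReal.mul_inv_cancel, one_mul]
  · exact pow_ne_zero _ (by simp [Real.pi_pos])
  · exact ENNReal.pow_ne_top ENNReal.ofReal_ne_top

end Plancherel

/-! ### Weyl relations and strong continuity of the displacement operators -/

section Displacement

variable {ι : Type} [Fintype ι]

lemma enorm_add_sq_le {E : Type*} [SeminormedAddCommGroup E] (x y : E) :
    ‖x + y‖ₑ ^ 2 ≤ 2 * ‖x‖ₑ ^ 2 + 2 * ‖y‖ₑ ^ 2 := by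
  have h : ‖x + y‖ ^ 2 ≤ 2 * ‖x‖ ^ 2 + 2 * ‖y‖ ^ 2 := by
    have := norm_add_le x y
    nlinarith [sq_nonneg (‖x‖ - ‖y‖), norm_nonneg (x + y)]
  have h2 := ENNReal.ofReal_le_ofReal h
  rw [ENNReal.ofReal_add (by positivity) (by positivity), ENNReal.ofReal_mul zero_le_two,
    ENNReal.ofReal_mul zero_le_two] at h2
  simpa only [ENNReal.ofReal_pow (norm_nonneg _), ofReal_norm, ENNReal.ofReal_ofNat] using h2

lemma coeFn_displacement (ξ : PhaseSpace ι) (ψ : ModeSpace ι) :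
    displacement ξ ψ =ᵐ[volume] fun x => displacementPhase ξ x * ψ (x - fun k => ξ (k, 0)) :=
  (memLp_displacement ξ ψ).coeFn_toLp

lemma ae_shift {P : (ι → ℝ) → Prop} (h : ∀ᵐ x, P x) (q : ι → ℝ) : ∀ᵐ x, P (x - q) :=
  (measurePreserving_shift q).quasiMeasurePreserving.ae h

/-- The Weyl relations. -/
lemma displacement_displacement (ξ η : PhaseSpace ι) (ψ : ModeSpace ι) :
    displacement ξ (displacement η ψ)
      = Complex.exp (((∑ k, (ξ (k, 1) * η (k, 0) - ξ (k, 0) * η (k, 1)) / 2 : ℝ) : ℂ) * Complex.I) •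
        displacement (ξ + η) ψ := by
  refine Lp.ext ?_
  filter_upwards [coeFn_displacement ξ (displacement η ψ), coeFn_displacement (ξ + η) ψ,
    ae_shift (coeFn_displacement η ψ) (fun k => ξ (k, 0)), Lp.coeFn_smul (Complex.exp
      (((∑ k, (ξ (k, 1) * η (k, 0) - ξ (k, 0) * η (k, 1)) / 2 : ℝ) : ℂ) * Complex.I))
      (displacement (ξ + η) ψ)] with x h1 h2 h3 h4
  rw [h1, h3, h4, Pi.smul_apply, h2, smul_eq_mul, ← mul_assoc, ← mul_assoc]
  congr 1
  · simp only [displacementPhase, ← Complex.exp_add]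
    congr 1
    simp only [← add_mul, ← Complex.ofReal_add]
    rw [← Finset.sum_add_distrib, ← Finset.sum_add_distrib]
    congr 2
    refine Finset.sum_congr rfl fun k _ => ?_
    simp only [Pi.sub_apply, Pi.add_apply]
    ring
  · congr 1
    ext k
    simp only [Pi.sub_apply, Pi.add_apply]
    ring

lemma displacement_zero (ψ : ModeSpace ι) : displacement 0 ψ = ψ := by
  refine Lp.ext ?_
  filter_upwards [coeFn_displacement 0 ψ] with x h1
  rw [h1]
  have : (x - fun k => (0 : PhaseSpace ι) (k, 0)) = x := by ext k; simp
  rw [this]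
  simp [displacementPhase]

lemma displacement_neg_apply_self (ξ : PhaseSpace ι) (ψ : ModeSpace ι) :
    displacement (-ξ) (displacement ξ ψ) = ψ := by
  rw [displacement_displacement, neg_add_cancel, displacement_zero]
  have : (∑ k, ((-ξ) (k, 1) * ξ (k, 0) - (-ξ) (k, 0) * ξ (k, 1)) / 2 : ℝ) = 0 :=
    Finset.sum_eq_zero fun k _ => by simp only [Pi.neg_apply]; ring
  rw [this]
  simp

lemma displacement_apply_neg_self (ξ : PhaseSpace ι) (ψ : ModeSpace ι) :
    displacement ξ (displacement (-ξ) ψ) = ψ := by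
  simpa using displacement_neg_apply_self (-ξ) ψ

lemma norm_displacement (ξ : PhaseSpace ι) (ψ : ModeSpace ι) : ‖displacement ξ ψ‖ = ‖ψ‖ := by
  have h : ‖displacement ξ ψ‖ₑ ^ 2 = ‖ψ‖ₑ ^ 2 := by
    rw [enorm_sq_eq_lintegral, enorm_sq_eq_lintegral,
      ← (measurePreserving_shift fun k => ξ (k, 0)).lintegral_comp_emb
        (MeasurableEquiv.subRight _).measurableEmbedding (fun x => ‖ψ x‖ₑ ^ 2)]
    refine lintegral_congr_ae ?_
    filter_upwards [coeFn_displacement ξ ψ] with x h1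
    rw [h1, enorm_mul, ← ofReal_norm (displacementPhase ξ x), norm_displacementPhase]
    simp
  have h2 := (ENNReal.pow_right_strictMono two_ne_zero).injective h
  rwa [← ofReal_norm, ← ofReal_norm,
    ENNReal.ofReal_eq_ofReal_iff (norm_nonneg _) (norm_nonneg _)] at h2

/-- The displacement operators are unitary. -/
def displacementEquiv (ξ : PhaseSpace ι) : ModeSpace ι ≃ₗᵢ[ℂ] ModeSpace ι where
  toFun := displacement ξ
  invFun := displacement (-ξ)
  left_inv := displacement_neg_apply_self ξ
  right_inv := displacement_apply_neg_self ξ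
  map_add' := map_add _
  map_smul' := map_smul _
  norm_map' := norm_displacement ξ

lemma displacementEquiv_apply (ξ : PhaseSpace ι) (ψ : ModeSpace ι) :
    displacementEquiv ξ ψ = displacement ξ ψ := rfl

lemma inner_displacement_displacement (ξ : PhaseSpace ι) (ψ χ : ModeSpace ι) :
    inner ℂ (displacement ξ ψ) (displacement ξ χ) = inner ℂ ψ χ :=
  (displacementEquiv ξ).inner_map_map ψ χ

lemma inner_displacement_right (ξ : PhaseSpace ι) (ψ χ : ModeSpace ι) :
    inner ℂ ψ (displacement ξ χ) = inner ℂ (displacement (-ξ) ψ) χ := by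
  rw [← inner_displacement_displacement ξ (displacement (-ξ) ψ), displacement_apply_neg_self]

lemma adjoint_displacement (ξ : PhaseSpace ι) :
    (displacement ξ).adjoint = displacement (-ξ) := by
  refine ContinuousLinearMap.ext fun ψ => ext_inner_right ℂ fun χ => ?_
  rw [ContinuousLinearMap.adjoint_inner_left, inner_displacement_right]

lemma continuous_displacementPhase_left (x : ι → ℝ) :
    Continuous fun ξ : PhaseSpace ι => displacementPhase ξ x := by
  unfold displacementPhase
  fun_prop

/-- The displacement operators are strongly continuous. -/
lemma continuous_displacement_apply (ψ : ModeSpace ι) :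
    Continuous fun ξ : PhaseSpace ι => displacement ξ ψ := by
  let τ : (ι → ℝ) → ModeSpace ι := fun q =>
    Lp.compMeasurePreserving (fun x => x - q) (measurePreserving_shift q) ψ
  have hτ : Continuous τ := by
    refine Continuous.compMeasurePreservingLp (f := fun _ => ψ)
      (g := fun q : ι → ℝ => (⟨fun x => x - q, by fun_prop⟩ : C(ι → ℝ, ι → ℝ)))
      continuous_const ?_ measurePreserving_shift (by simp)
    exact (ContinuousMap.curry (⟨fun a : (ι → ℝ) × (ι → ℝ) => a.2 - a.1, by fun_prop⟩ :
      C((ι → ℝ) × (ι → ℝ), ι → ℝ))).continuous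
  have hτc : ∀ q, τ q =ᵐ[volume] fun x => ψ (x - q) := fun q =>
    Lp.coeFn_compMeasurePreserving _ _
  rw [continuous_iff_continuousAt]
  intro ξ₀
  let χ := τ fun k => ξ₀ (k, 0)
  have h1 : Tendsto (fun ξ : PhaseSpace ι => ‖τ (fun k => ξ (k, 0)) - χ‖ₑ ^ 2) (𝓝 ξ₀) (𝓝 0) := by
    have : Continuous fun ξ : PhaseSpace ι => ‖τ (fun k => ξ (k, 0)) - χ‖ₑ ^ 2 :=
      (ENNReal.continuous_pow 2).comp (by fun_prop)
    simpa [χ] using this.tendsto ξ₀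
  have h2 : Tendsto (fun ξ : PhaseSpace ι =>
      ∫⁻ x, ‖displacementPhase ξ x - displacementPhase ξ₀ x‖ₑ ^ 2 * ‖χ x‖ₑ ^ 2) (𝓝 ξ₀) (𝓝 0) := by
    have := tendsto_lintegral_filter_of_dominated_convergence (μ := volume) (l := 𝓝 ξ₀)
      (F := fun ξ : PhaseSpace ι => fun x =>
        ‖displacementPhase ξ x - displacementPhase ξ₀ x‖ₑ ^ 2 * ‖χ x‖ₑ ^ 2) (f := fun _ => 0)
      (fun x => 4 * ‖χ x‖ₑ ^ 2) ?_ ?_ ?_ ?_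
    · simpa using this
    · refine Eventually.of_forall fun ξ => ?_
      refine Measurable.mul ?_ ((Lp.stronglyMeasurable χ).enorm.pow_const _)
      exact ((continuous_displacementPhase ξ).sub
        (continuous_displacementPhase ξ₀)).enorm.measurable.pow_const 2
    · refine Eventually.of_forall fun ξ => ae_of_all _ fun x => ?_
      gcongr
      have : ‖displacementPhase ξ x - displacementPhase ξ₀ x‖ₑ ≤ 2 := by
        rw [← ofReal_norm, ENNReal.ofReal_le_ofNat]
        refine (norm_sub_le _ _).trans ?_
        rw [norm_displacementPhase, norm_displacementPhase]
        norm_num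
      calc _ ≤ (2 : ℝ≥0∞) ^ 2 := by gcongr
        _ = 4 := by norm_num
    · rw [lintegral_const_mul' _ _ (by simp), ← enorm_sq_eq_lintegral]
      exact ENNReal.mul_ne_top (by simp) (by simp)
    · refine ae_of_all _ fun x => ?_
      have hc : Continuous fun ξ : PhaseSpace ι =>
          ‖displacementPhase ξ x - displacementPhase ξ₀ x‖ₑ ^ 2 := by
        have := continuous_displacementPhase_left (ι := ι) x
        exact (ENNReal.continuous_pow 2).comp (by fun_prop)
      have h3 := ENNReal.Tendsto.mul_const (b := ‖χ x‖ₑ ^ 2) (hc.tendsto ξ₀) (Or.inr (by simp))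
      simpa using h3
  have h3 : ∀ ξ : PhaseSpace ι, ‖displacement ξ ψ - displacement ξ₀ ψ‖ₑ ^ 2
      ≤ 2 * ‖τ (fun k => ξ (k, 0)) - χ‖ₑ ^ 2
        + 2 * ∫⁻ x, ‖displacementPhase ξ x - displacementPhase ξ₀ x‖ₑ ^ 2 * ‖χ x‖ₑ ^ 2 := by
    intro ξ
    rw [enorm_sq_eq_lintegral, enorm_sq_eq_lintegral, ← lintegral_const_mul' _ _ (by simp),
      ← lintegral_const_mul' _ _ (by simp), ← lintegral_add_left']
    · refine lintegral_mono_ae ?_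
      filter_upwards [Lp.coeFn_sub (displacement ξ ψ) (displacement ξ₀ ψ),
        Lp.coeFn_sub (τ fun k => ξ (k, 0)) χ, coeFn_displacement ξ ψ, coeFn_displacement ξ₀ ψ,
        hτc fun k => ξ (k, 0), hτc fun k => ξ₀ (k, 0)] with x e1 e2 e3 e4 e5 e6
      change χ x = _ at e6
      rw [e1, e2, Pi.sub_apply, Pi.sub_apply, e3, e4, ← e5, ← e6]
      have : displacementPhase ξ x * τ (fun k => ξ (k, 0)) x - displacementPhase ξ₀ x * χ x
          = displacementPhase ξ x * (τ (fun k => ξ (k, 0)) x - χ x)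
            + (displacementPhase ξ x - displacementPhase ξ₀ x) * χ x := by ring
      rw [this]
      refine (enorm_add_sq_le _ _).trans ?_
      rw [enorm_mul, enorm_mul, mul_pow, mul_pow, ← ofReal_norm (displacementPhase ξ x),
        norm_displacementPhase]
      simp
    · fun_prop
  have h4 : Tendsto (fun ξ : PhaseSpace ι => ‖displacement ξ ψ - displacement ξ₀ ψ‖ₑ ^ 2)
      (𝓝 ξ₀) (𝓝 0) := by
    refine tendsto_of_tendsto_of_tendsto_of_le_of_le tendsto_const_nhds ?_ (fun _ => zero_le) h3
    simpa using (ENNReal.Tendsto.const_mul h1 (Or.inr (by simp : (2 : ℝ≥0∞) ≠ ∞))).add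
      (ENNReal.Tendsto.const_mul h2 (Or.inr (by simp : (2 : ℝ≥0∞) ≠ ∞)))
  rw [ContinuousAt, tendsto_iff_edist_tendsto_0]
  have h5 := (ENNReal.continuous_rpow_const (y := 2⁻¹)).tendsto (0 : ℝ≥0∞) |>.comp h4
  rw [ENNReal.zero_rpow_of_pos (by norm_num)] at h5
  refine h5.congr fun ξ => ?_
  rw [Function.comp_apply, ← ENNReal.rpow_natCast, ← ENNReal.rpow_mul, edist_eq_enorm_sub]
  norm_num

end Displacement

/-! ### Moyal's identity -/

section Moyal

variable {ι : Type} [Fintype ι]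

lemma measurePreserving_reindex {α β : Type*} [Fintype α] [Fintype β] (e : α ≃ β) :
    MeasurePreserving (fun (f : β → ℝ) (a : α) => f (e a)) volume volume :=
  (volume_measurePreserving_piCongrLeft (fun _ => ℝ) e).symm

/-- The point of phase space with positions `q` and momenta `p`. -/
def phasePoint (w : (ι → ℝ) × (ι → ℝ)) : PhaseSpace ι := fun k => ![w.1 k.1, w.2 k.1] k.2

lemma phasePoint_apply_zero (w : (ι → ℝ) × (ι → ℝ)) (k : ι) : phasePoint w (k, 0) = w.1 k := rfl

lemma phasePoint_apply_one (w : (ι → ℝ) × (ι → ℝ)) (k : ι) : phasePoint w (k, 1) = w.2 k := rfl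

lemma measurePreserving_phasePoint :
    MeasurePreserving (phasePoint (ι := ι)) (volume.prod volume) volume := by
  let e : ι × Fin 2 ≃ ι ⊕ ι :=
    { toFun := fun k => ![Sum.inl k.1, Sum.inr k.1] k.2
      invFun := Sum.elim (fun k => (k, 0)) (fun k => (k, 1))
      left_inv := fun ⟨k, b⟩ => by fin_cases b <;> rfl
      right_inv := fun k => by cases k <;> rfl }
  have h := (measurePreserving_reindex e).comp
    (volume_measurePreserving_sumPiEquivProdPi fun _ : ι ⊕ ι => ℝ).symm
  have heq : ((fun (f : ι ⊕ ι → ℝ) (a : ι × Fin 2) => f (e a)) ∘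
      (MeasurableEquiv.sumPiEquivProdPi fun _ : ι ⊕ ι => ℝ).symm) = phasePoint := by
    funext w kb
    obtain ⟨k, b⟩ := kb
    fin_cases b <;> rfl
  rw [heq] at h
  exact h

/-- A matrix coefficient of the displacement operators is, in the momentum variable and up to a
phase, a Fourier integral. -/
lemma enorm_inner_displacement_phasePoint (φ ψ : ModeSpace ι) (q p : ι → ℝ) :
    ‖inner ℂ (displacement (phasePoint (q, p)) φ) ψ‖ₑ
      = ‖∫ x, Complex.exp (-((∑ k, p k * x k : ℝ) : ℂ) * Complex.I)
        * (starRingEnd ℂ (φ (x - q)) * ψ x)‖ₑ := by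
  set θ : ℝ := ∑ k, p k * q k / 2
  have h : inner ℂ (displacement (phasePoint (q, p)) φ) ψ = Complex.exp (θ * Complex.I) *
      ∫ x, Complex.exp (-((∑ k, p k * x k : ℝ) : ℂ) * Complex.I)
        * (starRingEnd ℂ (φ (x - q)) * ψ x) := by
    rw [L2.inner_def, ← integral_const_mul]
    refine integral_congr_ae ?_
    filter_upwards [coeFn_displacement (phasePoint (q, p)) φ] with x hx
    have h0 : starRingEnd ℂ (displacementPhase (phasePoint (q, p)) x)
        = Complex.exp (θ * Complex.I)
          * Complex.exp (-((∑ k, p k * x k : ℝ) : ℂ) * Complex.I) := ?_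
    · rw [hx, RCLike.inner_apply, map_mul, h0]
      simp only [phasePoint_apply_zero]
      ring
    simp only [phasePoint_apply_zero, phasePoint_apply_one, displacementPhase]
    rw [← Complex.exp_conj, ← Complex.exp_add, map_mul, Complex.conj_ofReal, Complex.conj_I, mul_neg,
      ← neg_mul, ← add_mul, ← Complex.ofReal_neg, ← Complex.ofReal_neg, ← Complex.ofReal_add]
    congr 3
    simp only [θ, mul_sub, Finset.sum_sub_distrib, mul_div_assoc]
    ring
  rw [h, enorm_mul, ← ofReal_norm (Complex.exp _), Complex.norm_exp_ofReal_mul_I]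
  simp

lemma continuous_inner_displacement (φ ψ : ModeSpace ι) :
    Continuous fun ξ : PhaseSpace ι => inner ℂ (displacement ξ φ) ψ :=
  (continuous_displacement_apply φ).inner continuous_const

/-- The orthogonality relation of the displacement operators (Moyal's identity). -/
theorem lintegral_enorm_inner_displacement_sq (φ ψ : ModeSpace ι) :
    ∫⁻ ξ : PhaseSpace ι, ‖inner ℂ (displacement ξ φ) ψ‖ₑ ^ 2
      = ENNReal.ofReal (2 * Real.pi) ^ Fintype.card ι * (‖φ‖ₑ ^ 2 * ‖ψ‖ₑ ^ 2) := by
  have hcont := continuous_inner_displacement φ ψ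
  have hm : Measurable fun ξ : PhaseSpace ι => ‖inner ℂ (displacement ξ φ) ψ‖ₑ ^ 2 :=
    hcont.enorm.measurable.pow_const 2
  rw [← measurePreserving_phasePoint.lintegral_comp hm,
    lintegral_prod (fun a => ‖inner ℂ (displacement (phasePoint a) φ) ψ‖ₑ ^ 2)
      (hm.comp measurePreserving_phasePoint.measurable).aemeasurable]
  have hφ : Measurable φ := (Lp.stronglyMeasurable φ).measurable
  have hψ : Measurable ψ := (Lp.stronglyMeasurable ψ).measurable
  have hF : Measurable fun w : (ι → ℝ) × (ι → ℝ) =>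
      ‖starRingEnd ℂ (φ (w.2 - w.1)) * ψ w.2‖ₑ ^ 2 := by
    have : Measurable fun w : (ι → ℝ) × (ι → ℝ) => φ (w.2 - w.1) :=
      hφ.comp (measurable_snd.sub measurable_fst)
    have h2 : Measurable fun w : (ι → ℝ) × (ι → ℝ) => starRingEnd ℂ (φ (w.2 - w.1)) :=
      Complex.continuous_conj.measurable.comp this
    exact (h2.mul (hψ.comp measurable_snd)).enorm.pow_const 2
  have htot : ∫⁻ q : ι → ℝ, ∫⁻ x, ‖starRingEnd ℂ (φ (x - q)) * ψ x‖ₑ ^ 2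
      = ‖φ‖ₑ ^ 2 * ‖ψ‖ₑ ^ 2 := by
    rw [lintegral_lintegral_swap hF.aemeasurable]
    simp_rw [enorm_mul, RCLike.enorm_conj, mul_pow]
    have : ∀ x : ι → ℝ, ∫⁻ q, ‖φ (x - q)‖ₑ ^ 2 * ‖ψ x‖ₑ ^ 2 = ‖φ‖ₑ ^ 2 * ‖ψ x‖ₑ ^ 2 := fun x => by
      rw [lintegral_mul_const' _ _ (by simp), enorm_sq_eq_lintegral φ,
        lintegral_sub_left_eq_self (fun q => ‖φ q‖ₑ ^ 2) x]
    simp_rw [this]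
    rw [lintegral_const_mul' _ _ (by simp), ← enorm_sq_eq_lintegral]
  have hae : ∀ᵐ q : ι → ℝ, ∫⁻ x, ‖starRingEnd ℂ (φ (x - q)) * ψ x‖ₑ ^ 2 < ∞ := by
    refine ae_lt_top hF.lintegral_prod_right' ?_
    rw [htot]
    exact ENNReal.mul_ne_top (by simp) (by simp)
  rw [← htot, ← lintegral_const_mul _ hF.lintegral_prod_right']
  refine lintegral_congr_ae ?_
  filter_upwards [hae] with q hq
  simp only [enorm_inner_displacement_phasePoint]
  have hφq : MemLp (fun x => starRingEnd ℂ (φ (x - q))) 2 :=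
    ((Lp.memLp φ).comp_measurePreserving (measurePreserving_shift q)).star
  refine lintegral_enorm_integral_exp_sq (hφq.integrable_mul (Lp.memLp ψ)) ?_
  refine ⟨(hφq.integrable_mul (Lp.memLp ψ)).1, ?_⟩
  rw [eLpNorm_lt_top_iff_lintegral_rpow_enorm_lt_top two_ne_zero ENNReal.ofNat_ne_top]
  simpa using hq

end Moyal

/-! ### Entropy bounds from resolutions of the identity and from mixtures -/

section EntropyBounds

variable {H : Type} [NormedAddCommGroup H] [InnerProductSpace ℂ H] [CompleteSpace H]

/-- The scalar inequality `η(p) + p ≤ p (-log r) + r`, where `η(p) = -p log p`. -/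
lemma negMulLog_add_le {p r : ℝ} (hp : 0 ≤ p) (hr : 0 < r) :
    Real.negMulLog p + p ≤ p * (-Real.log r) + r := by
  rcases hp.eq_or_lt with rfl | hp
  · simp [hr.le]
  · have h := Real.log_le_sub_one_of_pos (div_pos hr hp)
    rw [Real.log_div hr.ne' hp.ne'] at h
    have h2 : p * (Real.log r - Real.log p) ≤ p * (r / p - 1) := by gcongr
    rw [mul_sub, mul_sub, mul_div_cancel₀ _ hp.ne'] at h2
    rw [Real.negMulLog]
    linarith

/-- Klein's inequality for a continuous resolution of the identity `∫ |v x⟩⟨v x| dμ = 1` and a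
reference density `r` of total mass at most one. -/
theorem vonNeumannEntropy_le_lintegral {X : Type*} [MeasurableSpace X] {μ : Measure X}
    [TopologicalSpace.SeparableSpace H] {ρ : H →L[ℂ] H} (hρ : IsDensityOperator ρ) {v : X → H}
    (hv : ∀ ψ, Measurable fun x => inner ℂ ψ (v x))
    (hframe : ∀ ψ, ∫⁻ x, ‖inner ℂ ψ (v x)‖ₑ ^ 2 ∂μ = ‖ψ‖ₑ ^ 2) (hnorm : ∀ x, ‖v x‖ ≤ 1)
    {r : X → ℝ} (hr0 : ∀ x, 0 ≤ r x) (hr1 : ∀ x, r x ≤ 1) (hrm : Measurable r)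
    (hr : ∫⁻ x, ENNReal.ofReal (r x) ∂μ ≤ 1) (hz : ∀ x, r x = 0 → expect ρ (v x) = 0) :
    vonNeumannEntropy ρ ≤ ∫⁻ x, expect ρ (v x) * ENNReal.ofReal (-Real.log (r x)) ∂μ := by
  obtain ⟨κ, b, p, h⟩ := exists_isEigenbasis hρ.1 (by simp [hρ.2])
  have := b.countable
  rw [hρ.vonNeumannEntropy_eq h]
  -- both sides are augmented by `∑ p_k = 1 ≥ ∫ r dμ`, as `negMulLog_add_le` requires
  refine (ENNReal.add_le_add_iff_right ENNReal.one_ne_top).1 ?_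
  have hw : ∀ k, Measurable fun x => ‖inner ℂ (b k) (v x)‖ₑ ^ 2 := fun k =>
    (hv (b k)).enorm.pow_const 2
  have hexp : Measurable fun x => expect ρ (v x) := by
    simp_rw [h.expect_eq]
    exact Measurable.tsum fun k => (hw k).const_mul _
  have hlog : Measurable fun x => ENNReal.ofReal (-Real.log (r x)) :=
    (Real.measurable_log.comp hrm).neg.ennreal_ofReal
  have hm : Measurable fun x => expect ρ (v x) * ENNReal.ofReal (-Real.log (r x)) := hexp.mul hlog
  have hmk : ∀ k, Measurable fun x => (ENNReal.ofReal (p k) * ‖inner ℂ (b k) (v x)‖ₑ ^ 2)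
      * ENNReal.ofReal (-Real.log (r x)) + ‖inner ℂ (b k) (v x)‖ₑ ^ 2 * ENNReal.ofReal (r x) :=
    fun k => (((hw k).const_mul _).mul hlog).add ((hw k).mul hrm.ennreal_ofReal)
  have hpt : ∀ k x, ‖inner ℂ (b k) (v x)‖ₑ ^ 2
        * (ENNReal.ofReal (Real.negMulLog (p k)) + ENNReal.ofReal (p k))
      ≤ (ENNReal.ofReal (p k) * ‖inner ℂ (b k) (v x)‖ₑ ^ 2) * ENNReal.ofReal (-Real.log (r x))
        + ‖inner ℂ (b k) (v x)‖ₑ ^ 2 * ENNReal.ofReal (r x) := fun k x => by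
    have hη := Real.negMulLog_nonneg (h.nonneg k) (h.le_one hρ k)
    rcases (hr0 x).eq_or_lt with h0 | h0
    · have h1 := hz x h0.symm
      rw [h.expect_eq, ENNReal.tsum_eq_zero] at h1
      rcases mul_eq_zero.1 (h1 k) with h2 | h2
      · have : p k = 0 := le_antisymm (ENNReal.ofReal_eq_zero.1 h2) (h.nonneg k)
        simp [this]
      · simp [h2]
    · rw [mul_comm (ENNReal.ofReal (p k)), mul_assoc, ← mul_add]
      refine mul_le_mul_of_nonneg_left ?_ zero_le
      have hlog0 : 0 ≤ -Real.log (r x) := by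
        have := Real.log_nonpos (hr0 x) (hr1 x)
        linarith
      rw [← ENNReal.ofReal_add hη (h.nonneg k), ← ENNReal.ofReal_mul (h.nonneg k),
        ← ENNReal.ofReal_add (mul_nonneg (h.nonneg k) hlog0) (hr0 x)]
      exact ENNReal.ofReal_le_ofReal (negMulLog_add_le (h.nonneg k) h0)
  calc _ = ∑' k, (ENNReal.ofReal (Real.negMulLog (p k)) + ENNReal.ofReal (p k)) := by
        rw [ENNReal.tsum_add, h.tsum_eq_one hρ]
    _ = ∑' k, ∫⁻ x, ‖inner ℂ (b k) (v x)‖ₑ ^ 2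
        * (ENNReal.ofReal (Real.negMulLog (p k)) + ENNReal.ofReal (p k)) ∂μ := by
        refine tsum_congr fun k => ?_
        rw [lintegral_mul_const _ (hw k), hframe, ← ofReal_norm, b.orthonormal.1]
        simp
    _ ≤ ∑' k, ∫⁻ x, ((ENNReal.ofReal (p k) * ‖inner ℂ (b k) (v x)‖ₑ ^ 2)
          * ENNReal.ofReal (-Real.log (r x))
        + ‖inner ℂ (b k) (v x)‖ₑ ^ 2 * ENNReal.ofReal (r x)) ∂μ :=
        ENNReal.tsum_le_tsum fun k => lintegral_mono fun x => hpt k x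
    _ = ∫⁻ x, (expect ρ (v x) * ENNReal.ofReal (-Real.log (r x))
        + ‖v x‖ₑ ^ 2 * ENNReal.ofReal (r x)) ∂μ := by
        rw [← lintegral_tsum fun k => (hmk k).aemeasurable]
        refine lintegral_congr fun x => ?_
        rw [ENNReal.tsum_add, ENNReal.tsum_mul_right, ENNReal.tsum_mul_right, h.expect_eq,
          b.tsum_enorm_inner_sq]
    _ ≤ _ := by
        rw [lintegral_add_left hm]
        gcongr
        refine (lintegral_mono fun x => mul_le_of_le_one_left' (pow_le_one' ?_ 2)).trans hr
        rw [← ofReal_norm, ENNReal.ofReal_le_one]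
        exact hnorm x

/-- Cauchy–Schwarz for the trace against a positive operator of trace at most one. -/
lemma enorm_sum_inner_sq_le {ρ : H →L[ℂ] H} (hρ : ρ.IsPositive) (h1 : posTrace ρ ≤ 1) {κ : Type*}
    (b : HilbertBasis κ ℂ H) (s : Finset κ) (z : κ → H) :
    ‖∑ i ∈ s, inner ℂ (b i) (ρ (z i))‖ₑ ^ 2 ≤ ∑ i ∈ s, expect ρ (z i) := by
  have h2 : ∑ i ∈ s, expect ρ (b i) ≤ 1 :=
    (ENNReal.sum_le_tsum s).trans ((posTrace_eq_tsum_expect hρ b).symm.le.trans h1)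
  obtain ⟨S, hS, rfl⟩ := exists_sqrt hρ
  simp_rw [expect_sq hS] at h2 ⊢
  simp_rw [inner_sq_apply hS]
  have h3 : ‖∑ i ∈ s, inner ℂ (S (b i)) (S (z i))‖ ^ 2
      ≤ (∑ i ∈ s, ‖S (b i)‖ ^ 2) * ∑ i ∈ s, ‖S (z i)‖ ^ 2 := by
    refine le_trans ?_ (Finset.sum_mul_sq_le_sq_mul_sq s _ _)
    gcongr
    exact (norm_sum_le _ _).trans (Finset.sum_le_sum fun i _ => norm_inner_le_norm _ _)
  have h4 : ∀ y : κ → H, ∑ i ∈ s, ‖S (y i)‖ₑ ^ 2 = ENNReal.ofReal (∑ i ∈ s, ‖S (y i)‖ ^ 2) :=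
    fun y => by
      rw [ENNReal.ofReal_sum_of_nonneg fun _ _ => by positivity]
      simp_rw [ENNReal.ofReal_pow (norm_nonneg _), ofReal_norm]
  rw [h4, ENNReal.ofReal_le_one] at h2
  rw [h4, ← ofReal_norm, ← ENNReal.ofReal_pow (norm_nonneg _)]
  refine ENNReal.ofReal_le_ofReal (h3.trans (mul_le_of_le_one_left ?_ h2))
  positivity

/-- The difference of the two sides is `((1 + s r) a - r)² / (1 + s r)`. -/
lemma two_mul_le_sq_add_div {r a s : ℝ} (hr : 0 ≤ r) (hs : 0 ≤ s) :
    2 * (r * a) ≤ s * (r * a ^ 2) + a ^ 2 + r ^ 2 / (1 + s * r) := by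
  have h : 0 < 1 + s * r := by positivity
  have h2 : s * (r * a ^ 2) + a ^ 2 + r ^ 2 / (1 + s * r) - 2 * (r * a)
      = ((1 + s * r) * a - r) ^ 2 / (1 + s * r) := by
    field_simp
    ring
  have h3 : 0 ≤ ((1 + s * r) * a - r) ^ 2 / (1 + s * r) := by positivity
  linarith

/-- Monotonicity of the divergence belonging to the function `x ↦ x² / (1 + s x)` under the map
`f ↦ ∫ f(ξ) τ ξ dμ(ξ)` from densities to operators. The map sends `r` to `R`, and the constant
density `1` to the possibly unbounded operator `∑ q_b |g_b⟩⟨g_b|`; finitely many terms are retained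
on the left, so that only the quadratic form `htw` of the latter is needed. -/
theorem sum_le_lintegral_of_mixture {Ξ : Type*} [MeasurableSpace Ξ] {μ : Measure Ξ}
    {r : Ξ → ℝ} (hr0 : ∀ ξ, 0 ≤ r ξ) (hrm : Measurable r)
    {τ : Ξ → H →L[ℂ] H} (hτ : ∀ ξ, (τ ξ).IsPositive) (hτ1 : ∀ ξ, posTrace (τ ξ) ≤ 1)
    (hτm : ∀ x y, Measurable fun ξ => inner ℂ x (τ ξ y))
    {R : H →L[ℂ] H} {κ : Type*} {Ψ : HilbertBasis κ ℂ H} {P : κ → ℝ} (hR : IsEigenbasis R Ψ P)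
    (hRi : ∀ x y, Integrable (fun ξ => inner ℂ x (τ ξ y))
      (μ.withDensity fun ξ => ENNReal.ofReal (r ξ)))
    (hRτ : ∀ x y, inner ℂ x (R y) = ∫ ξ, inner ℂ x (τ ξ y)
      ∂(μ.withDensity fun ξ => ENNReal.ofReal (r ξ)))
    (hRe : ∀ x, expect R x = ∫⁻ ξ, expect (τ ξ) x ∂(μ.withDensity fun ξ => ENNReal.ofReal (r ξ)))
    {β : Type*} {g : HilbertBasis β ℂ H} {q : β → ℝ} (hq : ∀ b, 0 ≤ q b)
    (I : Finset κ) (B : Finset β)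
    (htw : ∀ c : β → ℂ, ∫⁻ ξ, expect (τ ξ) (∑ b ∈ B, c b • g b) ∂μ
      = ∑ b ∈ B, ENNReal.ofReal (q b) * ‖c b‖ₑ ^ 2)
    {s : ℝ} (hs : 0 ≤ s) :
    ∑ i ∈ I, ∑ b ∈ B, ‖inner ℂ (g b) (Ψ i)‖ₑ ^ 2 * ENNReal.ofReal (P i ^ 2 / (q b + s * P i))
      ≤ ∫⁻ ξ, ENNReal.ofReal (r ξ ^ 2 / (1 + s * r ξ)) ∂μ := by
  classical
  set γ := μ.withDensity fun ξ => ENNReal.ofReal (r ξ) with hγ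
  let x : κ → β → ℝ := fun i b => P i / (q b + s * P i)
  have hx0 : ∀ i b, 0 ≤ x i b := fun i b =>
    div_nonneg (hR.nonneg i) (add_nonneg (hq b) (mul_nonneg hs (hR.nonneg i)))
  have hx : ∀ i b, x i b ^ 2 * (q b + s * P i) = P i ^ 2 / (q b + s * P i) := fun i b => by
    simp only [x]
    -- a term with vanishing denominator is `0`, which only weakens the inequality
    rcases eq_or_ne (q b + s * P i) 0 with h | h
    · simp [h]
    · field_simp
  -- the optimal test operator is `∑ i, |Y i⟩⟨Ψ i| = ∑ b, |g b⟩⟨Z b|`, and `y ξ` is the trace of its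
  -- product with `τ ξ`
  let Y : κ → H := fun i => ∑ b ∈ B, ((x i b : ℂ) * inner ℂ (g b) (Ψ i)) • g b
  let Z : β → H := fun b => ∑ i ∈ I, ((x i b : ℂ) * inner ℂ (Ψ i) (g b)) • Ψ i
  let y : Ξ → ℂ := fun ξ => ∑ i ∈ I, inner ℂ (Ψ i) (τ ξ (Y i))
  let E : κ → β → ℝ≥0∞ := fun i b =>
    ‖inner ℂ (g b) (Ψ i)‖ₑ ^ 2 * ENNReal.ofReal (P i ^ 2 / (q b + s * P i))
  have hE : ∀ i b, E i b = ENNReal.ofReal (‖inner ℂ (g b) (Ψ i)‖ ^ 2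
      * (P i ^ 2 / (q b + s * P i))) := fun i b => by
    rw [ENNReal.ofReal_mul (by positivity), ENNReal.ofReal_pow (norm_nonneg _), ofReal_norm]
  have hy1 : ∀ ξ, ‖y ξ‖ₑ ^ 2 ≤ ∑ i ∈ I, expect (τ ξ) (Y i) := fun ξ =>
    enorm_sum_inner_sq_le (hτ ξ) (hτ1 ξ) Ψ I Y
  have hy2 : ∀ ξ, ‖y ξ‖ₑ ^ 2 ≤ ∑ b ∈ B, expect (τ ξ) (Z b) := fun ξ => by
    have h1 : starRingEnd ℂ (y ξ) = ∑ b ∈ B, inner ℂ (g b) (τ ξ (Z b)) := by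
      simp only [y, Y, Z, map_sum, map_smul, inner_sum, inner_smul_right]
      rw [Finset.sum_comm]
      refine Finset.sum_congr rfl fun b _ => Finset.sum_congr rfl fun i _ => ?_
      rw [map_mul, map_mul, Complex.conj_ofReal, inner_conj_symm, inner_conj_symm,
        (hτ ξ).inner_left_eq_inner_right]
    have h2 := enorm_sum_inner_sq_le (hτ ξ) (hτ1 ξ) g B Z
    rw [← h1, RCLike.enorm_conj] at h2
    exact h2
  have hyA : ENNReal.ofReal (∑ i ∈ I, ∑ b ∈ B, ‖inner ℂ (g b) (Ψ i)‖ ^ 2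
      * (P i ^ 2 / (q b + s * P i))) ≤ ∫⁻ ξ, ‖y ξ‖ₑ ∂γ := by
    have h1 : ∫ ξ, y ξ ∂γ = ((∑ i ∈ I, ∑ b ∈ B, ‖inner ℂ (g b) (Ψ i)‖ ^ 2
      * (P i ^ 2 / (q b + s * P i)) : ℝ) : ℂ) := by
      simp only [y]
      rw [integral_finsetSum _ fun i _ => hRi _ _, Complex.ofReal_sum]
      refine Finset.sum_congr rfl fun i _ => ?_
      rw [← hRτ, hR.inner_basis_apply, Complex.ofReal_sum]
      simp only [Y, inner_sum, inner_smul_right]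
      rw [Finset.mul_sum]
      refine Finset.sum_congr rfl fun b _ => ?_
      have h2 : inner ℂ (g b) (Ψ i) * inner ℂ (Ψ i) (g b)
          = ((‖inner ℂ (g b) (Ψ i)‖ ^ 2 : ℝ) : ℂ) := by
        rw [← inner_conj_symm (Ψ i) (g b), Complex.mul_conj, Complex.normSq_eq_norm_sq]
      have h3 : P i ^ 2 / (q b + s * P i) = P i * x i b := by
        simp only [x]
        ring
      rw [h3, mul_assoc, h2]
      push_cast
      ring
    have h0 : 0 ≤ ∑ i ∈ I, ∑ b ∈ B, ‖inner ℂ (g b) (Ψ i)‖ ^ 2 * (P i ^ 2 / (q b + s * P i)) :=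
      Finset.sum_nonneg fun i _ => Finset.sum_nonneg fun b _ => mul_nonneg (by positivity)
        (div_nonneg (by positivity) (add_nonneg (hq b) (mul_nonneg hs (hR.nonneg i))))
    have h2 := enorm_integral_le_lintegral_enorm (μ := γ) y
    rw [h1, ← ofReal_norm, Complex.norm_real, Real.norm_eq_abs, abs_of_nonneg h0] at h2
    exact h2
  have hA : ENNReal.ofReal (∑ i ∈ I, ∑ b ∈ B, ‖inner ℂ (g b) (Ψ i)‖ ^ 2
      * (P i ^ 2 / (q b + s * P i))) = ∑ i ∈ I, ∑ b ∈ B, E i b := by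
    have h0 : ∀ i b, 0 ≤ ‖inner ℂ (g b) (Ψ i)‖ ^ 2 * (P i ^ 2 / (q b + s * P i)) := fun i b =>
      mul_nonneg (by positivity)
        (div_nonneg (by positivity) (add_nonneg (hq b) (mul_nonneg hs (hR.nonneg i))))
    rw [ENNReal.ofReal_sum_of_nonneg fun i _ => Finset.sum_nonneg fun b _ => h0 i b]
    refine Finset.sum_congr rfl fun i _ => ?_
    rw [ENNReal.ofReal_sum_of_nonneg fun b _ => h0 i b]
    exact Finset.sum_congr rfl fun b _ => (hE i b).symm
  rw [hA] at hyA
  have hτe : ∀ v, Measurable fun ξ => expect (τ ξ) v := fun v =>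
    (Complex.measurable_re.comp (hτm v v)).ennreal_ofReal
  have hym : Measurable y := Finset.measurable_sum _ fun i _ => hτm _ _
  have hZ : ∫⁻ ξ, ∑ b ∈ B, expect (τ ξ) (Z b) ∂γ
      = ∑ i ∈ I, ∑ b ∈ B, ENNReal.ofReal (P i) * ‖(x i b : ℂ) * inner ℂ (Ψ i) (g b)‖ₑ ^ 2 := by
    rw [lintegral_finsetSum _ fun b _ => hτe _, Finset.sum_comm]
    refine Finset.sum_congr rfl fun b _ => ?_
    rw [← hRe, hR.expect_eq, tsum_eq_sum (s := I)]
    · refine Finset.sum_congr rfl fun i hi => ?_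
      rw [Ψ.orthonormal.inner_right_sum _ hi]
    · intro i hi
      have : inner ℂ (Ψ i) (Z b) = 0 := by
        simp only [Z, inner_sum, inner_smul_right]
        refine Finset.sum_eq_zero fun j hj => ?_
        rw [Ψ.orthonormal.2 (ne_of_mem_of_not_mem hj hi).symm, mul_zero]
      simp [this]
  have hY : ∫⁻ ξ, ∑ i ∈ I, expect (τ ξ) (Y i) ∂μ
      = ∑ i ∈ I, ∑ b ∈ B, ENNReal.ofReal (q b) * ‖(x i b : ℂ) * inner ℂ (g b) (Ψ i)‖ₑ ^ 2 := by
    rw [lintegral_finsetSum _ fun i _ => hτe _]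
    exact Finset.sum_congr rfl fun i _ => htw _
  have hxE : ∀ i b, ENNReal.ofReal s * (ENNReal.ofReal (P i)
        * ‖(x i b : ℂ) * inner ℂ (Ψ i) (g b)‖ₑ ^ 2)
      + ENNReal.ofReal (q b) * ‖(x i b : ℂ) * inner ℂ (g b) (Ψ i)‖ₑ ^ 2 = E i b := fun i b => by
    rw [hE, ← inner_conj_symm (Ψ i) (g b)]
    simp only [enorm_mul, RCLike.enorm_conj]
    simp only [← ofReal_norm, Complex.norm_real, Real.norm_eq_abs, abs_of_nonneg (hx0 i b)]
    rw [← ENNReal.ofReal_mul (hx0 i b), ← ENNReal.ofReal_pow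
      (mul_nonneg (hx0 i b) (norm_nonneg _)), ← ENNReal.ofReal_mul (hR.nonneg i),
      ← ENNReal.ofReal_mul hs, ← ENNReal.ofReal_mul (hq b), ← ENNReal.ofReal_add, ← hx]
    · congr 1
      ring
    · exact mul_nonneg hs (mul_nonneg (hR.nonneg i) (sq_nonneg _))
    · exact mul_nonneg (hq b) (sq_nonneg _)
  have hpt : ∀ ξ, 2 * (ENNReal.ofReal (r ξ) * ‖y ξ‖ₑ)
      ≤ ENNReal.ofReal s * (ENNReal.ofReal (r ξ) * ∑ b ∈ B, expect (τ ξ) (Z b))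
        + ∑ i ∈ I, expect (τ ξ) (Y i) + ENNReal.ofReal (r ξ ^ 2 / (1 + s * r ξ)) := fun ξ => by
    refine le_trans ?_ (add_le_add_left (add_le_add (mul_le_mul_right
      (mul_le_mul_right (hy2 ξ) _) _) (hy1 ξ)) _)
    have h := ENNReal.ofReal_le_ofReal (two_mul_le_sq_add_div (a := ‖y ξ‖) (hr0 ξ) hs)
    have h0 := hr0 ξ
    rw [ENNReal.ofReal_add (by positivity) (by positivity), ENNReal.ofReal_add (by positivity)
      (by positivity), ENNReal.ofReal_mul zero_le_two, ENNReal.ofReal_mul h0,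
      ENNReal.ofReal_mul hs, ENNReal.ofReal_mul h0, ENNReal.ofReal_pow (norm_nonneg _),
      ofReal_norm, ENNReal.ofReal_ofNat] at h
    exact h
  have hrm' : Measurable fun ξ => ENNReal.ofReal (r ξ) := hrm.ennreal_ofReal
  have hZm : Measurable fun ξ => ∑ b ∈ B, expect (τ ξ) (Z b) :=
    Finset.measurable_sum _ fun b _ => hτe _
  have hYm : Measurable fun ξ => ∑ i ∈ I, expect (τ ξ) (Y i) :=
    Finset.measurable_sum _ fun b _ => hτe _
  have hγint : ∀ f : Ξ → ℝ≥0∞, Measurable f →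
      ∫⁻ ξ, f ξ ∂γ = ∫⁻ ξ, ENNReal.ofReal (r ξ) * f ξ ∂μ := fun f hf => by
    rw [hγ, lintegral_withDensity_eq_lintegral_mul _ hrm' hf]
    rfl
  have hfin : ∑ i ∈ I, ∑ b ∈ B, E i b ≠ ∞ := by
    rw [← hA]
    exact ENNReal.ofReal_ne_top
  -- the cross term `2 ∫ r |y| dμ` is at least twice the left-hand side, and the two quadratic terms
  -- of `two_mul_le_sq_add_div` add up to the left-hand side once
  refine (ENNReal.add_le_add_iff_left hfin).1 ?_
  calc _ = 2 * ∑ i ∈ I, ∑ b ∈ B, E i b := (two_mul _).symm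
    _ ≤ 2 * ∫⁻ ξ, ‖y ξ‖ₑ ∂γ := by gcongr
    _ = ∫⁻ ξ, 2 * (ENNReal.ofReal (r ξ) * ‖y ξ‖ₑ) ∂μ := by
        rw [hγint _ hym.enorm, lintegral_const_mul' _ _ (by simp)]
    _ ≤ _ := lintegral_mono hpt
    _ = ENNReal.ofReal s * ∫⁻ ξ, ∑ b ∈ B, expect (τ ξ) (Z b) ∂γ
        + ∫⁻ ξ, ∑ i ∈ I, expect (τ ξ) (Y i) ∂μ
        + ∫⁻ ξ, ENNReal.ofReal (r ξ ^ 2 / (1 + s * r ξ)) ∂μ := by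
        have hm1 : Measurable fun ξ => ENNReal.ofReal (r ξ) * ∑ b ∈ B, expect (τ ξ) (Z b) :=
          hrm'.mul hZm
        have hm2 : Measurable fun ξ => ENNReal.ofReal s
          * (ENNReal.ofReal (r ξ) * ∑ b ∈ B, expect (τ ξ) (Z b)) := hm1.const_mul _
        have hm3 : Measurable fun ξ => ENNReal.ofReal s
          * (ENNReal.ofReal (r ξ) * ∑ b ∈ B, expect (τ ξ) (Z b))
          + ∑ i ∈ I, expect (τ ξ) (Y i) := hm2.add hYm
        rw [lintegral_add_left hm3, lintegral_add_left hm2, lintegral_const_mul' _ _ (by simp),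
          hγint _ hZm]
    _ = _ := by
        rw [hZ, hY, Finset.mul_sum, ← Finset.sum_add_distrib]
        congr 1
        refine Finset.sum_congr rfl fun i _ => ?_
        rw [Finset.mul_sum, ← Finset.sum_add_distrib]
        exact Finset.sum_congr rfl fun b _ => hxE i b

/-- The logarithm as a mixture of the functions `x ↦ x² / (1 + s x)`. -/
lemma lintegral_Ioc_sq_div {r S : ℝ} (hr : 0 ≤ r) (hS : 0 ≤ S) :
    ∫⁻ s in Set.Ioc 0 S, ENNReal.ofReal (r ^ 2 / (1 + s * r))
      = ENNReal.ofReal (r * Real.log (1 + S * r)) := by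
  have hpos : ∀ s ∈ Set.uIcc 0 S, 0 < 1 + s * r := fun s hs => by
    rw [Set.uIcc_of_le hS] at hs
    have := mul_nonneg hs.1 hr
    linarith
  have hcont : ContinuousOn (fun s : ℝ => r ^ 2 / (1 + s * r)) (Set.uIcc 0 S) :=
    ContinuousOn.div (by fun_prop) (by fun_prop) fun s hs => (hpos s hs).ne'
  have hint := hcont.intervalIntegrable (μ := volume)
  have h1 : ∫ s in (0 : ℝ)..S, r ^ 2 / (1 + s * r) = r * Real.log (1 + S * r) := by
    rw [intervalIntegral.integral_eq_sub_of_hasDerivAt (f := fun s => r * Real.log (1 + s * r))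
      (fun s hs => ?_) hint]
    · simp
    · have := (((hasDerivAt_id s).mul_const r).const_add 1).log (hpos s hs).ne'
      refine (this.const_mul r).congr_deriv ?_
      simp only [id]
      ring
  rw [← h1, intervalIntegral.integral_of_le hS, ofReal_integral_eq_lintegral_ofReal]
  · exact (intervalIntegrable_iff_integrableOn_Ioc_of_le hS).1 hint
  · refine (ae_restrict_iff' measurableSet_Ioc).2 (ae_of_all _ fun s hs => ?_)
    have := hpos s (by rw [Set.uIcc_of_le hS]; exact ⟨hs.1.le, hs.2⟩)
    simp only [Pi.zero_apply]
    positivity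

lemma ofReal_mul_log_le_lintegral_Ioc {P q S : ℝ} (hP : 0 ≤ P) (hq : 0 ≤ q) (hS : 0 ≤ S) :
    ENNReal.ofReal (P * Real.log (1 + S * (P / q)))
      ≤ ∫⁻ s in Set.Ioc 0 S, ENNReal.ofReal (P ^ 2 / (q + s * P)) := by
  rcases hq.eq_or_lt with rfl | hq
  · simp
  · have h1 : ∀ s, P ^ 2 / (q + s * P) = q * ((P / q) ^ 2 / (1 + s * (P / q))) := fun s => by
      rw [← mul_div_mul_left (P ^ 2) _ (inv_ne_zero hq.ne'), mul_add, inv_mul_cancel₀ hq.ne']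
      field_simp
    simp_rw [h1, ENNReal.ofReal_mul hq.le]
    rw [lintegral_const_mul' _ _ (by simp), lintegral_Ioc_sq_div (by positivity) hS,
      ← ENNReal.ofReal_mul hq.le, ← mul_assoc, mul_div_cancel₀ _ hq.ne']

lemma mul_log_add_le {P q S : ℝ} (hP : 0 ≤ P) (hq : 0 < q) (hS : 1 ≤ S) :
    P * Real.log S + P * (-Real.log q)
      ≤ P * Real.log (1 + S * (P / q)) + Real.negMulLog P := by
  rcases hP.eq_or_lt with rfl | hP
  · simp
  have hS0 : 0 < S := by linarith
  have h1 : Real.log (S * (P / q)) ≤ Real.log (1 + S * (P / q)) :=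
    Real.log_le_log (by positivity) (by linarith)
  rw [Real.log_mul hS0.ne' (by positivity), Real.log_div hP.ne' hq.ne'] at h1
  have h2 := mul_le_mul_of_nonneg_left h1 hP.le
  rw [Real.negMulLog]
  linarith

/-- Monotonicity of the relative entropy under the map `f ↦ ∫ f(ξ) τ ξ dμ(ξ)` from densities to
operators. The map sends `r` to `R` and the constant density `1` to the possibly unbounded operator
`∑ q_b |g_b⟩⟨g_b|`. The logarithms `log x` are replaced by `log (1 + S x) - log S`, which keeps
every term nonnegative and is harmless in the limit `S → ∞`. -/
theorem log_add_tsum_le {Ξ : Type*} [MeasurableSpace Ξ] {μ : Measure Ξ} [SFinite μ]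
    {r : Ξ → ℝ} (hr0 : ∀ ξ, 0 ≤ r ξ) (hrm : Measurable r)
    {τ : Ξ → H →L[ℂ] H} (hτ : ∀ ξ, (τ ξ).IsPositive) (hτ1 : ∀ ξ, posTrace (τ ξ) ≤ 1)
    (hτm : ∀ x y, Measurable fun ξ => inner ℂ x (τ ξ y))
    {R : H →L[ℂ] H} (hRd : IsDensityOperator R)
    (hRi : ∀ x y, Integrable (fun ξ => inner ℂ x (τ ξ y))
      (μ.withDensity fun ξ => ENNReal.ofReal (r ξ)))
    (hRτ : ∀ x y, inner ℂ x (R y) = ∫ ξ, inner ℂ x (τ ξ y)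
      ∂(μ.withDensity fun ξ => ENNReal.ofReal (r ξ)))
    (hRe : ∀ x, expect R x = ∫⁻ ξ, expect (τ ξ) x ∂(μ.withDensity fun ξ => ENNReal.ofReal (r ξ)))
    {β : Type*} {g : HilbertBasis β ℂ H} {q : β → ℝ} (hq : ∀ b, 0 ≤ q b) (hq1 : ∀ b, q b ≤ 1)
    (hqR : ∀ b, q b = 0 → expect R (g b) = 0)
    (htw : ∀ (B : Finset β) (c : β → ℂ), ∫⁻ ξ, expect (τ ξ) (∑ b ∈ B, c b • g b) ∂μ
      = ∑ b ∈ B, ENNReal.ofReal (q b) * ‖c b‖ₑ ^ 2)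
    {S : ℝ} (hS : 1 ≤ S) :
    ENNReal.ofReal (Real.log S) + ∑' b, expect R (g b) * ENNReal.ofReal (-Real.log (q b))
      ≤ ∫⁻ ξ, ENNReal.ofReal (Real.log (1 + S * r ξ))
          ∂(μ.withDensity fun ξ => ENNReal.ofReal (r ξ)) + vonNeumannEntropy R := by
  obtain ⟨κ, Ψ, P, hR⟩ := exists_isEigenbasis hRd.1 (by simp [hRd.2])
  have hS0 : 0 ≤ S := by linarith
  have hlogS : 0 ≤ Real.log S := Real.log_nonneg hS
  have hfin : ∀ (I : Finset κ) (B : Finset β), ∑ i ∈ I, ∑ b ∈ B, ‖inner ℂ (g b) (Ψ i)‖ₑ ^ 2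
        * ENNReal.ofReal (P i * Real.log (1 + S * (P i / q b)))
      ≤ ∫⁻ ξ, ENNReal.ofReal (Real.log (1 + S * r ξ))
          ∂(μ.withDensity fun ξ => ENNReal.ofReal (r ξ)) := fun I B => by
    have hmP : ∀ i b, Measurable fun s : ℝ => ENNReal.ofReal (P i ^ 2 / (q b + s * P i)) :=
      fun i b => by fun_prop
    calc _ ≤ ∑ i ∈ I, ∑ b ∈ B, ‖inner ℂ (g b) (Ψ i)‖ₑ ^ 2
        * ∫⁻ s in Set.Ioc 0 S, ENNReal.ofReal (P i ^ 2 / (q b + s * P i)) := by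
          gcongr with i _ b _
          exact ofReal_mul_log_le_lintegral_Ioc (hR.nonneg i) (hq b) hS0
      _ = ∫⁻ s in Set.Ioc 0 S, ∑ i ∈ I, ∑ b ∈ B, ‖inner ℂ (g b) (Ψ i)‖ₑ ^ 2
          * ENNReal.ofReal (P i ^ 2 / (q b + s * P i)) := by
          rw [lintegral_finsetSum _ fun i _ => Finset.measurable_sum _ fun b _ =>
            (hmP i b).const_mul _]
          refine Finset.sum_congr rfl fun i _ => ?_
          rw [lintegral_finsetSum _ fun b _ => (hmP i b).const_mul _]
          refine Finset.sum_congr rfl fun b _ => ?_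
          rw [lintegral_const_mul' _ _ (by simp)]
      _ ≤ ∫⁻ s in Set.Ioc 0 S, ∫⁻ ξ, ENNReal.ofReal (r ξ ^ 2 / (1 + s * r ξ)) ∂μ :=
          setLIntegral_mono' measurableSet_Ioc fun s hs =>
            sum_le_lintegral_of_mixture hr0 hrm hτ hτ1 hτm hR hRi hRτ hRe hq I B (htw B) hs.1.le
      _ = ∫⁻ ξ, ENNReal.ofReal (r ξ * Real.log (1 + S * r ξ)) ∂μ := by
          rw [lintegral_lintegral_swap]
          · exact lintegral_congr fun ξ => lintegral_Ioc_sq_div (hr0 ξ) hS0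
          · have : Measurable fun a : ℝ × Ξ => ENNReal.ofReal (r a.2 ^ 2 / (1 + a.1 * r a.2)) := by
              fun_prop
            exact this.aemeasurable
      _ = _ := by
          rw [lintegral_withDensity_eq_lintegral_mul _ hrm.ennreal_ofReal (by fun_prop)]
          refine lintegral_congr fun ξ => ?_
          rw [Pi.mul_apply, ENNReal.ofReal_mul (hr0 ξ)]
  have hsum : ∑' i, ∑' b, ‖inner ℂ (g b) (Ψ i)‖ₑ ^ 2
        * ENNReal.ofReal (P i * Real.log (1 + S * (P i / q b)))
      ≤ ∫⁻ ξ, ENNReal.ofReal (Real.log (1 + S * r ξ))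
          ∂(μ.withDensity fun ξ => ENNReal.ofReal (r ξ)) := by
    refine ENNReal.summable.tsum_le_of_sum_le fun I => ?_
    rw [← Summable.tsum_finsetSum fun i _ => ENNReal.summable]
    refine ENNReal.summable.tsum_le_of_sum_le fun B => ?_
    rw [Finset.sum_comm]
    exact hfin I B
  have hw : ∀ i, ∑' b, ‖inner ℂ (g b) (Ψ i)‖ₑ ^ 2 = 1 := fun i => by
    rw [g.tsum_enorm_inner_sq, ← ofReal_norm, Ψ.orthonormal.1]
    simp
  have hpt : ∀ i b, ‖inner ℂ (g b) (Ψ i)‖ₑ ^ 2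
        * (ENNReal.ofReal (P i) * ENNReal.ofReal (Real.log S))
        + (ENNReal.ofReal (P i) * ‖inner ℂ (Ψ i) (g b)‖ₑ ^ 2) * ENNReal.ofReal (-Real.log (q b))
      ≤ ‖inner ℂ (g b) (Ψ i)‖ₑ ^ 2 * ENNReal.ofReal (P i * Real.log (1 + S * (P i / q b)))
        + ‖inner ℂ (g b) (Ψ i)‖ₑ ^ 2 * ENNReal.ofReal (Real.negMulLog (P i)) := fun i b => by
    have hη := Real.negMulLog_nonneg (hR.nonneg i) (hR.le_one hRd i)
    have hsymm : ‖inner ℂ (Ψ i) (g b)‖ₑ = ‖inner ℂ (g b) (Ψ i)‖ₑ := by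
      rw [← inner_conj_symm, RCLike.enorm_conj]
    rw [hsymm]
    rcases (hq b).eq_or_lt with h0 | h0
    · have h1 := hqR b h0.symm
      rw [hR.expect_eq, ENNReal.tsum_eq_zero] at h1
      have h2 := h1 i
      rw [hsymm] at h2
      rcases mul_eq_zero.1 h2 with h2 | h2
      · have h3 : P i = 0 := le_antisymm (ENNReal.ofReal_eq_zero.1 h2) (hR.nonneg i)
        simp [h3]
      · simp [h2]
    · rw [mul_comm (ENNReal.ofReal (P i)) (‖inner ℂ (g b) (Ψ i)‖ₑ ^ 2), mul_assoc,
        ← mul_add (‖inner ℂ (g b) (Ψ i)‖ₑ ^ 2), ← mul_add (‖inner ℂ (g b) (Ψ i)‖ₑ ^ 2)]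
      refine mul_le_mul_right ?_ _
      have hlogq : 0 ≤ -Real.log (q b) := by
        have := Real.log_nonpos (hq b) (hq1 b)
        linarith
      have hlog1 : 0 ≤ P i * Real.log (1 + S * (P i / q b)) := by
        have h3 := div_nonneg (hR.nonneg i) (hq b)
        refine mul_nonneg (hR.nonneg i) (Real.log_nonneg ?_)
        have := mul_nonneg hS0 h3
        linarith
      rw [← ENNReal.ofReal_mul (hR.nonneg i), ← ENNReal.ofReal_mul (hR.nonneg i),
        ← ENNReal.ofReal_add (mul_nonneg (hR.nonneg i) hlogS) (mul_nonneg (hR.nonneg i) hlogq),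
        ← ENNReal.ofReal_add hlog1 hη]
      exact ENNReal.ofReal_le_ofReal (mul_log_add_le (hR.nonneg i) h0 hS)
  calc _ = ∑' i, ∑' b, (‖inner ℂ (g b) (Ψ i)‖ₑ ^ 2
        * (ENNReal.ofReal (P i) * ENNReal.ofReal (Real.log S))
        + (ENNReal.ofReal (P i) * ‖inner ℂ (Ψ i) (g b)‖ₑ ^ 2)
          * ENNReal.ofReal (-Real.log (q b))) := by
        simp_rw [ENNReal.tsum_add, ENNReal.tsum_mul_right, hw, one_mul, ENNReal.tsum_mul_right,
          hR.tsum_eq_one hRd, one_mul]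
        congr 1
        rw [ENNReal.tsum_comm]
        simp_rw [ENNReal.tsum_mul_right, ← hR.expect_eq]
    _ ≤ ∑' i, ∑' b, (‖inner ℂ (g b) (Ψ i)‖ₑ ^ 2
          * ENNReal.ofReal (P i * Real.log (1 + S * (P i / q b)))
        + ‖inner ℂ (g b) (Ψ i)‖ₑ ^ 2 * ENNReal.ofReal (Real.negMulLog (P i))) :=
        ENNReal.tsum_le_tsum fun i => ENNReal.tsum_le_tsum fun b => hpt i b
    _ ≤ _ := by
        simp_rw [ENNReal.tsum_add, ENNReal.tsum_mul_right, hw, one_mul]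
        rw [hRd.vonNeumannEntropy_eq hR]
        gcongr

end EntropyBounds

/-! ### The vacuum vector -/

section Vacuum

variable {ι : Type} [Fintype ι]

/-- The wave function `π ^ (-1/4) exp (-y² / 2)` of the vacuum of one mode. -/
def vacuumFun (y : ℝ) : ℝ := Real.pi ^ (-(1 / 4) : ℝ) * Real.exp (-(y ^ 2) / 2)

lemma continuous_vacuumFun : Continuous vacuumFun := by
  unfold vacuumFun
  fun_prop

lemma vacuumFun_sq (y : ℝ) :
    vacuumFun y ^ 2 = Real.pi ^ (-(1 / 2) : ℝ) * Real.exp (-1 * y ^ 2) := by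
  rw [vacuumFun, mul_pow, ← Real.exp_nat_mul, ← Real.rpow_natCast, ← Real.rpow_mul Real.pi_pos.le]
  congr 2 <;> push_cast <;> ring

lemma memLp_vacuumFun :
    MemLp (fun x : ι → ℝ => ((∏ k, vacuumFun (x k) : ℝ) : ℂ)) 2 volume := by
  have hc : Continuous fun x : ι → ℝ => ((∏ k, vacuumFun (x k) : ℝ) : ℂ) := by
    have := continuous_vacuumFun
    fun_prop
  rw [memLp_two_iff_integrable_sq_norm hc.aestronglyMeasurable]
  have : ∀ x : ι → ℝ, ‖((∏ k, vacuumFun (x k) : ℝ) : ℂ)‖ ^ 2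
      = ∏ k, (Real.pi ^ (-(1 / 2) : ℝ) * Real.exp (-1 * x k ^ 2)) := fun x => by
    rw [Complex.norm_real, Real.norm_eq_abs, sq_abs, ← Finset.prod_pow]
    simp_rw [vacuumFun_sq]
  simp_rw [this]
  exact Integrable.fintype_prod (f := fun _ y => Real.pi ^ (-(1 / 2) : ℝ) * Real.exp (-1 * y ^ 2))
    fun _ => (integrable_exp_neg_mul_sq one_pos).const_mul _

/-- The vacuum vector of the modes `ι`. -/
def vacuum (ι : Type) [Fintype ι] : ModeSpace ι := (memLp_vacuumFun (ι := ι)).toLp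

lemma coeFn_vacuum : vacuum ι =ᵐ[volume] fun x => ((∏ k, vacuumFun (x k) : ℝ) : ℂ) :=
  memLp_vacuumFun.coeFn_toLp

lemma integral_vacuumFun_displaced (q p : ℝ) :
    ∫ y : ℝ, (vacuumFun y * vacuumFun (y - q) : ℝ) * Complex.exp ((p * (y - q / 2) : ℝ) * Complex.I)
      = Complex.exp (-((q ^ 2 + p ^ 2 : ℝ) : ℂ) / 4) := by
  have h1 : ∀ y : ℝ, (vacuumFun y * vacuumFun (y - q) : ℝ)
        * Complex.exp ((p * (y - q / 2) : ℝ) * Complex.I)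
      = ((Real.pi ^ (-(1 / 2) : ℝ) : ℝ) : ℂ) * Complex.exp ((-1 : ℂ) * y ^ 2
        + (q + p * Complex.I) * y + (-q ^ 2 / 2 - p * q / 2 * Complex.I)) := fun y => by
    have h2 : vacuumFun y * vacuumFun (y - q)
        = Real.pi ^ (-(1 / 2) : ℝ) * Real.exp (-y ^ 2 + q * y - q ^ 2 / 2) := by
      rw [vacuumFun, vacuumFun, mul_mul_mul_comm, ← Real.rpow_add Real.pi_pos, ← Real.exp_add]
      congr 2 <;> ring
    rw [h2, Complex.ofReal_mul, mul_assoc, Complex.ofReal_exp, ← Complex.exp_add]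
    congr 2
    push_cast
    ring
  simp_rw [h1]
  rw [integral_const_mul, integral_cexp_quadratic (by simp)]
  have h3 : ((Real.pi : ℂ) / -(-1)) ^ (1 / 2 : ℂ) = ((Real.pi ^ (1 / 2 : ℝ) : ℝ) : ℂ) := by
    rw [neg_neg, div_one, Complex.ofReal_cpow Real.pi_pos.le]
    norm_num
  rw [h3, ← mul_assoc, ← Complex.ofReal_mul, ← Real.rpow_add Real.pi_pos]
  norm_num
  congr 1
  linear_combination ((p : ℂ) ^ 2 / 4) * Complex.I_sq

/-- The characteristic function of the vacuum. -/
lemma inner_vacuum_displacement (ξ : PhaseSpace ι) :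
    inner ℂ (vacuum ι) (displacement ξ (vacuum ι))
      = Complex.exp (-((∑ k, (ξ (k, 0) ^ 2 + ξ (k, 1) ^ 2) : ℝ) : ℂ) / 4) := by
  have h1 : inner ℂ (vacuum ι) (displacement ξ (vacuum ι))
      = ∫ x : ι → ℝ, ∏ k, ((vacuumFun (x k) * vacuumFun (x k - ξ (k, 0)) : ℝ)
        * Complex.exp ((ξ (k, 1) * (x k - ξ (k, 0) / 2) : ℝ) * Complex.I)) := by
    rw [L2.inner_def]
    refine integral_congr_ae ?_
    filter_upwards [coeFn_vacuum (ι := ι), coeFn_displacement ξ (vacuum ι),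
      ae_shift (coeFn_vacuum (ι := ι)) fun k => ξ (k, 0)] with x h2 h3 h4
    rw [h3, h2, h4, RCLike.inner_apply, Finset.prod_mul_distrib, ← Complex.exp_sum,
      displacementPhase, Complex.conj_ofReal]
    simp only [Pi.sub_apply, Complex.ofReal_mul, Complex.ofReal_prod, Complex.ofReal_sum,
      Finset.sum_mul, Finset.prod_mul_distrib]
    ring
  rw [h1, integral_fintype_prod_volume_eq_prod (f := fun k y =>
    ((vacuumFun y * vacuumFun (y - ξ (k, 0)) : ℝ) : ℂ)
        * Complex.exp ((ξ (k, 1) * (y - ξ (k, 0) / 2) : ℝ) * Complex.I))]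
  simp_rw [integral_vacuumFun_displaced]
  rw [← Complex.exp_sum]
  congr 1
  push_cast
  rw [← Finset.sum_div, Finset.sum_neg_distrib]

lemma norm_vacuum : ‖vacuum ι‖ = 1 := by
  have h := inner_vacuum_displacement (0 : PhaseSpace ι)
  rw [displacement_zero, inner_self_eq_norm_sq_to_K] at h
  have h2 : ((‖vacuum ι‖ ^ 2 : ℝ) : ℂ) = 1 := by
    rw [Complex.ofReal_pow]
    refine h.trans ?_
    simp
  exact (pow_eq_one_iff_of_nonneg (norm_nonneg _) two_ne_zero).1 (by exact_mod_cast h2)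

end Vacuum

/-! ### Tensor products and phase space of composite systems -/

section Tensor

variable {α β : Type} [Fintype α] [Fintype β]

lemma coeFn_tensorLeft (φ : ModeSpace α) (ψ : ModeSpace β) :
    tensorLeft φ ψ =ᵐ[volume] tensorFun φ ψ :=
  (memLp_tensorFun φ ψ).coeFn_toLp

lemma ae_split_fst {P : (α → ℝ) → Prop} (h : ∀ᵐ x, P x) :
    ∀ᵐ z : α ⊕ β → ℝ, P fun a => z (Sum.inl a) :=
  (measurePreserving_split α β).quasiMeasurePreserving.ae
    ((Measure.quasiMeasurePreserving_fst (ν := (volume : Measure (β → ℝ)))).ae h)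

lemma ae_split_snd' {P : (β → ℝ) → Prop} (h : ∀ᵐ x, P x) :
    ∀ᵐ z : α ⊕ β → ℝ, P fun b => z (Sum.inr b) :=
  (measurePreserving_split α β).quasiMeasurePreserving.ae
    ((Measure.quasiMeasurePreserving_snd (μ := (volume : Measure (α → ℝ)))).ae h)

lemma norm_tensorLeft_apply (φ : ModeSpace α) (ψ : ModeSpace β) :
    ‖tensorLeft φ ψ‖ = ‖φ‖ * ‖ψ‖ := by
  change ‖(memLp_tensorFun φ ψ).toLp‖ = _
  rw [Lp.norm_toLp, eLpNorm_tensorFun, ENNReal.toReal_mul, Lp.norm_def, Lp.norm_def]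

lemma inner_tensorLeft_tensorLeft (φ φ' : ModeSpace α) (ψ ψ' : ModeSpace β) :
    inner ℂ (tensorLeft φ ψ) (tensorLeft φ' ψ') = inner ℂ φ φ' * inner ℂ ψ ψ' := by
  have h1 : inner ℂ (tensorLeft φ ψ) (tensorLeft φ' ψ')
      = ∫ z : α ⊕ β → ℝ, (fun w : (α → ℝ) × (β → ℝ) => inner ℂ (φ w.1) (φ' w.1) *
        inner ℂ (ψ w.2) (ψ' w.2)) ((fun a => z (Sum.inl a)), fun b => z (Sum.inr b)) := by
    rw [L2.inner_def]
    refine integral_congr_ae ?_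
    filter_upwards [coeFn_tensorLeft φ ψ, coeFn_tensorLeft φ' ψ'] with z h1 h2
    rw [h1, h2]
    simp only [tensorFun, RCLike.inner_apply, map_mul]
    ring
  have mp := measurePreserving_split α β
  have hemb : MeasurableEmbedding fun z : α ⊕ β → ℝ =>
      ((fun a => z (Sum.inl a)), fun b => z (Sum.inr b)) :=
    (MeasurableEquiv.sumPiEquivProdPi fun _ : α ⊕ β => ℝ).measurableEmbedding
  rw [h1, mp.integral_comp hemb (fun w : (α → ℝ) × (β → ℝ) => inner ℂ (φ w.1) (φ' w.1) *
        inner ℂ (ψ w.2) (ψ' w.2)), integral_prod_mul (fun x => inner ℂ (φ x) (φ' x))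
    (fun y => inner ℂ (ψ y) (ψ' y)), ← L2.inner_def, ← L2.inner_def]

/-- The map `φ ↦ φ ⊗ ψ` from the Hilbert space of the system `α` to that of the composite system
`α ⊕ β`. -/
def tensorRight (ψ : ModeSpace β) : ModeSpace α →L[ℂ] ModeSpace (α ⊕ β) :=
  LinearMap.mkContinuous
    { toFun := fun φ => tensorLeft φ ψ
      map_add' := fun φ χ => by
        refine Lp.ext ?_
        filter_upwards [coeFn_tensorLeft (φ + χ) ψ, coeFn_tensorLeft φ ψ, coeFn_tensorLeft χ ψ,
          Lp.coeFn_add (tensorLeft φ ψ) (tensorLeft χ ψ),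
          ae_split_fst (β := β) (Lp.coeFn_add φ χ)] with z h1 h2 h3 h4 h5
        rw [h4, Pi.add_apply, h1, h2, h3]
        simp only [tensorFun, Pi.add_apply] at h5 ⊢
        rw [h5, add_mul]
      map_smul' := fun c φ => by
        refine Lp.ext ?_
        filter_upwards [coeFn_tensorLeft (c • φ) ψ, coeFn_tensorLeft φ ψ,
          Lp.coeFn_smul c (tensorLeft φ ψ),
          ae_split_fst (β := β) (Lp.coeFn_smul c φ)] with z h1 h2 h4 h5
        rw [RingHom.id_apply, h4, Pi.smul_apply, h1, h2]
        simp only [tensorFun, Pi.smul_apply, smul_eq_mul] at h5 ⊢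
        rw [h5, mul_assoc] }
    ‖ψ‖ (fun φ => by
      simp only [LinearMap.coe_mk, AddHom.coe_mk]
      rw [norm_tensorLeft_apply, mul_comm])

lemma tensorRight_apply (φ : ModeSpace α) (ψ : ModeSpace β) :
    tensorRight ψ φ = tensorLeft φ ψ := rfl

/-- The point of the phase space of `α ⊕ β` with given components. -/
def joinPhase (w : PhaseSpace α × PhaseSpace β) : PhaseSpace (α ⊕ β) :=
  fun k => Sum.elim (fun a => w.1 (a, k.2)) (fun b => w.2 (b, k.2)) k.1

lemma joinPhase_inl (w : PhaseSpace α × PhaseSpace β) (a : α) (c : Fin 2) :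
    joinPhase w (Sum.inl a, c) = w.1 (a, c) := rfl

lemma joinPhase_inr (w : PhaseSpace α × PhaseSpace β) (b : β) (c : Fin 2) :
    joinPhase w (Sum.inr b, c) = w.2 (b, c) := rfl

lemma extendByZero_eq_joinPhase (ξ : PhaseSpace α) :
    (extendByZero ξ : PhaseSpace (α ⊕ β)) = joinPhase (ξ, 0) := by
  funext k
  obtain ⟨a | b, c⟩ := k <;> rfl

lemma continuous_joinPhase : Continuous (joinPhase (α := α) (β := β)) := by
  refine continuous_pi fun k => ?_
  obtain ⟨a | b, c⟩ := k
  · exact (continuous_apply (a, c)).comp continuous_fst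
  · exact (continuous_apply (b, c)).comp continuous_snd

lemma measurePreserving_joinPhase :
    MeasurePreserving (joinPhase (α := α) (β := β)) (volume.prod volume) volume := by
  have h := (measurePreserving_reindex (Equiv.sumProdDistrib α β (Fin 2))).comp
    (volume_measurePreserving_sumPiEquivProdPi fun _ : α × Fin 2 ⊕ β × Fin 2 => ℝ).symm
  have heq : ((fun (f : α × Fin 2 ⊕ β × Fin 2 → ℝ) (a : (α ⊕ β) × Fin 2) =>
      f (Equiv.sumProdDistrib α β (Fin 2) a)) ∘
      (MeasurableEquiv.sumPiEquivProdPi fun _ : α × Fin 2 ⊕ β × Fin 2 => ℝ).symm) = joinPhase := by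
    funext w k
    obtain ⟨a | b, c⟩ := k <;> rfl
  rw [heq] at h
  exact h

lemma displacement_joinPhase_tensorLeft (ξ : PhaseSpace α) (η : PhaseSpace β) (φ : ModeSpace α)
    (ψ : ModeSpace β) :
    displacement (joinPhase (ξ, η)) (tensorLeft φ ψ)
      = tensorLeft (displacement ξ φ) (displacement η ψ) := by
  refine Lp.ext ?_
  filter_upwards [coeFn_displacement (joinPhase (ξ, η)) (tensorLeft φ ψ),
    ae_shift (coeFn_tensorLeft φ ψ) fun k => joinPhase (ξ, η) (k, 0),
    coeFn_tensorLeft (displacement ξ φ) (displacement η ψ),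
    ae_split_fst (β := β) (coeFn_displacement ξ φ),
    ae_split_snd' (α := α) (coeFn_displacement η ψ)] with z h1 h2 h3 h4 h5
  rw [h1, h2, h3, tensorFun, tensorFun, h4, h5, mul_mul_mul_comm]
  congr 1
  simp only [displacementPhase]
  rw [← Complex.exp_add, ← add_mul, ← Complex.ofReal_add, Fintype.sum_sum_type]
  rfl

lemma displacement_extendByZero_tensorLeft (ξ : PhaseSpace α) (φ : ModeSpace α)
    (ψ : ModeSpace β) :
    displacement (extendByZero ξ) (tensorLeft φ ψ) = tensorLeft (displacement ξ φ) ψ := by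
  rw [extendByZero_eq_joinPhase, displacement_joinPhase_tensorLeft, displacement_zero]

/-! ### Normalised measure on phase space -/

/-- Lebesgue measure on phase space, normalised such that the displaced copies of a unit vector
resolve the identity. -/
def phaseVolume (ι : Type) [Fintype ι] : Measure (PhaseSpace ι) :=
  (ENNReal.ofReal (2 * Real.pi) ^ Fintype.card ι)⁻¹ • volume

lemma two_pi_pow_ne_zero (n : ℕ) : ENNReal.ofReal (2 * Real.pi) ^ n ≠ 0 :=
  pow_ne_zero _ (by simp [Real.pi_pos])

lemma two_pi_pow_ne_top (n : ℕ) : ENNReal.ofReal (2 * Real.pi) ^ n ≠ ∞ :=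
  ENNReal.pow_ne_top ENNReal.ofReal_ne_top

instance instSFinitePhaseVolume (ι : Type) [Fintype ι] : SFinite (phaseVolume ι) := by
  unfold phaseVolume
  infer_instance

lemma lintegral_phaseVolume_enorm_inner_displacement_sq {ι : Type} [Fintype ι] (φ ψ : ModeSpace ι) :
    ∫⁻ ξ, ‖inner ℂ (displacement ξ φ) ψ‖ₑ ^ 2 ∂(phaseVolume ι) = ‖φ‖ₑ ^ 2 * ‖ψ‖ₑ ^ 2 := by
  rw [phaseVolume, lintegral_smul_measure, lintegral_enorm_inner_displacement_sq, smul_eq_mul,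
    ← mul_assoc, ENNReal.inv_mul_cancel (two_pi_pow_ne_zero _) (two_pi_pow_ne_top _), one_mul]

lemma measurePreserving_joinPhase_phaseVolume :
    MeasurePreserving (joinPhase (α := α) (β := β))
      ((phaseVolume α).prod (phaseVolume β)) (phaseVolume (α ⊕ β)) := by
  refine ⟨continuous_joinPhase.measurable, ?_⟩
  rw [phaseVolume, phaseVolume, phaseVolume, Measure.prod_smul_left, Measure.prod_smul_right, smul_smul,
    Measure.map_smul, measurePreserving_joinPhase.map_eq, Fintype.card_sum, pow_add,
    ENNReal.mul_inv (Or.inl (two_pi_pow_ne_zero _)) (Or.inl (two_pi_pow_ne_top _))]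

/-- The resolution of the identity of the composite system by product coherent states. -/
lemma lintegral_lintegral_enorm_inner_tensorLeft_sq {φ : ModeSpace α} {ψ : ModeSpace β}
    (χ : ModeSpace (α ⊕ β)) :
    ∫⁻ ξ, ∫⁻ η, ‖inner ℂ (tensorLeft (displacement ξ φ) (displacement η ψ)) χ‖ₑ ^ 2
      ∂(phaseVolume β) ∂(phaseVolume α) = ‖φ‖ₑ ^ 2 * ‖ψ‖ₑ ^ 2 * ‖χ‖ₑ ^ 2 := by
  have h := lintegral_phaseVolume_enorm_inner_displacement_sq (tensorLeft φ ψ) χ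
  have hm : Measurable fun ξ : PhaseSpace (α ⊕ β) =>
      ‖inner ℂ (displacement ξ (tensorLeft φ ψ)) χ‖ₑ ^ 2 :=
    (continuous_inner_displacement _ _).enorm.measurable.pow_const 2
  rw [← measurePreserving_joinPhase_phaseVolume.lintegral_comp hm, lintegral_prod
    (fun w => ‖inner ℂ (displacement (joinPhase w) (tensorLeft φ ψ)) χ‖ₑ ^ 2)
    (hm.comp continuous_joinPhase.measurable).aemeasurable] at h
  simp_rw [displacement_joinPhase_tensorLeft] at h
  rw [h, ← ofReal_norm (tensorLeft φ ψ), norm_tensorLeft_apply, ENNReal.ofReal_mul (norm_nonneg _),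
    ofReal_norm, ofReal_norm, mul_pow]

/-! ### Product bases -/

/-- Product vectors are total, because displaced product vacua already resolve the identity. -/
lemma eq_zero_of_inner_tensorLeft {χ : ModeSpace (α ⊕ β)}
    (h : ∀ (φ : ModeSpace α) (ψ : ModeSpace β), inner ℂ (tensorLeft φ ψ) χ = 0) : χ = 0 := by
  have h1 := lintegral_lintegral_enorm_inner_tensorLeft_sq (φ := vacuum α) (ψ := vacuum β) χ
  simp only [h, enorm_zero, ne_eq, OfNat.ofNat_ne_zero, not_false_eq_true, zero_pow,
    lintegral_zero] at h1
  rw [← ofReal_norm (vacuum α), ← ofReal_norm (vacuum β), norm_vacuum, norm_vacuum] at h1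
  simpa using h1.symm

lemma inner_tensorLeft_eq_left (φ : ModeSpace α) (ψ : ModeSpace β) (χ : ModeSpace (α ⊕ β)) :
    inner ℂ (tensorLeft φ ψ) χ = inner ℂ ψ ((tensorLeft φ).adjoint χ) :=
  (ContinuousLinearMap.adjoint_inner_right _ _ _).symm

lemma inner_tensorLeft_eq_right (φ : ModeSpace α) (ψ : ModeSpace β) (χ : ModeSpace (α ⊕ β)) :
    inner ℂ (tensorLeft φ ψ) χ = inner ℂ φ ((tensorRight ψ).adjoint χ) :=
  (ContinuousLinearMap.adjoint_inner_right (tensorRight ψ) _ _).symm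

lemma orthonormal_tensorLeft {κ κ' : Type*} (e : HilbertBasis κ ℂ (ModeSpace α))
    (f : HilbertBasis κ' ℂ (ModeSpace β)) :
    Orthonormal ℂ fun b : κ × κ' => tensorLeft (e b.1) (f b.2) := by
  constructor
  · intro b
    rw [norm_tensorLeft_apply, e.orthonormal.1, f.orthonormal.1, one_mul]
  · rintro ⟨a, j⟩ ⟨a', j'⟩ hne
    dsimp only
    rw [inner_tensorLeft_tensorLeft]
    rcases eq_or_ne a a' with rfl | ha
    · rw [f.orthonormal.2 fun h : j = j' => hne (by rw [h]), mul_zero]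
    · rw [e.orthonormal.2 ha, zero_mul]

lemma span_tensorLeft_orthogonal {κ κ' : Type*} (e : HilbertBasis κ ℂ (ModeSpace α))
    (f : HilbertBasis κ' ℂ (ModeSpace β)) :
    (Submodule.span ℂ (Set.range fun b : κ × κ' => tensorLeft (e b.1) (f b.2)))ᗮ = ⊥ := by
  rw [eq_bot_iff]
  intro χ hχ
  rw [Submodule.mem_orthogonal] at hχ
  have h1 : ∀ a j, inner ℂ (tensorLeft (e a) (f j)) χ = 0 := fun a j =>
    hχ _ (Submodule.subset_span ⟨(a, j), rfl⟩)
  have h2 : ∀ j, (tensorRight (α := α) (f j)).adjoint χ = 0 := fun j =>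
    e.eq_zero_of_inner fun a => by rw [← inner_tensorLeft_eq_right, h1]
  have h3 : ∀ φ : ModeSpace α, (tensorLeft (β := β) φ).adjoint χ = 0 := fun φ =>
    f.eq_zero_of_inner fun j => by
      rw [← inner_tensorLeft_eq_left, inner_tensorLeft_eq_right, h2, inner_zero_right]
  refine eq_zero_of_inner_tensorLeft fun φ ψ => ?_
  rw [inner_tensorLeft_eq_left, h3, inner_zero_right]

/-- The product of two orthonormal bases. -/
def tensorBasis {κ κ' : Type*} (e : HilbertBasis κ ℂ (ModeSpace α))
    (f : HilbertBasis κ' ℂ (ModeSpace β)) : HilbertBasis (κ × κ') ℂ (ModeSpace (α ⊕ β)) :=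
  HilbertBasis.mkOfOrthogonalEqBot (orthonormal_tensorLeft e f) (span_tensorLeft_orthogonal e f)

lemma tensorBasis_apply {κ κ' : Type*} (e : HilbertBasis κ ℂ (ModeSpace α))
    (f : HilbertBasis κ' ℂ (ModeSpace β)) (b : κ × κ') :
    tensorBasis e f b = tensorLeft (e b.1) (f b.2) := by
  rw [tensorBasis, HilbertBasis.coe_mkOfOrthogonalEqBot]

/-! ### The partial trace -/

section PartialTrace

variable {ρ : ModeOp (α ⊕ β)}

/-- The terms of the series defining the partial trace have traces summing to the trace of `ρ`. -/
lemma tsum_posTrace_tensorLeft (hρ : ρ.IsPositive) {κ : Type*}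
    (e : HilbertBasis κ ℂ (ModeSpace α)) :
    ∑' i, posTrace ((tensorLeft (e i)).adjoint ∘L ρ ∘L tensorLeft (β := β) (e i))
      = posTrace ρ := by
  let f := stdBasis (ModeSpace β)
  rw [posTrace_eq_tsum_expect hρ (tensorBasis e f), ENNReal.tsum_prod']
  refine tsum_congr fun i => ?_
  rw [posTrace_eq_tsum_expect (hρ.adjoint_conj _) f]
  refine tsum_congr fun j => ?_
  rw [expect_adjoint_conj, tensorBasis_apply]

lemma summable_partialTraceLeft (hρ : IsDensityOperator ρ) :
    Summable fun i => (tensorLeft (β := β) (stdBasis (ModeSpace α) i)).adjoint ∘L ρ ∘L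
      tensorLeft (stdBasis (ModeSpace α) i) := by
  refine Summable.of_norm ?_
  have h := tsum_posTrace_tensorLeft hρ.1 (stdBasis (ModeSpace α))
  rw [hρ.2] at h
  have h2 := ENNReal.summable_toReal (h.trans_ne ENNReal.one_ne_top)
  refine h2.of_nonneg_of_le (fun _ => norm_nonneg _) fun i => ?_
  have h3 := ofReal_norm_le_posTrace
    (hρ.1.adjoint_conj (tensorLeft (β := β) (stdBasis (ModeSpace α) i)))
  have h4 := ENNReal.ne_top_of_tsum_ne_top (h.trans_ne ENNReal.one_ne_top) i
  exact (ENNReal.ofReal_le_iff_le_toReal h4).1 h3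

lemma hasSum_inner_partialTraceLeft (hρ : IsDensityOperator ρ) (x y : ModeSpace β) :
    HasSum (fun i => inner ℂ (tensorLeft (stdBasis (ModeSpace α) i) x)
      (ρ (tensorLeft (stdBasis (ModeSpace α) i) y))) (inner ℂ x (partialTraceLeft ρ y)) := by
  have h := ((summable_partialTraceLeft hρ).hasSum.mapL
    (ContinuousLinearMap.apply ℂ (ModeSpace β) y)).mapL (innerSL ℂ x)
  refine h.of_forall_eq fun i => ?_
  rw [innerSL_apply_apply, ContinuousLinearMap.apply_apply, ContinuousLinearMap.comp_apply,
    ContinuousLinearMap.adjoint_inner_right]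
  rfl

lemma isPositive_partialTraceLeft (hρ : IsDensityOperator ρ) :
    (partialTraceLeft ρ).IsPositive := by
  rw [ContinuousLinearMap.isPositive_iff_complex]
  intro x
  have h := hasSum_inner_partialTraceLeft hρ x x
  have h1 : ∀ i, inner ℂ (tensorLeft (stdBasis (ModeSpace α) i) x)
      (ρ (tensorLeft (stdBasis (ModeSpace α) i) x))
      = (((inner ℂ (tensorLeft (stdBasis (ModeSpace α) i) x)
      (ρ (tensorLeft (stdBasis (ModeSpace α) i) x))).re : ℝ) : ℂ) := fun i =>
    inner_apply_self_eq_re hρ.1 _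
  have h2 := Complex.hasSum_re h
  have h3 : inner ℂ x (partialTraceLeft ρ x) = ((inner ℂ x (partialTraceLeft ρ x)).re : ℂ) :=
    h.unique ((Complex.hasSum_ofReal.2 h2).of_forall_eq h1)
  have h4 : 0 ≤ (inner ℂ x (partialTraceLeft ρ x)).re :=
    h2.nonneg fun i => inner_apply_self_re_nonneg hρ.1 _
  rw [← inner_conj_symm, h3, Complex.conj_ofReal]
  exact ⟨by simp, by simpa using h4⟩

/-- The partial trace may be evaluated in any orthonormal basis. -/
lemma expect_partialTraceLeft (hρ : IsDensityOperator ρ) {κ : Type*}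
    (e : HilbertBasis κ ℂ (ModeSpace α)) (x : ModeSpace β) :
    expect (partialTraceLeft ρ) x = ∑' i, expect ρ (tensorLeft (e i) x) := by
  have h := Complex.hasSum_re (hasSum_inner_partialTraceLeft hρ x x)
  have h1 : expect (partialTraceLeft ρ) x
      = ∑' i, expect ρ (tensorLeft (stdBasis (ModeSpace α) i) x) := by
    rw [expect, ← h.tsum_eq, ENNReal.ofReal_tsum_of_nonneg (fun i => inner_apply_self_re_nonneg hρ.1 _)
      h.summable]
    rfl
  have hb := tsum_expect_eq_tsum_expect (hρ.1.adjoint_conj (tensorRight x))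
    (stdBasis (ModeSpace α)) e
  simp_rw [expect_adjoint_conj, tensorRight_apply] at hb
  rw [h1, hb]

lemma isDensityOperator_partialTraceLeft (hρ : IsDensityOperator ρ) :
    IsDensityOperator (partialTraceLeft ρ) := by
  refine ⟨isPositive_partialTraceLeft hρ, ?_⟩
  let e := stdBasis (ModeSpace α)
  let f := stdBasis (ModeSpace β)
  rw [posTrace_eq_tsum_expect (isPositive_partialTraceLeft hρ) f]
  simp_rw [expect_partialTraceLeft hρ e]
  rw [ENNReal.tsum_comm, ← hρ.2, posTrace_eq_tsum_expect hρ.1 (tensorBasis e f),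
    ENNReal.tsum_prod']
  simp_rw [tensorBasis_apply]

/-- The expectation of the partial trace in terms of an eigenbasis of `ρ`. -/
lemma IsEigenbasis.expect_partialTraceLeft {κ : Type*}
    {b : HilbertBasis κ ℂ (ModeSpace (α ⊕ β))} {p : κ → ℝ} (h : IsEigenbasis ρ b p)
    (hρ : IsDensityOperator ρ) (x : ModeSpace β) :
    expect (partialTraceLeft ρ) x
      = ∑' k, ENNReal.ofReal (p k) * ‖(tensorRight x).adjoint (b k)‖ₑ ^ 2 := by
  let e := stdBasis (ModeSpace α)
  rw [_root_.expect_partialTraceLeft hρ e]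
  simp_rw [h.expect_eq]
  rw [ENNReal.tsum_comm]
  refine tsum_congr fun k => ?_
  rw [ENNReal.tsum_mul_left, ← e.tsum_enorm_inner_sq]
  congr 1
  refine tsum_congr fun i => ?_
  rw [← inner_tensorLeft_eq_right, ← inner_conj_symm, RCLike.enorm_conj]

end PartialTrace

end Tensor

/-! ### Orthogonality of matrix coefficients of the displacement operators -/

section Polarized

variable {ι : Type} [Fintype ι]

lemma memLp_inner_displacement (χ φ : ModeSpace ι) :
    MemLp (fun ξ => inner ℂ (displacement ξ χ) φ) 2 (phaseVolume ι) := by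
  refine ⟨(continuous_inner_displacement χ φ).aestronglyMeasurable, ?_⟩
  rw [eLpNorm_lt_top_iff_lintegral_rpow_enorm_lt_top two_ne_zero ENNReal.ofNat_ne_top]
  have h := lintegral_phaseVolume_enorm_inner_displacement_sq χ φ
  simp only [ENNReal.toReal_ofNat, ENNReal.rpow_ofNat]
  rw [h]
  exact ENNReal.mul_lt_top (ENNReal.pow_lt_top enorm_lt_top) (ENNReal.pow_lt_top enorm_lt_top)

/-- The matrix coefficient `ξ ↦ ⟨W(ξ) χ, φ⟩` as a square integrable function on phase space. -/
def matrixCoeff (χ φ : ModeSpace ι) : Lp ℂ 2 (phaseVolume ι) :=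
  (memLp_inner_displacement χ φ).toLp

lemma coeFn_matrixCoeff (χ φ : ModeSpace ι) :
    matrixCoeff χ φ =ᵐ[phaseVolume ι] fun ξ => inner ℂ (displacement ξ χ) φ :=
  MemLp.coeFn_toLp _

lemma norm_matrixCoeff (χ φ : ModeSpace ι) : ‖matrixCoeff χ φ‖ = ‖χ‖ * ‖φ‖ := by
  have h : ‖matrixCoeff χ φ‖ₑ ^ 2 = (‖χ‖ₑ * ‖φ‖ₑ) ^ 2 := by
    rw [enorm_sq_eq_lintegral, mul_pow, ← lintegral_phaseVolume_enorm_inner_displacement_sq]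
    refine lintegral_congr_ae ?_
    filter_upwards [coeFn_matrixCoeff χ φ] with ξ hξ
    rw [hξ]
  have h1 : ‖matrixCoeff χ φ‖ₑ = ‖χ‖ₑ * ‖φ‖ₑ :=
    le_antisymm ((ENNReal.pow_le_pow_left_iff two_ne_zero).1 h.le)
      ((ENNReal.pow_le_pow_left_iff two_ne_zero).1 h.ge)
  simpa using congrArg ENNReal.toReal h1

lemma matrixCoeff_add_right (χ φ φ' : ModeSpace ι) :
    matrixCoeff χ (φ + φ') = matrixCoeff χ φ + matrixCoeff χ φ' := by
  rw [matrixCoeff, matrixCoeff, matrixCoeff, ← MemLp.toLp_add]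
  exact MemLp.toLp_congr _ _ (ae_of_all _ fun ξ => inner_add_right _ _ _)

lemma matrixCoeff_smul_right (c : ℂ) (χ φ : ModeSpace ι) :
    matrixCoeff χ (c • φ) = c • matrixCoeff χ φ := by
  rw [matrixCoeff, matrixCoeff, ← MemLp.toLp_const_smul]
  exact MemLp.toLp_congr _ _ (ae_of_all _ fun ξ => inner_smul_right _ _ _)

lemma matrixCoeff_add_left (χ χ' φ : ModeSpace ι) :
    matrixCoeff (χ + χ') φ = matrixCoeff χ φ + matrixCoeff χ' φ := by
  rw [matrixCoeff, matrixCoeff, matrixCoeff, ← MemLp.toLp_add]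
  exact MemLp.toLp_congr _ _ (ae_of_all _ fun ξ => by
    simp only [map_add, inner_add_left, Pi.add_apply])

lemma matrixCoeff_smul_left (c : ℂ) (χ φ : ModeSpace ι) :
    matrixCoeff (c • χ) φ = (starRingEnd ℂ c) • matrixCoeff χ φ := by
  rw [matrixCoeff, matrixCoeff, ← MemLp.toLp_const_smul]
  exact MemLp.toLp_congr _ _ (ae_of_all _ fun ξ => by
    simp only [map_smul, inner_smul_left, Pi.smul_apply, smul_eq_mul])

/-- By polarization, from `‖⟨W(·) χ, φ⟩‖ = ‖χ‖ ‖φ‖`. -/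
lemma inner_matrixCoeff_self_left (χ : ModeSpace ι) {φ φ' : ModeSpace ι} (h : inner ℂ φ φ' = 0) :
    inner ℂ (matrixCoeff χ φ) (matrixCoeff χ φ') = 0 := by
  have key : ∀ c : ℂ, ‖matrixCoeff χ φ + c • matrixCoeff χ φ'‖ ^ 2
      = ‖χ‖ ^ 2 * (‖φ‖ ^ 2 + ‖c • φ'‖ ^ 2) := fun c => by
    rw [← matrixCoeff_smul_right, ← matrixCoeff_add_right, norm_matrixCoeff, mul_pow, pow_two ‖φ + _‖,
      norm_add_sq_eq_norm_sq_add_norm_sq_of_inner_eq_zero _ _ (by rw [inner_smul_right, h, mul_zero]),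
      pow_two ‖φ‖, pow_two ‖c • φ'‖]
  rw [inner_eq_sum_norm_sq_div_four]
  have h1 := key 1
  have h2 := key (-1)
  have h3 := key Complex.I
  have h4 := key (-Complex.I)
  simp only [one_smul, neg_smul, ← sub_eq_add_neg, norm_neg, norm_smul, Complex.norm_I] at h1 h2 h3 h4
  have hc : ∀ r : ℝ, (RCLike.ofReal r : ℂ) ^ 2 = ((r ^ 2 : ℝ) : ℂ) := fun r =>
    (Complex.ofReal_pow r 2).symm
  simp only [RCLike.I_to_complex]
  rw [hc, hc, hc, hc, h1, h2, h3, h4]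
  simp

/-- The matrix coefficients of orthogonal vectors are orthogonal. -/
lemma inner_matrixCoeff_eq_zero (χ χ' : ModeSpace ι) {φ φ' : ModeSpace ι} (h : inner ℂ φ φ' = 0) :
    inner ℂ (matrixCoeff χ φ) (matrixCoeff χ' φ') = 0 := by
  have h1 := inner_matrixCoeff_self_left (χ + χ') h
  have h2 := inner_matrixCoeff_self_left (χ + Complex.I • χ') h
  have h3 := inner_matrixCoeff_self_left χ h
  have h4 := inner_matrixCoeff_self_left χ' h
  simp only [matrixCoeff_add_left, matrixCoeff_smul_left, inner_add_left, inner_add_right,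
    inner_smul_left, inner_smul_right, h3, h4, map_neg, Complex.conj_I, neg_neg] at h1 h2
  linear_combination (1 / 2 : ℂ) * h1 + (Complex.I / 2) * h2 +
    (1 / 2 : ℂ) * (inner ℂ (matrixCoeff χ φ) (matrixCoeff χ' φ') -
      inner ℂ (matrixCoeff χ' φ) (matrixCoeff χ φ')) * Complex.I_sq

/-- Coefficients belonging to different `e a` are orthogonal, so only the diagonal terms survive. -/
lemma lintegral_enorm_sum_inner_displacement_sq {κ : Type*} {e : κ → ModeSpace ι}
    (he : Orthonormal ℂ e) (A : Finset κ) (χ : κ → ModeSpace ι) :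
    ∫⁻ ξ, ‖∑ a ∈ A, inner ℂ (displacement ξ (χ a)) (e a)‖ₑ ^ 2 ∂(phaseVolume ι)
      = ∑ a ∈ A, ‖χ a‖ₑ ^ 2 := by
  classical
  have h1 : ∫⁻ ξ, ‖∑ a ∈ A, inner ℂ (displacement ξ (χ a)) (e a)‖ₑ ^ 2 ∂(phaseVolume ι)
      = ‖∑ a ∈ A, matrixCoeff (χ a) (e a)‖ₑ ^ 2 := by
    rw [enorm_sq_eq_lintegral]
    refine lintegral_congr_ae ?_
    have h2 : ∀ᵐ ξ ∂(phaseVolume ι), ∀ a ∈ A, matrixCoeff (χ a) (e a) ξ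
        = inner ℂ (displacement ξ (χ a)) (e a) :=
      (ae_ball_iff A.countable_toSet).2 fun a _ => coeFn_matrixCoeff _ _
    filter_upwards [h2, Lp.coeFn_finsetSum A fun a => matrixCoeff (χ a) (e a)] with ξ h3 h4
    rw [h4, Finset.sum_apply, Finset.sum_congr rfl h3]
  have h5 : ‖∑ a ∈ A, matrixCoeff (χ a) (e a)‖ ^ 2 = ∑ a ∈ A, ‖χ a‖ ^ 2 := by
    have h6 : inner ℂ (∑ a ∈ A, matrixCoeff (χ a) (e a)) (∑ a ∈ A, matrixCoeff (χ a) (e a))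
        = ∑ a ∈ A, ((‖χ a‖ ^ 2 : ℝ) : ℂ) := by
      rw [sum_inner]
      refine Finset.sum_congr rfl fun a ha => ?_
      rw [inner_sum, Finset.sum_eq_single a]
      · rw [inner_self_eq_norm_sq_to_K, norm_matrixCoeff, he.1, mul_one]
        simp
      · exact fun b _ hb => inner_matrixCoeff_eq_zero _ _ (he.2 hb.symm)
      · exact fun h => absurd ha h
    rw [inner_self_eq_norm_sq_to_K, ← Complex.ofReal_sum] at h6
    refine Complex.ofReal_injective ?_
    rw [Complex.ofReal_pow]
    exact h6
  rw [h1, ← ofReal_norm, ← ENNReal.ofReal_pow (norm_nonneg _), h5,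
    ENNReal.ofReal_sum_of_nonneg fun _ _ => by positivity]
  refine Finset.sum_congr rfl fun a _ => ?_
  rw [ENNReal.ofReal_pow (norm_nonneg _), ofReal_norm]

end Polarized

/-! ### Averages over all displacements of a subsystem -/

section Twirl

instance instSeparableSpaceModeSpace (ι : Type) [Fintype ι] :
    TopologicalSpace.SeparableSpace (ModeSpace ι) := by
  have : Fact ((2 : ℝ≥0∞) ≠ ∞) := ⟨ENNReal.ofNat_ne_top⟩
  infer_instance

variable {α β : Type} [Fintype α] [Fintype β]

/-- The operator `W(ξ, 0) ρ W(ξ, 0)†`. -/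
def displaced (ρ : ModeOp (α ⊕ β)) (ξ : PhaseSpace α) : ModeOp (α ⊕ β) :=
  displacement (extendByZero ξ) ∘L ρ ∘L (displacement (extendByZero ξ)).adjoint

lemma neg_extendByZero (ξ : PhaseSpace α) :
    -(extendByZero ξ : PhaseSpace (α ⊕ β)) = extendByZero (-ξ) := by
  funext k
  obtain ⟨a | b, c⟩ := k <;> simp [extendByZero]

lemma displaced_apply (ρ : ModeOp (α ⊕ β)) (ξ : PhaseSpace α) (x : ModeSpace (α ⊕ β)) :
    displaced ρ ξ x = displacement (extendByZero ξ) (ρ (displacement (extendByZero (-ξ)) x)) := by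
  rw [displaced, adjoint_displacement, neg_extendByZero]
  rfl

lemma inner_displaced (ρ : ModeOp (α ⊕ β)) (ξ : PhaseSpace α) (x y : ModeSpace (α ⊕ β)) :
    inner ℂ x (displaced ρ ξ y) = inner ℂ (displacement (extendByZero (-ξ)) x)
      (ρ (displacement (extendByZero (-ξ)) y)) := by
  rw [displaced_apply, inner_displacement_right, neg_extendByZero]

lemma expect_displaced (ρ : ModeOp (α ⊕ β)) (ξ : PhaseSpace α) (x : ModeSpace (α ⊕ β)) :
    expect (displaced ρ ξ) x = expect ρ (displacement (extendByZero (-ξ)) x) := by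
  rw [expect, inner_displaced]
  rfl

lemma isPositive_displaced {ρ : ModeOp (α ⊕ β)} (hρ : ρ.IsPositive) (ξ : PhaseSpace α) :
    (displaced ρ ξ).IsPositive :=
  hρ.conj_adjoint _

lemma exists_displaced_hilbertBasis {ι : Type} [Fintype ι] {κ : Type*}
    (e : HilbertBasis κ ℂ (ModeSpace ι)) (ξ : PhaseSpace ι) :
    ∃ e' : HilbertBasis κ ℂ (ModeSpace ι), ∀ i, e' i = displacement ξ (e i) := by
  classical
  refine ⟨⟨(displacementEquiv ξ).symm.trans e.repr⟩, fun i => ?_⟩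
  rw [← displacementEquiv_apply, ← HilbertBasis.repr_symm_single, ← e.repr_symm_single]
  rfl

lemma posTrace_displaced {ρ : ModeOp (α ⊕ β)} (hρ : ρ.IsPositive) (ξ : PhaseSpace α) :
    posTrace (displaced ρ ξ) = posTrace ρ := by
  obtain ⟨e', he'⟩ := exists_displaced_hilbertBasis (stdBasis (ModeSpace (α ⊕ β)))
    (extendByZero (-ξ))
  rw [posTrace_eq_tsum_expect (isPositive_displaced hρ ξ) (stdBasis _),
    posTrace_eq_tsum_expect hρ e']
  exact tsum_congr fun i => by rw [expect_displaced, he']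

lemma inner_displacement_extendByZero_tensorLeft (ξ : PhaseSpace α) (χ : ModeSpace (α ⊕ β))
    (φ : ModeSpace α) (f : ModeSpace β) :
    inner ℂ (displacement (extendByZero ξ) χ) (tensorLeft φ f)
      = inner ℂ (displacement ξ ((tensorRight f).adjoint χ)) φ := by
  rw [← inner_displacement_displacement (extendByZero (-ξ)), displacement_extendByZero_tensorLeft,
    ← neg_extendByZero, displacement_neg_apply_self, ← inner_conj_symm, inner_tensorLeft_eq_right,
    inner_conj_symm, inner_displacement_right, neg_neg]

/-- Averaging over all displacements of `A` turns `ρ` into the unbounded operator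
`1 ⊗ tr_A ρ`. -/
lemma lintegral_expect_displaced {ρ : ModeOp (α ⊕ β)} (hρ : IsDensityOperator ρ)
    {κ κ' : Type*} (e : HilbertBasis κ ℂ (ModeSpace α)) {f : HilbertBasis κ' ℂ (ModeSpace β)}
    {q : κ' → ℝ} (hq : IsEigenbasis (partialTraceLeft ρ) f q) (B : Finset (κ × κ'))
    (c : κ × κ' → ℂ) :
    ∫⁻ ξ, expect (displaced ρ ξ) (∑ b ∈ B, c b • tensorBasis e f b) ∂(phaseVolume α)
      = ∑ b ∈ B, ENNReal.ofReal (q b.2) * ‖c b‖ₑ ^ 2 := by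
  classical
  obtain ⟨K, ψ, p, hp⟩ := exists_isEigenbasis hρ.1 (by rw [hρ.2]; exact ENNReal.one_ne_top)
  have hK := ψ.countable
  let A := B.image Prod.fst
  let J := B.image Prod.snd
  -- extended by zero to a rectangle `A × J`, the vector is `∑ a, e a ⊗ F a`
  let c' : κ × κ' → ℂ := fun b => if b ∈ B then c b else 0
  have hBs : B ⊆ A ×ˢ J := fun b hb => Finset.mem_product.2
    ⟨Finset.mem_image_of_mem _ hb, Finset.mem_image_of_mem _ hb⟩
  have hBA : ∀ {E : Type _} [AddCommMonoid E] (F : κ × κ' → ℂ → E), (∀ b, F b 0 = 0) →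
      ∑ b ∈ B, F b (c b) = ∑ a ∈ A, ∑ j ∈ J, F (a, j) (c' (a, j)) := by
    intro E _ F hF
    rw [← Finset.sum_product' (f := fun a j => F (a, j) (c' (a, j))), ← Finset.sum_subset hBs]
    · exact Finset.sum_congr rfl fun b hb => by simp only [c', if_pos hb]
    · intro b _ hb
      simp only [c', if_neg hb, hF]
  let F : κ → ModeSpace β := fun a => ∑ j ∈ J, c' (a, j) • f j
  have hsum : ∑ b ∈ B, c b • tensorBasis e f b = ∑ a ∈ A, tensorLeft (e a) (F a) := by
    rw [hBA (fun b z => z • tensorBasis e f b) fun b => zero_smul _ _]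
    refine Finset.sum_congr rfl fun a _ => ?_
    rw [map_sum]
    refine Finset.sum_congr rfl fun j _ => ?_
    rw [map_smul, tensorBasis_apply]
  have h1 : ∀ ξ, expect (displaced ρ ξ) (∑ b ∈ B, c b • tensorBasis e f b)
      = ∑' k, ENNReal.ofReal (p k) * ‖∑ a ∈ A, inner ℂ (displacement ξ
        ((tensorRight (F a)).adjoint (ψ k))) (e a)‖ₑ ^ 2 := fun ξ => by
    rw [expect_displaced, hp.expect_eq, hsum]
    refine tsum_congr fun k => ?_
    rw [← neg_extendByZero, inner_displacement_right, neg_neg, inner_sum]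
    simp_rw [inner_displacement_extendByZero_tensorLeft]
  simp_rw [h1]
  have hm : ∀ k, Measurable fun ξ => ‖∑ a ∈ A, inner ℂ (displacement ξ
        ((tensorRight (F a)).adjoint (ψ k))) (e a)‖ₑ ^ 2 := fun k =>
    ((continuous_finsetSum A fun a _ =>
      continuous_inner_displacement _ _).enorm.measurable).pow_const 2
  rw [lintegral_tsum fun k => ((hm k).const_mul _).aemeasurable]
  simp_rw [lintegral_const_mul _ (hm _),
    lintegral_enorm_sum_inner_displacement_sq e.orthonormal, Finset.mul_sum]
  rw [Summable.tsum_finsetSum fun _ _ => ENNReal.summable,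
    hBA (fun b z => ENNReal.ofReal (q b.2) * ‖z‖ₑ ^ 2) (by simp)]
  refine Finset.sum_congr rfl fun a _ => ?_
  rw [← hp.expect_partialTraceLeft hρ, hq.expect_eq, tsum_eq_sum (s := J)]
  · refine Finset.sum_congr rfl fun j hj => ?_
    rw [f.orthonormal.inner_right_sum (fun j => c' (a, j)) hj]
  · intro j hj
    have : inner ℂ (f j) (F a) = 0 := by
      rw [inner_sum]
      refine Finset.sum_eq_zero fun i hi => ?_
      rw [inner_smul_right, f.orthonormal.2 (fun h : j = i => hj (h.symm ▸ hi)), mul_zero]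
    rw [this]
    simp

end Twirl

/-! ### Centred normal laws on phase space -/

section Gauss

variable {ι : Type} [Fintype ι]

/-- The law of independent centred normal components of variance `t / 2` on phase space. -/
def phaseGaussian (ι : Type) [Fintype ι] (t : ℝ) : Measure (PhaseSpace ι) :=
  Measure.pi fun _ : ι × Fin 2 => gaussianReal 0 (t / 2).toNNReal

instance instIsProbabilityMeasurePhaseGaussian (ι : Type) [Fintype ι] (t : ℝ) :
    IsProbabilityMeasure (phaseGaussian ι t) := by
  unfold phaseGaussian
  infer_instance

/-- The density of `phaseGaussian ι t` with respect to `phaseVolume ι`. -/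
def gaussDensity (ι : Type) [Fintype ι] (t : ℝ) (ξ : PhaseSpace ι) : ℝ :=
  (2 / t) ^ Fintype.card ι * Real.exp (-(∑ k, ξ k ^ 2) / t)

lemma gaussDensity_pos {t : ℝ} (ht : 0 < t) (ξ : PhaseSpace ι) : 0 < gaussDensity ι t ξ := by
  unfold gaussDensity
  positivity

lemma continuous_gaussDensity (t : ℝ) : Continuous (gaussDensity ι t) := by
  unfold gaussDensity
  fun_prop

lemma gaussDensity_eq_prod {t : ℝ} (ht : 0 < t) (ξ : PhaseSpace ι) :
    gaussDensity ι t ξ = (2 * Real.pi) ^ Fintype.card ι *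
      ∏ k, gaussianPDFReal 0 (t / 2).toNNReal (ξ k) := by
  simp only [gaussianPDFReal, sub_zero, Real.coe_toNNReal _ (by positivity : 0 ≤ t / 2)]
  rw [Finset.prod_mul_distrib, ← Real.exp_sum, Finset.prod_const, Finset.card_univ,
    Fintype.card_prod, Fintype.card_fin, mul_comm (Fintype.card ι), pow_mul, inv_pow,
    Real.sq_sqrt (by positivity), ← mul_assoc, ← mul_pow, gaussDensity, ← Finset.sum_div,
    Finset.sum_neg_distrib]
  congr 2
  · field_simp
  · rw [mul_div_cancel₀ t two_ne_zero]

lemma withDensity_gaussDensity {t : ℝ} (ht : 0 < t) :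
    (phaseVolume ι).withDensity (fun ξ => ENNReal.ofReal (gaussDensity ι t ξ))
      = phaseGaussian ι t := by
  classical
  have hv : (t / 2).toNNReal ≠ 0 := by simp [ht]
  refine (Measure.pi_eq fun s hs => ?_).symm
  rw [withDensity_apply _ (MeasurableSet.univ_pi hs), phaseVolume, Measure.restrict_smul,
    lintegral_smul_measure]
  simp_rw [gaussianReal_apply_eq_integral _ hv]
  rw [← ENNReal.ofReal_prod_of_nonneg fun k _ =>
    setIntegral_nonneg (hs k) fun x _ => gaussianPDFReal_nonneg _ _ _]
  simp_rw [← integral_indicator (hs _)]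
  rw [← integral_fintype_prod_volume_eq_prod
    (fun k : ι × Fin 2 => (s k).indicator (gaussianPDFReal 0 (t / 2).toNNReal)),
    ofReal_integral_eq_lintegral_ofReal, ← lintegral_indicator (MeasurableSet.univ_pi hs),
    smul_eq_mul, ← lintegral_const_mul']
  · refine lintegral_congr fun ξ => ?_
    by_cases h : ξ ∈ Set.univ.pi s
    · rw [Set.indicator_of_mem h, gaussDensity_eq_prod ht,
        ENNReal.ofReal_mul (p := (2 * Real.pi) ^ _) (by positivity),
        ENNReal.ofReal_pow (by positivity), ← mul_assoc,
        ENNReal.inv_mul_cancel (two_pi_pow_ne_zero _) (two_pi_pow_ne_top _), one_mul]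
      congr 1
      exact Finset.prod_congr rfl fun k _ => by
        rw [Set.indicator_of_mem (h k (Set.mem_univ k))]
    · rw [Set.indicator_of_notMem h, mul_zero]
      simp only [Set.mem_univ_pi, not_forall] at h
      obtain ⟨k, hk⟩ := h
      rw [Finset.prod_eq_zero (Finset.mem_univ k) (Set.indicator_of_notMem hk _),
        ENNReal.ofReal_zero]
  · exact ENNReal.inv_ne_top.2 (two_pi_pow_ne_zero _)
  · exact Integrable.fintype_prod fun k => (integrable_gaussianPDFReal _ _).indicator (hs k)
  · exact ae_of_all _ fun ξ => Finset.prod_nonneg fun k _ =>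
      Set.indicator_nonneg (fun x _ => gaussianPDFReal_nonneg _ _ _) _

lemma lintegral_gaussDensity {t : ℝ} (ht : 0 < t) :
    ∫⁻ ξ, ENNReal.ofReal (gaussDensity ι t ξ) ∂(phaseVolume ι) = 1 := by
  rw [← setLIntegral_univ, ← withDensity_apply _ MeasurableSet.univ, withDensity_gaussDensity ht,
    measure_univ]

lemma integral_add_sq_phaseGaussian {t : ℝ} (ht : 0 ≤ t) (k : ι × Fin 2) (a : ℝ) :
    Integrable (fun ξ : PhaseSpace ι => (a + ξ k) ^ 2) (phaseGaussian ι t) ∧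
      ∫ ξ : PhaseSpace ι, (a + ξ k) ^ 2 ∂(phaseGaussian ι t) = a ^ 2 + t / 2 := by
  have hi : Integrable (fun x : ℝ => (a + x) ^ 2) (gaussianReal 0 (t / 2).toNNReal) :=
    ((memLp_const a).add (memLp_id_gaussianReal 2)).integrable_sq
  have hp : MeasurePreserving (fun ξ : PhaseSpace ι => ξ k) (phaseGaussian ι t)
      (gaussianReal 0 (t / 2).toNNReal) := measurePreserving_eval _ k
  have h2 : Integrable (fun x : ℝ => x ^ 2) (gaussianReal 0 (t / 2).toNNReal) :=
    (memLp_id_gaussianReal 2).integrable_sq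
  have h1 : Integrable (fun x : ℝ => x) (gaussianReal 0 (t / 2).toNNReal) :=
    (memLp_id_gaussianReal 1).integrable le_rfl
  have hvar : ∫ x, x ^ 2 ∂(gaussianReal 0 (t / 2).toNNReal) = t / 2 := by
    have h := variance_id_gaussianReal (μ := 0) (v := (t / 2).toNNReal)
    rw [variance_of_integral_eq_zero aemeasurable_id (by simp)] at h
    simpa [Real.coe_toNNReal _ (by positivity : 0 ≤ t / 2)] using h
  refine ⟨hp.integrable_comp_of_integrable hi, ?_⟩
  have h3 : ∫ ξ : PhaseSpace ι, (a + ξ k) ^ 2 ∂(phaseGaussian ι t)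
      = ∫ x, (a + x) ^ 2 ∂(gaussianReal 0 (t / 2).toNNReal) := by
    rw [← hp.map_eq, integral_map hp.measurable.aemeasurable (by fun_prop)]
  rw [h3]
  have h4 : ∀ x : ℝ, (a + x) ^ 2 = a ^ 2 + 2 * a * x + x ^ 2 := fun x => by ring
  simp_rw [h4]
  have h5 : Integrable (fun x : ℝ => 2 * a * x) (gaussianReal 0 (t / 2).toNNReal) :=
    h1.const_mul _
  have h6 : Integrable (fun x : ℝ => a ^ 2 + 2 * a * x) (gaussianReal 0 (t / 2).toNNReal) :=
    (integrable_const _).add h5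
  rw [integral_add h6 h2, integral_add (integrable_const _) h5, integral_const_mul, hvar,
    integral_id_gaussianReal]
  simp

end Gauss

/-! ### The diffused state -/

section Diffuse

variable {α β : Type} [Fintype α] [Fintype β] {ρ : ModeOp (α ⊕ β)}

lemma continuous_extendByZero : Continuous (extendByZero (α := α) (β := β)) := by
  have : (extendByZero (α := α) (β := β)) = fun ξ => joinPhase (ξ, 0) :=
    funext extendByZero_eq_joinPhase
  rw [this]
  exact continuous_joinPhase.comp (by fun_prop)

/-- A density operator is the norm convergent sum of its spectral decomposition, so conjugation by
displacement operators is continuous in operator norm. -/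
lemma continuous_displaced (hρ : IsDensityOperator ρ) : Continuous (displaced ρ) := by
  obtain ⟨K, ψ, p, hp⟩ := exists_isEigenbasis hρ.1 (by rw [hρ.2]; exact ENNReal.one_ne_top)
  have hs := (hp.hasSum_one hρ).summable
  let F : PhaseSpace α → K → ModeOp (α ⊕ β) := fun ξ k =>
    (p k : ℂ) • InnerProductSpace.rankOne ℂ (displacement (extendByZero ξ) (ψ k))
      (displacement (extendByZero ξ) (ψ k))
  have hF : ∀ ξ k, ‖F ξ k‖ ≤ p k := fun ξ k => by
    rw [norm_smul, InnerProductSpace.norm_rankOne, norm_displacement, ψ.orthonormal.1,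
      Complex.norm_real, Real.norm_eq_abs, abs_of_nonneg (hp.nonneg k)]
    simp
  have hFs : ∀ ξ, Summable (F ξ) := fun ξ => Summable.of_norm_bounded hs (hF ξ)
  have heq : displaced ρ = fun ξ => ∑' k, F ξ k := by
    funext ξ
    refine ContinuousLinearMap.ext fun x => ?_
    have h1 := (hFs ξ).hasSum.mapL (ContinuousLinearMap.apply ℂ (ModeSpace (α ⊕ β)) x)
    rw [displaced_apply]
    refine HasSum.unique ?_ h1
    refine ((hp.hasSum_apply _).mapL (displacement (extendByZero ξ))).of_forall_eq fun k => ?_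
    rw [map_smul, mul_smul, ← neg_extendByZero, inner_displacement_right, neg_neg,
      map_smul (displacement (extendByZero ξ)), map_smul (displacement (extendByZero ξ))]
    rfl
  rw [heq]
  refine continuous_tsum (fun k => ?_) hs fun k ξ => hF ξ k
  exact (continuous_rankOne_self ((continuous_displacement_apply (ψ k)).comp
    continuous_extendByZero)).const_smul (p k : ℂ)

lemma norm_displaced_le (ρ : ModeOp (α ⊕ β)) (ξ : PhaseSpace α) : ‖displaced ρ ξ‖ ≤ ‖ρ‖ := by
  refine ContinuousLinearMap.opNorm_le_bound _ (norm_nonneg _) fun x => ?_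
  rw [displaced_apply, norm_displacement]
  refine (ρ.le_opNorm _).trans_eq ?_
  rw [norm_displacement]

lemma integrable_displaced (hρ : IsDensityOperator ρ) (t : ℝ) :
    Integrable (displaced ρ) (phaseGaussian α t) :=
  Integrable.of_bound (continuous_displaced hρ).aestronglyMeasurable ‖ρ‖
    (ae_of_all _ (norm_displaced_le ρ))

lemma integrable_inner_displaced (hρ : IsDensityOperator ρ) (t : ℝ)
    (x y : ModeSpace (α ⊕ β)) :
    Integrable (fun ξ => inner ℂ x (displaced ρ ξ y)) (phaseGaussian α t) := by
  have h := (innerApply x y).integrable_comp (integrable_displaced hρ t)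
  simpa only [innerApply_apply] using h

lemma continuous_inner_displaced (hρ : IsDensityOperator ρ) (x y : ModeSpace (α ⊕ β)) :
    Continuous fun ξ => inner ℂ x (displaced ρ ξ y) := by
  have h := (innerApply x y).continuous.comp (continuous_displaced hρ)
  simpa only [Function.comp_def, innerApply_apply] using h

lemma inner_diffuseLeft (hρ : IsDensityOperator ρ) (t : ℝ) (x y : ModeSpace (α ⊕ β)) :
    inner ℂ x (diffuseLeft t ρ y) = ∫ ξ, inner ℂ x (displaced ρ ξ y) ∂(phaseGaussian α t) := by
  have h := (innerApply x y).integral_comp_comm (integrable_displaced hρ t)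
  simp only [innerApply_apply] at h
  rw [h]
  rfl

lemma re_inner_diffuseLeft (hρ : IsDensityOperator ρ) (t : ℝ) (x : ModeSpace (α ⊕ β)) :
    inner ℂ x (diffuseLeft t ρ x)
      = ((∫ ξ, (inner ℂ x (displaced ρ ξ x)).re ∂(phaseGaussian α t) : ℝ) : ℂ) := by
  rw [inner_diffuseLeft hρ, ← integral_complex_ofReal]
  exact integral_congr_ae (ae_of_all _ fun ξ =>
    inner_apply_self_eq_re (isPositive_displaced hρ.1 ξ) x)

lemma expect_diffuseLeft (hρ : IsDensityOperator ρ) (t : ℝ) (x : ModeSpace (α ⊕ β)) :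
    expect (diffuseLeft t ρ) x = ∫⁻ ξ, expect (displaced ρ ξ) x ∂(phaseGaussian α t) := by
  rw [expect, re_inner_diffuseLeft hρ, Complex.ofReal_re, ofReal_integral_eq_lintegral_ofReal]
  · rfl
  · exact (integrable_inner_displaced hρ t x x).re
  · exact ae_of_all _ fun ξ => inner_apply_self_re_nonneg (isPositive_displaced hρ.1 ξ) x

lemma isPositive_diffuseLeft (hρ : IsDensityOperator ρ) (t : ℝ) :
    (diffuseLeft t ρ).IsPositive := by
  rw [ContinuousLinearMap.isPositive_iff_complex]
  intro x
  have h4 : 0 ≤ ∫ ξ, (inner ℂ x (displaced ρ ξ x)).re ∂(phaseGaussian α t) :=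
    integral_nonneg fun ξ => inner_apply_self_re_nonneg (isPositive_displaced hρ.1 ξ) x
  rw [← inner_conj_symm, re_inner_diffuseLeft hρ, Complex.conj_ofReal]
  exact ⟨by simp, by simpa using h4⟩

lemma measurable_expect_displaced (hρ : IsDensityOperator ρ) (x : ModeSpace (α ⊕ β)) :
    Measurable fun ξ => expect (displaced ρ ξ) x :=
  (Complex.continuous_re.comp (continuous_inner_displaced hρ x x)).measurable.ennreal_ofReal

lemma isDensityOperator_diffuseLeft (hρ : IsDensityOperator ρ) (t : ℝ) :
    IsDensityOperator (diffuseLeft t ρ) := by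
  refine ⟨isPositive_diffuseLeft hρ t, ?_⟩
  let e := stdBasis (ModeSpace (α ⊕ β))
  have := e.countable
  rw [posTrace_eq_tsum_expect (isPositive_diffuseLeft hρ t) e]
  simp_rw [expect_diffuseLeft hρ]
  rw [← lintegral_tsum fun i => (measurable_expect_displaced hρ _).aemeasurable]
  simp_rw [← posTrace_eq_tsum_expect (isPositive_displaced hρ.1 _) e, posTrace_displaced hρ.1, hρ.2]
  simp

/-- Diffusion on `A` does not change the reduced state of `B`. -/
lemma partialTraceLeft_diffuseLeft (hρ : IsDensityOperator ρ) (t : ℝ) :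
    partialTraceLeft (diffuseLeft t ρ) = partialTraceLeft ρ := by
  refine eq_of_expect_eq (isPositive_partialTraceLeft (isDensityOperator_diffuseLeft hρ t))
    (isPositive_partialTraceLeft hρ) fun x => ?_
  let e := stdBasis (ModeSpace α)
  have := e.countable
  rw [expect_partialTraceLeft (isDensityOperator_diffuseLeft hρ t) e]
  simp_rw [expect_diffuseLeft hρ]
  rw [← lintegral_tsum fun i => (measurable_expect_displaced hρ _).aemeasurable]
  have h : ∀ ξ, ∑' i, expect (displaced ρ ξ) (tensorLeft (e i) x)
      = expect (partialTraceLeft ρ) x := fun ξ => by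
    obtain ⟨e', he'⟩ := exists_displaced_hilbertBasis e (-ξ)
    rw [expect_partialTraceLeft hρ e']
    refine tsum_congr fun i => ?_
    rw [expect_displaced, displacement_extendByZero_tensorLeft, he']
  simp_rw [h]
  simp

end Diffuse

/-! ### The lower bound on the entropy gained by diffusion -/

section Scalar

variable {ι : Type} [Fintype ι]

lemma log_gaussDensity {t : ℝ} (ht : 0 < t) (ξ : PhaseSpace ι) :
    Real.log (gaussDensity ι t ξ) = -(Fintype.card ι * Real.log (t / 2)) - (∑ k, ξ k ^ 2) / t := by
  rw [gaussDensity, Real.log_mul (by positivity) (Real.exp_pos _).ne', Real.log_exp, Real.log_pow,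
    ← inv_div, Real.log_inv]
  ring

lemma integrable_sum_sq_phaseGaussian {t : ℝ} (ht : 0 ≤ t) :
    Integrable (fun ξ : PhaseSpace ι => ∑ k, ξ k ^ 2) (phaseGaussian ι t) :=
  integrable_finsetSum _ fun k _ => by simpa using (integral_add_sq_phaseGaussian ht k 0).1

lemma integral_sum_sq_phaseGaussian {t : ℝ} (ht : 0 ≤ t) :
    ∫ ξ : PhaseSpace ι, ∑ k, ξ k ^ 2 ∂(phaseGaussian ι t) = Fintype.card ι * t := by
  have h : ∀ k : ι × Fin 2, ∫ ξ : PhaseSpace ι, ξ k ^ 2 ∂(phaseGaussian ι t) = t / 2 := fun k => by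
    simpa using (integral_add_sq_phaseGaussian ht k 0).2
  rw [integral_finsetSum _ fun k _ => by simpa using (integral_add_sq_phaseGaussian ht k 0).1]
  simp only [h, Finset.sum_const, Finset.card_univ, Fintype.card_prod, Fintype.card_fin,
    nsmul_eq_mul]
  push_cast
  ring

lemma integrable_log_gaussDensity {t : ℝ} (ht : 0 < t) :
    Integrable (fun ξ => Real.log (gaussDensity ι t ξ)) (phaseGaussian ι t) := by
  simp_rw [log_gaussDensity ht]
  exact (integrable_const _).sub ((integrable_sum_sq_phaseGaussian ht.le).div_const t)

/-- The negative of the differential entropy of the normal law, relative to `phaseVolume`. -/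
lemma integral_log_gaussDensity {t : ℝ} (ht : 0 < t) :
    ∫ ξ, Real.log (gaussDensity ι t ξ) ∂(phaseGaussian ι t)
      = -(Fintype.card ι * (1 + Real.log (t / 2))) := by
  simp_rw [log_gaussDensity ht]
  rw [integral_sub (integrable_const _) ((integrable_sum_sq_phaseGaussian ht.le).div_const t),
    integral_div, integral_sum_sq_phaseGaussian ht.le]
  simp only [integral_const, probReal_univ, smul_eq_mul]
  field_simp
  ring

lemma log_one_add_le_two_mul_sqrt {x : ℝ} (hx : 0 ≤ x) : Real.log (1 + x) ≤ 2 * √x := by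
  have h1 : 1 + x ≤ (1 + √x) ^ 2 := by nlinarith [Real.sqrt_nonneg x, Real.sq_sqrt hx]
  calc Real.log (1 + x) ≤ Real.log ((1 + √x) ^ 2) := Real.log_le_log (by positivity) h1
    _ = 2 * Real.log (1 + √x) := by rw [Real.log_pow]; norm_num
    _ ≤ 2 * √x := by
      have := Real.log_le_sub_one_of_pos (by positivity : 0 < 1 + √x)
      linarith

/-- The square root of a Gaussian density is a multiple of a Gaussian density of twice the
variance. -/
lemma inv_sqrt_gaussDensity {t : ℝ} (ht : 0 < t) (ξ : PhaseSpace ι) :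
    gaussDensity ι t ξ * (√(gaussDensity ι t ξ))⁻¹
      = √((2 / t) ^ Fintype.card ι) * t ^ Fintype.card ι * gaussDensity ι (2 * t) ξ := by
  have h := gaussDensity_pos ht ξ
  rw [← div_eq_mul_inv, Real.div_sqrt, gaussDensity, gaussDensity, Real.sqrt_mul (by positivity),
    Real.sqrt_eq_rpow (Real.exp _), ← Real.exp_mul, mul_assoc, ← mul_assoc (t ^ _), ← mul_pow]
  have h2 : t * (2 / (2 * t)) = 1 := by field_simp
  rw [h2, one_pow, one_mul]
  congr 2
  field_simp

lemma integrable_inv_sqrt_gaussDensity {t : ℝ} (ht : 0 < t) :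
    Integrable (fun ξ => (√(gaussDensity ι t ξ))⁻¹) (phaseGaussian ι t) := by
  have hm : Measurable fun ξ => (√(gaussDensity ι t ξ))⁻¹ :=
    ((continuous_gaussDensity t).measurable.sqrt).inv
  refine ⟨hm.aestronglyMeasurable, ?_⟩
  rw [hasFiniteIntegral_iff_ofReal (ae_of_all _ fun ξ => by positivity),
    ← withDensity_gaussDensity ht,
    lintegral_withDensity_eq_lintegral_mul _ (continuous_gaussDensity t).measurable.ennreal_ofReal
      hm.ennreal_ofReal]
  simp only [Pi.mul_apply]
  simp_rw [← ENNReal.ofReal_mul (gaussDensity_pos ht _).le, inv_sqrt_gaussDensity ht,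
    ENNReal.ofReal_mul (by positivity : 0 ≤ √((2 / t) ^ Fintype.card ι) * t ^ Fintype.card ι)]
  rw [lintegral_const_mul _ (continuous_gaussDensity _).measurable.ennreal_ofReal,
    lintegral_gaussDensity (by positivity), mul_one]
  exact ENNReal.ofReal_lt_top

/-- As `S → ∞`, `∫ log (1 + S r) dγ - log S` is asymptotically at most `∫ log r dγ`. -/
lemma lintegral_log_one_add_mul_gaussDensity_le {t : ℝ} (ht : 0 < t) {S : ℝ} (hS : 1 ≤ S) :
    0 ≤ Real.log S - Fintype.card ι * (1 + Real.log (t / 2))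
        + 2 * (√S)⁻¹ * ∫ ξ, (√(gaussDensity ι t ξ))⁻¹ ∂(phaseGaussian ι t) ∧
    ∫⁻ ξ, ENNReal.ofReal (Real.log (1 + S * gaussDensity ι t ξ)) ∂(phaseGaussian ι t)
      ≤ ENNReal.ofReal (Real.log S - Fintype.card ι * (1 + Real.log (t / 2))
        + 2 * (√S)⁻¹ * ∫ ξ, (√(gaussDensity ι t ξ))⁻¹ ∂(phaseGaussian ι t)) := by
  have hS0 : 0 < S := by linarith
  have hb : ∀ ξ, Real.log (1 + S * gaussDensity ι t ξ)
      ≤ (Real.log S + Real.log (gaussDensity ι t ξ)) + 2 * (√S)⁻¹ * (√(gaussDensity ι t ξ))⁻¹ :=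
    fun ξ => by
      have h := gaussDensity_pos ht ξ
      have h1 : 1 + S * gaussDensity ι t ξ
          = S * gaussDensity ι t ξ * (1 + (S * gaussDensity ι t ξ)⁻¹) := by field_simp; ring
      rw [h1, Real.log_mul (by positivity) (by positivity), Real.log_mul hS0.ne' h.ne']
      have h2 := log_one_add_le_two_mul_sqrt (x := (S * gaussDensity ι t ξ)⁻¹) (by positivity)
      rw [Real.sqrt_inv, Real.sqrt_mul hS0.le, mul_inv (√S), ← mul_assoc] at h2
      linarith
  have hi1 : Integrable (fun ξ => Real.log S + Real.log (gaussDensity ι t ξ))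
      (phaseGaussian ι t) := (integrable_const _).add (integrable_log_gaussDensity ht)
  have hi2 : Integrable (fun ξ => 2 * (√S)⁻¹ * (√(gaussDensity ι t ξ))⁻¹) (phaseGaussian ι t) :=
    (integrable_inv_sqrt_gaussDensity ht).const_mul _
  have hpos : ∀ ξ, 0 ≤ (Real.log S + Real.log (gaussDensity ι t ξ))
      + 2 * (√S)⁻¹ * (√(gaussDensity ι t ξ))⁻¹ := fun ξ =>
    (Real.log_nonneg (by have := gaussDensity_pos ht ξ; nlinarith)).trans (hb ξ)
  have hE : ∫ ξ, ((Real.log S + Real.log (gaussDensity ι t ξ))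
      + 2 * (√S)⁻¹ * (√(gaussDensity ι t ξ))⁻¹) ∂(phaseGaussian ι t)
      = Real.log S - Fintype.card ι * (1 + Real.log (t / 2))
        + 2 * (√S)⁻¹ * ∫ ξ, (√(gaussDensity ι t ξ))⁻¹ ∂(phaseGaussian ι t) := by
    rw [integral_add hi1 hi2, integral_add (integrable_const _) (integrable_log_gaussDensity ht),
      integral_const_mul, integral_log_gaussDensity ht]
    simp [sub_eq_add_neg]
  rw [← hE]
  refine ⟨integral_nonneg hpos, ?_⟩
  have hi3 : Integrable (fun ξ => (Real.log S + Real.log (gaussDensity ι t ξ))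
      + 2 * (√S)⁻¹ * (√(gaussDensity ι t ξ))⁻¹) (phaseGaussian ι t) := hi1.add hi2
  rw [ofReal_integral_eq_lintegral_ofReal hi3 (ae_of_all _ hpos)]
  exact lintegral_mono fun ξ => ENNReal.ofReal_le_ofReal (hb ξ)

end Scalar

section Lower

variable {α β : Type} [Fintype α] [Fintype β] {ρ : ModeOp (α ⊕ β)}

/-- The entropy of the diffused state exceeds that of the reduced state of `B` by at least the
differential entropy of the noise. -/
lemma le_vonNeumannEntropy_diffuseLeft (hρ : IsDensityOperator ρ) {t : ℝ} (ht : 0 < t)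
    (hR : vonNeumannEntropy (diffuseLeft t ρ) ≠ ∞)
    (hB : vonNeumannEntropy (partialTraceLeft ρ) ≠ ∞) :
    Fintype.card α * (1 + Real.log (t / 2))
      ≤ (vonNeumannEntropy (diffuseLeft t ρ)).toReal
        - (vonNeumannEntropy (partialTraceLeft ρ)).toReal := by
  have hρB := isDensityOperator_partialTraceLeft hρ
  have hRd := isDensityOperator_diffuseLeft hρ t
  obtain ⟨K, f, q, hq⟩ := exists_isEigenbasis hρB.1 (by rw [hρB.2]; exact ENNReal.one_ne_top)
  let e := stdBasis (ModeSpace α)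
  have hsum : ∀ j, ∑' i, expect (diffuseLeft t ρ) (tensorBasis e f (i, j)) = ENNReal.ofReal (q j) :=
    fun j => by
      simp_rw [tensorBasis_apply]
      rw [← expect_partialTraceLeft hRd e, partialTraceLeft_diffuseLeft hρ, hq.expect_self]
  have hent : ∑' b : _ × K, expect (diffuseLeft t ρ) (tensorBasis e f b)
      * ENNReal.ofReal (-Real.log (q b.2)) = vonNeumannEntropy (partialTraceLeft ρ) := by
    rw [ENNReal.tsum_prod', ENNReal.tsum_comm, hρB.vonNeumannEntropy_eq hq]
    refine tsum_congr fun j => ?_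
    simp only
    rw [ENNReal.tsum_mul_right, hsum, ← ENNReal.ofReal_mul (hq.nonneg j), Real.negMulLog,
      neg_mul, mul_neg]
  -- the terms `log S` on both sides of the regularised inequality cancel
  have hle : ∀ S : ℝ, 1 ≤ S → Fintype.card α * (1 + Real.log (t / 2))
      - 2 * (√S)⁻¹ * ∫ ξ, (√(gaussDensity α t ξ))⁻¹ ∂(phaseGaussian α t)
      ≤ (vonNeumannEntropy (diffuseLeft t ρ)).toReal
        - (vonNeumannEntropy (partialTraceLeft ρ)).toReal := fun S hS => by
    have h := log_add_tsum_le (μ := phaseVolume α) (r := gaussDensity α t)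
      (fun ξ => (gaussDensity_pos ht ξ).le) (continuous_gaussDensity t).measurable
      (τ := displaced ρ) (isPositive_displaced hρ.1)
      (fun ξ => ((posTrace_displaced hρ.1 ξ).trans hρ.2).le)
      (fun x y => (continuous_inner_displaced hρ x y).measurable) hRd
      (by rw [withDensity_gaussDensity ht]; exact integrable_inner_displaced hρ t)
      (by rw [withDensity_gaussDensity ht]; exact inner_diffuseLeft hρ t)
      (by rw [withDensity_gaussDensity ht]; exact expect_diffuseLeft hρ t)
      (g := tensorBasis e f) (q := fun b => q b.2) (fun b => hq.nonneg _)
      (fun b => hq.le_one hρB _)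
      (fun b hb => by
        have h1 := hsum b.2
        rw [show q b.2 = 0 from hb, ENNReal.ofReal_zero, ENNReal.tsum_eq_zero] at h1
        exact h1 b.1)
      (fun B c => lintegral_expect_displaced hρ e hq B c) hS
    rw [hent, withDensity_gaussDensity ht] at h
    obtain ⟨h3, h4⟩ := lintegral_log_one_add_mul_gaussDensity_le (ι := α) ht hS
    have h2 := h.trans (add_le_add_left h4 _)
    have hpos : 0 ≤ Real.log S := Real.log_nonneg hS
    rw [← ENNReal.ofReal_toReal hR, ← ENNReal.ofReal_toReal hB,
      ← ENNReal.ofReal_add hpos ENNReal.toReal_nonneg,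
      ← ENNReal.ofReal_add h3 ENNReal.toReal_nonneg,
      ENNReal.ofReal_le_ofReal_iff (by positivity)] at h2
    linarith
  have hlim : Tendsto (fun S : ℝ => Fintype.card α * (1 + Real.log (t / 2))
      - 2 * (√S)⁻¹ * ∫ ξ, (√(gaussDensity α t ξ))⁻¹ ∂(phaseGaussian α t)) atTop
      (𝓝 (Fintype.card α * (1 + Real.log (t / 2))
        - 2 * 0 * ∫ ξ, (√(gaussDensity α t ξ))⁻¹ ∂(phaseGaussian α t))) :=
    tendsto_const_nhds.sub (((tendsto_inv_atTop_zero.comp Real.tendsto_sqrt_atTop).const_mul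
      2).mul_const _)
  rw [mul_zero, zero_mul, sub_zero] at hlim
  exact le_of_tendsto hlim ((eventually_ge_atTop 1).mono hle)

end Lower

/-! ### Second moments of the Husimi function -/

section Husimi

variable {ι : Type} [Fintype ι]

lemma IsGaussianState.isDensityOperator {ρ : ModeOp ι} (hρ : IsGaussianState ρ) :
    IsDensityOperator ρ := by
  obtain ⟨M, d, h, -⟩ := hρ
  exact h

lemma norm_exp_sub_one_sq (x : ℝ) : ‖Complex.exp (x * Complex.I) - 1‖ ^ 2 = 2 - 2 * Real.cos x := by
  rw [Complex.exp_mul_I, ← Complex.ofReal_cos, ← Complex.ofReal_sin, ← Complex.normSq_eq_norm_sq,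
    Complex.normSq_apply]
  simp only [Complex.sub_re, Complex.add_re, Complex.ofReal_re, Complex.mul_re, Complex.I_re,
    Complex.ofReal_im, Complex.I_im, Complex.one_re, Complex.sub_im, Complex.add_im,
    Complex.mul_im, Complex.one_im]
  nlinarith [Real.sin_sq_add_cos_sq x]

/-- Conjugation by `exp (i u · R)` multiplies matrix coefficients of displacement operators by
characters of phase space. -/
lemma exp_mul_inner_displacement (u ξ : PhaseSpace ι) (φ ψ : ModeSpace ι) :
    Complex.exp (((u ⬝ᵥ ξ : ℝ) : ℂ) * Complex.I) * inner ℂ (displacement ξ φ) ψ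
      = inner ℂ (displacement ξ (modeExp u φ)) (modeExp u ψ) := by
  rw [modeExp, ← inner_displacement_displacement (fun k => ![-u (k.1, 1), u (k.1, 0)] k.2)
    (displacement ξ φ), displacement_displacement, displacement_displacement, inner_smul_left,
    inner_smul_left, add_comm ξ, ← mul_assoc, ← Complex.exp_conj, ← Complex.exp_conj,
    ← Complex.exp_add]
  congr 2
  simp only [map_mul, Complex.conj_ofReal, Complex.conj_I, mul_neg]
  rw [← sub_eq_add_neg, ← sub_mul, ← Complex.ofReal_sub, ← neg_mul, ← Complex.ofReal_neg]
  congr 2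
  rw [dotProduct, Fintype.sum_prod_type, ← Finset.sum_sub_distrib, ← Finset.sum_neg_distrib]
  refine Finset.sum_congr rfl fun k _ => ?_
  simp only [Fin.sum_univ_two, Matrix.cons_val_zero, Matrix.cons_val_one]
  ring

lemma norm_modeExp_sub_sq (u : PhaseSpace ι) (ψ : ModeSpace ι) :
    ‖modeExp u ψ - ψ‖ ^ 2 = 2 * ‖ψ‖ ^ 2 - 2 * (inner ℂ ψ (modeExp u ψ)).re := by
  have h := norm_sub_sq (𝕜 := ℂ) (modeExp u ψ) ψ
  rw [← inner_conj_symm, RCLike.conj_re] at h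
  rw [h, modeExp, norm_displacement]
  simp only [RCLike.re_to_complex]
  ring

/-- Multiplication by a character is conjugation by `exp (i u · R)`, so the deviation of the
character from `1` is controlled by the displacement of the two vectors. -/
lemma lintegral_exp_sub_one_mul_inner_displacement_le (u : PhaseSpace ι) (φ ψ : ModeSpace ι) :
    ∫⁻ ξ, ‖Complex.exp (((u ⬝ᵥ ξ : ℝ) : ℂ) * Complex.I) - 1‖ₑ ^ 2
        * ‖inner ℂ (displacement ξ φ) ψ‖ₑ ^ 2 ∂(phaseVolume ι)
      ≤ 2 * (‖modeExp u φ - φ‖ₑ ^ 2 * ‖ψ‖ₑ ^ 2) + 2 * (‖φ‖ₑ ^ 2 * ‖modeExp u ψ - ψ‖ₑ ^ 2) := by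
  have hn : ‖modeExp u ψ‖ₑ = ‖ψ‖ₑ := by
    rw [← ofReal_norm, modeExp, norm_displacement, ofReal_norm]
  have h : ∀ ξ, ‖Complex.exp (((u ⬝ᵥ ξ : ℝ) : ℂ) * Complex.I) - 1‖ₑ ^ 2
        * ‖inner ℂ (displacement ξ φ) ψ‖ₑ ^ 2
      ≤ 2 * ‖inner ℂ (displacement ξ (modeExp u φ - φ)) (modeExp u ψ)‖ₑ ^ 2
        + 2 * ‖inner ℂ (displacement ξ φ) (modeExp u ψ - ψ)‖ₑ ^ 2 := fun ξ => by
    refine le_trans (le_of_eq ?_) (enorm_add_sq_le _ _)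
    rw [← mul_pow, ← enorm_mul, sub_mul, one_mul, exp_mul_inner_displacement, map_sub,
      inner_sub_left, inner_sub_right]
    congr 2
    ring
  refine (lintegral_mono h).trans_eq ?_
  have hm : ∀ φ ψ : ModeSpace ι, Measurable fun ξ => ‖inner ℂ (displacement ξ φ) ψ‖ₑ ^ 2 :=
    fun φ ψ => (continuous_inner_displacement φ ψ).enorm.measurable.pow_const 2
  rw [lintegral_add_left ((hm _ _).const_mul 2), lintegral_const_mul _ (hm _ _),
    lintegral_const_mul _ (hm _ _), lintegral_phaseVolume_enorm_inner_displacement_sq,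
    lintegral_phaseVolume_enorm_inner_displacement_sq, hn]

lemma continuous_inner_displacement_apply (ρ : ModeOp ι) (φ : ModeSpace ι) :
    Continuous fun ξ => inner ℂ (displacement ξ φ) (ρ (displacement ξ φ)) :=
  (continuous_displacement_apply φ).inner (ρ.continuous.comp (continuous_displacement_apply φ))

lemma measurable_expect_displacement (ρ : ModeOp ι) (φ : ModeSpace ι) :
    Measurable fun ξ => expect ρ (displacement ξ φ) :=
  (Complex.continuous_re.comp (continuous_inner_displacement_apply ρ φ)).measurable.ennreal_ofReal

lemma measurable_exp_sub_one (u : PhaseSpace ι) :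
    Measurable fun ξ : PhaseSpace ι =>
      ‖Complex.exp (((u ⬝ᵥ ξ : ℝ) : ℂ) * Complex.I) - 1‖ₑ ^ 2 := by
  have h : Continuous fun ξ : PhaseSpace ι =>
      Complex.exp (((u ⬝ᵥ ξ : ℝ) : ℂ) * Complex.I) - 1 := by
    unfold dotProduct
    fun_prop
  exact h.enorm.measurable.pow_const 2

/-- The characteristic functions of `φ` and of `ρ` control the characteristic function of the Husimi
function. -/
lemma lintegral_exp_sub_one_mul_expect_le {ρ : ModeOp ι} (hρ : IsDensityOperator ρ)
    {φ : ModeSpace ι} (hφ : ‖φ‖ = 1) (u : PhaseSpace ι) :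
    ∫⁻ ξ, ‖Complex.exp (((u ⬝ᵥ ξ : ℝ) : ℂ) * Complex.I) - 1‖ₑ ^ 2
        * expect ρ (displacement ξ φ) ∂(phaseVolume ι)
      ≤ ENNReal.ofReal (2 * (2 - 2 * (inner ℂ φ (modeExp u φ)).re)
        + 2 * (2 - 2 * (opTrace (ρ ∘L modeExp u)).re)) := by
  obtain ⟨K, ψ, p, hp⟩ := exists_isEigenbasis hρ.1 (by rw [hρ.2]; exact ENNReal.one_ne_top)
  have := ψ.countable
  have h1 : ∀ ξ, ‖Complex.exp (((u ⬝ᵥ ξ : ℝ) : ℂ) * Complex.I) - 1‖ₑ ^ 2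
        * expect ρ (displacement ξ φ)
      = ∑' k, ENNReal.ofReal (p k) * (‖Complex.exp (((u ⬝ᵥ ξ : ℝ) : ℂ) * Complex.I) - 1‖ₑ ^ 2
        * ‖inner ℂ (displacement ξ φ) (ψ k)‖ₑ ^ 2) := fun ξ => by
    rw [hp.expect_eq, ← ENNReal.tsum_mul_left]
    refine tsum_congr fun k => ?_
    rw [← inner_conj_symm, RCLike.enorm_conj, mul_left_comm]
  have hm : ∀ k, Measurable fun ξ => ‖Complex.exp (((u ⬝ᵥ ξ : ℝ) : ℂ) * Complex.I) - 1‖ₑ ^ 2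
        * ‖inner ℂ (displacement ξ φ) (ψ k)‖ₑ ^ 2 := fun k =>
    (measurable_exp_sub_one u).mul
      ((continuous_inner_displacement φ (ψ k)).enorm.measurable.pow_const 2)
  simp_rw [h1]
  rw [lintegral_tsum fun k => ((hm k).const_mul _).aemeasurable]
  simp_rw [lintegral_const_mul _ (hm _)]
  have hn : ∀ k, ‖ψ k‖ = 1 := ψ.orthonormal.1
  have h2 : HasSum (fun k => p k * (2 * (2 - 2 * (inner ℂ φ (modeExp u φ)).re)
      + 2 * (2 - 2 * (inner ℂ (ψ k) (modeExp u (ψ k))).re)))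
      (2 * (2 - 2 * (inner ℂ φ (modeExp u φ)).re)
        + 2 * (2 - 2 * (opTrace (ρ ∘L modeExp u)).re)) := by
    have h3 := Complex.hasSum_re (hp.hasSum_opTrace hρ (modeExp u))
    have h4 := ((hp.hasSum_one hρ).mul_right
      (2 * (2 - 2 * (inner ℂ φ (modeExp u φ)).re) + 4)).sub (h3.mul_left 4)
    have h5 := h4.of_forall_eq (g := fun k => p k * (2 * (2 - 2 * (inner ℂ φ (modeExp u φ)).re)
      + 2 * (2 - 2 * (inner ℂ (ψ k) (modeExp u (ψ k))).re))) fun k => by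
        rw [Complex.re_ofReal_mul]
        ring
    refine (congrArg (HasSum _) ?_).mp h5
    ring
  have h5 : ∀ k, 2 * (2 - 2 * (inner ℂ φ (modeExp u φ)).re)
      + 2 * (2 - 2 * (inner ℂ (ψ k) (modeExp u (ψ k))).re)
      = 2 * ‖modeExp u φ - φ‖ ^ 2 + 2 * ‖modeExp u (ψ k) - ψ k‖ ^ 2 := fun k => by
    rw [norm_modeExp_sub_sq, norm_modeExp_sub_sq, hφ, hn]
    ring
  rw [← h2.tsum_eq, ENNReal.ofReal_tsum_of_nonneg
    (fun k => mul_nonneg (hp.nonneg k) (by rw [h5]; positivity)) h2.summable]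
  refine ENNReal.tsum_le_tsum fun k => ?_
  rw [ENNReal.ofReal_mul (hp.nonneg k)]
  gcongr
  refine (lintegral_exp_sub_one_mul_inner_displacement_le u φ (ψ k)).trans_eq ?_
  rw [h5, ENNReal.ofReal_add (by positivity) (by positivity), ENNReal.ofReal_mul two_pos.le,
    ENNReal.ofReal_mul two_pos.le, ENNReal.ofReal_pow (norm_nonneg _),
    ENNReal.ofReal_pow (norm_nonneg _), ofReal_norm, ofReal_norm, ← ofReal_norm φ,
    ← ofReal_norm (ψ k), hφ, hn]
  simp

lemma one_sub_re_exp_le (a b : ℝ) :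
    1 - (Complex.exp ((a : ℂ) * Complex.I - b)).re ≤ b + Real.exp |b| * (a ^ 2 / 2) := by
  have h : (Complex.exp ((a : ℂ) * Complex.I - b)).re = Real.exp (-b) * Real.cos a := by
    rw [Complex.exp_re]
    simp
  have h1 := Real.add_one_le_exp (-b)
  have h2 := Real.one_sub_sq_div_two_le_cos (x := a)
  have h3 : Real.exp (-b) ≤ Real.exp |b| := Real.exp_le_exp.2 (neg_le_abs b)
  have h4 : Real.exp (-b) * (1 - Real.cos a) ≤ Real.exp |b| * (a ^ 2 / 2) :=
    mul_le_mul h3 (by linarith) (by linarith [Real.cos_le_one a]) (Real.exp_pos _).le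
  rw [h]
  linarith

/-- Fatou's lemma bounds a second moment by the behaviour of the characteristic function at the
origin. -/
lemma lintegral_sq_mul_le_of_forall {Q : PhaseSpace ι → ℝ≥0∞} (hQ : Measurable Q)
    {μ : Measure (PhaseSpace ι)} [DecidableEq ι] (j : ι × Fin 2) {C : ℝ}
    (h : ∀ s : ℝ, 0 < s → s ≤ 1 → ∫⁻ ξ, ‖Complex.exp (((Pi.single j s ⬝ᵥ ξ : ℝ) : ℂ) * Complex.I)
      - 1‖ₑ ^ 2 * Q ξ ∂μ ≤ ENNReal.ofReal (C * s ^ 2)) :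
    ∫⁻ ξ, ENNReal.ofReal (4 / Real.pi ^ 2 * ξ j ^ 2) * Q ξ ∂μ ≤ ENNReal.ofReal C := by
  -- `|exp (i s x) - 1|² ≥ 4 / π² (s x)²` as soon as `|s x| ≤ π`; here `s = s n → 0`
  let s : ℕ → ℝ := fun n => 1 / ((n : ℝ) + 1)
  have hs : ∀ n, 0 < s n := fun n => by positivity
  have hs1 : ∀ n, s n ≤ 1 := fun n => by
    refine div_le_one_of_le₀ ?_ (by positivity)
    linarith [Nat.cast_nonneg (α := ℝ) n]
  let F : ℕ → PhaseSpace ι → ℝ≥0∞ := fun n ξ => ENNReal.ofReal ((s n ^ 2)⁻¹) *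
    (‖Complex.exp (((Pi.single j (s n) ⬝ᵥ ξ : ℝ) : ℂ) * Complex.I) - 1‖ₑ ^ 2 * Q ξ)
  have hm : ∀ n, Measurable (F n) := fun n => ((measurable_exp_sub_one _).mul hQ).const_mul _
  have hF : ∀ n, ∫⁻ ξ, F n ξ ∂μ ≤ ENNReal.ofReal C := fun n => by
    have hm1 : Measurable fun ξ => ‖Complex.exp (((Pi.single j (s n) ⬝ᵥ ξ : ℝ) : ℂ) * Complex.I)
        - 1‖ₑ ^ 2 * Q ξ := (measurable_exp_sub_one _).mul hQ
    simp only [F]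
    rw [lintegral_const_mul _ hm1]
    refine (mul_le_mul_right (h (s n) (hs n) (hs1 n)) _).trans_eq ?_
    rw [← ENNReal.ofReal_mul (by positivity)]
    congr 1
    have := (hs n).ne'
    field_simp
  have hle : ∀ ξ, ENNReal.ofReal (4 / Real.pi ^ 2 * ξ j ^ 2) * Q ξ
      ≤ liminf (fun n => F n ξ) atTop := fun ξ => by
    refine le_liminf_of_le (by isBoundedDefault) ?_
    have ht : Tendsto (fun n => s n * ξ j) atTop (𝓝 (0 * ξ j)) :=
      tendsto_one_div_add_atTop_nhds_zero_nat.mul_const _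
    rw [zero_mul] at ht
    have hev : ∀ᶠ n in atTop, |s n * ξ j| < Real.pi :=
      ht.abs.eventually_lt_const (by rw [abs_zero]; exact Real.pi_pos)
    filter_upwards [hev] with n hn
    have hc := Real.cos_le_one_sub_mul_cos_sq hn.le
    have hsn := hs n
    simp only [F]
    rw [← mul_assoc, single_dotProduct, ← ofReal_norm, ← ENNReal.ofReal_pow (norm_nonneg _),
      norm_exp_sub_one_sq, ← ENNReal.ofReal_mul (by positivity)]
    refine mul_le_mul_left (ENNReal.ofReal_le_ofReal ?_) _
    rw [inv_mul_eq_div, le_div_iff₀ (by positivity)]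
    calc 4 / Real.pi ^ 2 * ξ j ^ 2 * s n ^ 2 = 2 * (2 / Real.pi ^ 2 * (s n * ξ j) ^ 2) := by ring
      _ ≤ _ := by linarith
  refine (lintegral_mono hle).trans ((lintegral_liminf_le hm).trans ?_)
  exact liminf_le_of_frequently_le' (Frequently.of_forall hF)

/-- The Husimi function of a Gaussian state has finite second moments. -/
lemma lintegral_sq_mul_expect_displacement_ne_top {ρ : ModeOp ι} (hρ : IsGaussianState ρ)
    (j : ι × Fin 2) :
    ∫⁻ ξ, ENNReal.ofReal (ξ j ^ 2) * expect ρ (displacement ξ (vacuum ι)) ∂(phaseVolume ι) ≠ ∞ := by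
  classical
  obtain ⟨M, d, hd, -, hM⟩ := hρ
  -- the first summand comes from the vacuum, the second from `ρ`
  let C : ℝ := 4 * (1 / 4) + 4 * (|M j j| / 4 + Real.exp (|M j j| / 4) * (d j ^ 2 / 2))
  have h : ∀ s : ℝ, 0 < s → s ≤ 1 → ∫⁻ ξ, ‖Complex.exp (((Pi.single j s ⬝ᵥ ξ : ℝ) : ℂ) * Complex.I)
      - 1‖ₑ ^ 2 * expect ρ (displacement ξ (vacuum ι)) ∂(phaseVolume ι)
      ≤ ENNReal.ofReal (C * s ^ 2) := fun s hs hs1 => by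
    refine (lintegral_exp_sub_one_mul_expect_le hd norm_vacuum (Pi.single j s)).trans
      (ENNReal.ofReal_le_ofReal ?_)
    have hv : 1 - (inner ℂ (vacuum ι) (modeExp (Pi.single j s) (vacuum ι))).re ≤ s ^ 2 / 4 := by
      have h1 : inner ℂ (vacuum ι) (modeExp (Pi.single j s) (vacuum ι))
          = Complex.exp (((0 : ℝ) : ℂ) * Complex.I - ((s ^ 2 / 4 : ℝ) : ℂ)) := by
        rw [modeExp, inner_vacuum_displacement]
        congr 1
        have h2 : ∑ k, ((Pi.single j s : PhaseSpace ι) (k, 1) ^ 2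
            + (Pi.single j s : PhaseSpace ι) (k, 0) ^ 2) = s ^ 2 := by
          have h3 : ∑ k, (Pi.single j s : PhaseSpace ι) k ^ 2 = s ^ 2 := by
            rw [Finset.sum_eq_single j]
            · rw [Pi.single_eq_same]
            · intro b _ hb
              rw [Pi.single_eq_of_ne hb]
              ring
            · simp
          rw [← h3, Fintype.sum_prod_type]
          simp only [Fin.sum_univ_two]
          exact Finset.sum_congr rfl fun k _ => add_comm _ _
        simp only [Matrix.cons_val_zero, Matrix.cons_val_one, neg_sq]
        rw [h2]
        push_cast
        ring
      have h4 := one_sub_re_exp_le 0 (s ^ 2 / 4)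
      rw [h1]
      simpa using h4
    have hs2 : s ^ 2 ≤ 1 := pow_le_one₀ hs.le hs1
    have hg : 1 - (opTrace (ρ ∘L modeExp (Pi.single j s))).re
        ≤ (|M j j| / 4 + Real.exp (|M j j| / 4) * (d j ^ 2 / 2)) * s ^ 2 := by
      have h1 : (Pi.single j s ⬝ᵥ d : ℝ) = s * d j := single_dotProduct _ _ _
      have h2 : (Pi.single j s ⬝ᵥ (M *ᵥ Pi.single j s) : ℝ) = s ^ 2 * M j j := by
        rw [single_dotProduct, Matrix.mulVec_single]
        simp only [Pi.smul_apply, MulOpposite.smul_eq_mul_unop, MulOpposite.unop_op,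
          Matrix.col_apply]
        ring
      have h3 := one_sub_re_exp_le (s * d j) (s ^ 2 * M j j / 4)
      rw [hM, h1, h2]
      have h4 : |s ^ 2 * M j j / 4| ≤ |M j j| / 4 := by
        rw [abs_div, abs_mul, abs_of_nonneg (sq_nonneg s), abs_of_pos (four_pos (α := ℝ))]
        have := mul_le_mul_of_nonneg_right hs2 (abs_nonneg (M j j))
        linarith
      have h5 : Real.exp |s ^ 2 * M j j / 4| ≤ Real.exp (|M j j| / 4) := Real.exp_le_exp.2 h4
      have h6 : s ^ 2 * M j j / 4 ≤ s ^ 2 * |M j j| / 4 := by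
        gcongr
        exact le_abs_self _
      have h7 : Real.exp |s ^ 2 * M j j / 4| * ((s * d j) ^ 2 / 2)
          ≤ Real.exp (|M j j| / 4) * ((s * d j) ^ 2 / 2) := by gcongr
      have h8 : ((s ^ 2 * M j j / 4 : ℝ) : ℂ) = ((s ^ 2 * M j j : ℝ) : ℂ) / 4 := by push_cast; rfl
      rw [h8] at h3
      refine h3.trans ?_
      rw [mul_pow] at h7 ⊢
      linarith
    simp only [C]
    linarith
  have h2 := lintegral_sq_mul_le_of_forall (measurable_expect_displacement ρ (vacuum ι)) j h
  have hpi : (0 : ℝ) ≤ 4 / Real.pi ^ 2 := by positivity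
  simp_rw [ENNReal.ofReal_mul hpi, mul_assoc] at h2
  rw [lintegral_const_mul' _ _ ENNReal.ofReal_ne_top] at h2
  intro htop
  rw [htop, ENNReal.mul_top (by simp [Real.pi_pos])] at h2
  exact ENNReal.ofReal_ne_top (top_le_iff.1 h2)

end Husimi

/-! ### Husimi functions of reduced and of diffused states -/

section Marginal

/-- The displaced copies of a unit vector compute the trace. -/
lemma lintegral_expect_displacement {ι : Type} [Fintype ι] {T : ModeOp ι} (hT : T.IsPositive)
    {φ : ModeSpace ι} (hφ : ‖φ‖ = 1) :
    ∫⁻ ξ, expect T (displacement ξ φ) ∂(phaseVolume ι) = posTrace T := by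
  obtain ⟨S, hS, rfl⟩ := exists_sqrt hT
  let e := stdBasis (ModeSpace ι)
  have := e.countable
  have hsa : ∀ x y, inner ℂ x (S y) = inner ℂ (S x) y := fun x y => (hS.isSymmetric x y).symm
  have h1 : ∀ x, expect (S * S) x = ∑' i, ‖inner ℂ x (S (e i))‖ₑ ^ 2 := fun x => by
    rw [expect_sq hS, ← e.tsum_enorm_inner_sq]
    refine tsum_congr fun i => ?_
    rw [hsa, ← inner_conj_symm, RCLike.enorm_conj]
  simp_rw [h1]
  have hm : ∀ i, Measurable fun ξ => ‖inner ℂ (displacement ξ φ) (S (e i))‖ₑ ^ 2 := fun i =>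
    (continuous_inner_displacement _ _).enorm.measurable.pow_const 2
  rw [lintegral_tsum fun i => (hm i).aemeasurable, posTrace_eq_tsum_expect hT e]
  refine tsum_congr fun i => ?_
  rw [lintegral_phaseVolume_enorm_inner_displacement_sq, ← ofReal_norm φ, hφ, expect_sq hS]
  simp

variable {α β : Type} [Fintype α] [Fintype β] {ρ : ModeOp (α ⊕ β)}

lemma tensorLeft_vacuum : tensorLeft (vacuum α) (vacuum β) = vacuum (α ⊕ β) := by
  refine Lp.ext ?_
  filter_upwards [coeFn_tensorLeft (vacuum α) (vacuum β), coeFn_vacuum (ι := α ⊕ β),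
    ae_split_fst (β := β) (coeFn_vacuum (ι := α)),
    ae_split_snd' (α := α) (coeFn_vacuum (ι := β))] with z h1 h2 h3 h4
  rw [h1, h2, tensorFun, h3, h4, Fintype.prod_sum_type, Complex.ofReal_mul]

lemma lintegral_expect_tensorLeft_right (hρ : ρ.IsPositive) (x : ModeSpace α) :
    ∫⁻ η, expect ρ (tensorLeft x (displacement η (vacuum β))) ∂(phaseVolume β)
      = posTrace ((tensorLeft x).adjoint ∘L ρ ∘L tensorLeft (β := β) x) := by
  rw [← lintegral_expect_displacement (hρ.adjoint_conj _) norm_vacuum]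
  simp_rw [expect_adjoint_conj]

lemma lintegral_expect_tensorLeft_left (hρ : IsDensityOperator ρ) (y : ModeSpace β) :
    ∫⁻ ξ, expect ρ (tensorLeft (displacement ξ (vacuum α)) y) ∂(phaseVolume α)
      = expect (partialTraceLeft ρ) y := by
  have h := lintegral_expect_displacement (hρ.1.adjoint_conj (tensorRight (α := α) y))
    (norm_vacuum (ι := α))
  simp_rw [expect_adjoint_conj, tensorRight_apply] at h
  rw [h, posTrace_eq_tsum_expect (hρ.1.adjoint_conj _) (stdBasis (ModeSpace α)),
    expect_partialTraceLeft hρ (stdBasis (ModeSpace α))]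
  simp_rw [expect_adjoint_conj, tensorRight_apply]

/-- The Husimi function of the reduced state of the left subsystem. -/
def husimiLeft (ρ : ModeOp (α ⊕ β)) (ξ : PhaseSpace α) : ℝ≥0∞ :=
  posTrace ((tensorLeft (displacement ξ (vacuum α))).adjoint ∘L ρ ∘L
    tensorLeft (β := β) (displacement ξ (vacuum α)))

lemma husimiLeft_eq_tsum (hρ : ρ.IsPositive) {κ : Type*} (f : HilbertBasis κ ℂ (ModeSpace β))
    (ξ : PhaseSpace α) :
    husimiLeft ρ ξ = ∑' j, expect ρ (tensorLeft (displacement ξ (vacuum α)) (f j)) := by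
  rw [husimiLeft, posTrace_eq_tsum_expect (hρ.adjoint_conj _) f]
  simp_rw [expect_adjoint_conj]

lemma measurable_expect_tensorLeft_left (ρ : ModeOp (α ⊕ β)) (y : ModeSpace β) :
    Measurable fun ξ => expect ρ (tensorLeft (displacement ξ (vacuum α)) y) := by
  have h : Continuous fun ξ : PhaseSpace α => tensorLeft (displacement ξ (vacuum α)) y :=
    (tensorRight y).continuous.comp (continuous_displacement_apply _)
  exact (Complex.continuous_re.comp (h.inner (ρ.continuous.comp h))).measurable.ennreal_ofReal

lemma measurable_husimiLeft (hρ : ρ.IsPositive) : Measurable (husimiLeft ρ) := by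
  have := (stdBasis (ModeSpace β)).countable
  have h : husimiLeft ρ = fun ξ => ∑' j, expect ρ (tensorLeft (displacement ξ (vacuum α))
      (stdBasis (ModeSpace β) j)) := funext (husimiLeft_eq_tsum hρ _)
  rw [h]
  exact Measurable.tsum fun j => measurable_expect_tensorLeft_left ρ _

lemma lintegral_husimiLeft (hρ : IsDensityOperator ρ) :
    ∫⁻ ξ, husimiLeft ρ ξ ∂(phaseVolume α) = 1 := by
  let f := stdBasis (ModeSpace β)
  have := f.countable
  simp_rw [husimiLeft_eq_tsum hρ.1 f]
  rw [lintegral_tsum fun j => (measurable_expect_tensorLeft_left ρ _).aemeasurable]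
  simp_rw [lintegral_expect_tensorLeft_left hρ]
  rw [← posTrace_eq_tsum_expect (isPositive_partialTraceLeft hρ) f,
    (isDensityOperator_partialTraceLeft hρ).2]

lemma lintegral_expect_displacement_joinPhase (ρ : ModeOp (α ⊕ β))
    {w : PhaseSpace (α ⊕ β) → ℝ≥0∞} (hw : Measurable w) :
    ∫⁻ ζ, w ζ * expect ρ (displacement ζ (vacuum (α ⊕ β))) ∂(phaseVolume (α ⊕ β))
      = ∫⁻ z, w (joinPhase z) * expect ρ (tensorLeft (displacement z.1 (vacuum α))
        (displacement z.2 (vacuum β))) ∂((phaseVolume α).prod (phaseVolume β)) := by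
  have hm : Measurable fun ζ => w ζ * expect ρ (displacement ζ (vacuum (α ⊕ β))) :=
    hw.mul (measurable_expect_displacement ρ _)
  rw [← measurePreserving_joinPhase_phaseVolume.lintegral_comp hm]
  refine lintegral_congr fun z => ?_
  rw [← tensorLeft_vacuum, ← displacement_joinPhase_tensorLeft]

lemma measurable_expect_tensorLeft_prod (ρ : ModeOp (α ⊕ β)) :
    Measurable fun z : PhaseSpace α × PhaseSpace β =>
      expect ρ (tensorLeft (displacement z.1 (vacuum α)) (displacement z.2 (vacuum β))) := by
  simp_rw [← displacement_joinPhase_tensorLeft, tensorLeft_vacuum]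
  exact (measurable_expect_displacement ρ _).comp continuous_joinPhase.measurable

/-- The Husimi function of `A` is a marginal of that of the composite system. -/
lemma lintegral_sq_mul_husimiLeft_ne_top (hρ : IsGaussianState ρ) (k : α × Fin 2) :
    ∫⁻ ξ, ENNReal.ofReal (ξ k ^ 2) * husimiLeft ρ ξ ∂(phaseVolume α) ≠ ∞ := by
  have hd := hρ.isDensityOperator
  have h := lintegral_sq_mul_expect_displacement_ne_top hρ (Sum.inl k.1, k.2)
  have hw : ∀ {ι : Type} (k : ι × Fin 2), Measurable fun ξ : PhaseSpace ι =>
      ENNReal.ofReal (ξ k ^ 2) := fun k => by fun_prop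
  have hm : Measurable fun z : PhaseSpace α × PhaseSpace β => ENNReal.ofReal (z.1 k ^ 2) *
      expect ρ (tensorLeft (displacement z.1 (vacuum α)) (displacement z.2 (vacuum β))) :=
    ((hw k).comp measurable_fst).mul (measurable_expect_tensorLeft_prod ρ)
  rw [lintegral_expect_displacement_joinPhase ρ (hw _)] at h
  simp only [joinPhase_inl] at h
  rw [lintegral_prod _ hm.aemeasurable] at h
  refine ne_of_eq_of_ne (lintegral_congr fun ξ => ?_) h
  dsimp only
  rw [lintegral_const_mul' _ _ ENNReal.ofReal_ne_top, lintegral_expect_tensorLeft_right hd.1]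
  rfl

/-- The Husimi function of `B` is a marginal of that of the composite system. -/
lemma lintegral_sq_mul_expect_partialTraceLeft_ne_top (hρ : IsGaussianState ρ) (k : β × Fin 2) :
    ∫⁻ η, ENNReal.ofReal (η k ^ 2) * expect (partialTraceLeft ρ) (displacement η (vacuum β))
      ∂(phaseVolume β) ≠ ∞ := by
  have hd := hρ.isDensityOperator
  have h := lintegral_sq_mul_expect_displacement_ne_top hρ (Sum.inr k.1, k.2)
  have hw : ∀ {ι : Type} (k : ι × Fin 2), Measurable fun ξ : PhaseSpace ι =>
      ENNReal.ofReal (ξ k ^ 2) := fun k => by fun_prop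
  have hm : Measurable fun z : PhaseSpace α × PhaseSpace β => ENNReal.ofReal (z.2 k ^ 2) *
      expect ρ (tensorLeft (displacement z.1 (vacuum α)) (displacement z.2 (vacuum β))) :=
    ((hw k).comp measurable_snd).mul (measurable_expect_tensorLeft_prod ρ)
  rw [lintegral_expect_displacement_joinPhase ρ (hw _)] at h
  simp only [joinPhase_inr] at h
  rw [lintegral_prod_symm _ hm.aemeasurable] at h
  refine ne_of_eq_of_ne (lintegral_congr fun η => ?_) h
  dsimp only
  rw [lintegral_const_mul' _ _ ENNReal.ofReal_ne_top, lintegral_expect_tensorLeft_left hd]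

lemma measurePreserving_add_phaseVolume {ι : Type} [Fintype ι] (η : PhaseSpace ι) :
    MeasurePreserving (fun ξ => ξ + η) (phaseVolume ι) (phaseVolume ι) :=
  (measurePreserving_add_right volume η).smul_measure _

/-- Diffusion convolves the Husimi function with the normal law. -/
lemma husimiLeft_diffuseLeft (hρ : IsDensityOperator ρ) (t : ℝ) (ξ : PhaseSpace α) :
    husimiLeft (diffuseLeft t ρ) ξ = ∫⁻ η, husimiLeft ρ (ξ - η) ∂(phaseGaussian α t) := by
  let f := stdBasis (ModeSpace β)
  have := f.countable
  rw [husimiLeft_eq_tsum (isPositive_diffuseLeft hρ t) f]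
  simp_rw [expect_diffuseLeft hρ]
  rw [← lintegral_tsum fun i => (measurable_expect_displaced hρ _).aemeasurable]
  refine lintegral_congr fun η => ?_
  rw [husimiLeft_eq_tsum hρ.1 f]
  refine tsum_congr fun j => ?_
  rw [expect_displaced, displacement_extendByZero_tensorLeft, displacement_displacement,
    ← tensorRight_apply, map_smul, expect_smul_of_norm_eq_one _ _ (Complex.norm_exp_ofReal_mul_I _),
    tensorRight_apply, sub_eq_add_neg, add_comm]

/-- Diffusion for time `t` increases the second moments of the Husimi function by `t / 2`. -/
lemma lintegral_sq_mul_husimiLeft_diffuseLeft (hρ : IsDensityOperator ρ) {t : ℝ} (ht : 0 ≤ t)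
    (k : α × Fin 2) :
    ∫⁻ ξ, ENNReal.ofReal (ξ k ^ 2) * husimiLeft (diffuseLeft t ρ) ξ ∂(phaseVolume α)
      = ∫⁻ ξ, ENNReal.ofReal (ξ k ^ 2) * husimiLeft ρ ξ ∂(phaseVolume α)
        + ENNReal.ofReal (t / 2) := by
  have hQ := measurable_husimiLeft (ρ := ρ) hρ.1
  have hw : Measurable fun ξ : PhaseSpace α => ENNReal.ofReal (ξ k ^ 2) := by fun_prop
  have hs : Measurable fun z : PhaseSpace α × PhaseSpace α => z.1 - z.2 := by fun_prop
  have hm1 : Measurable fun z : PhaseSpace α × PhaseSpace α =>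
      ENNReal.ofReal (z.1 k ^ 2) * husimiLeft ρ (z.1 - z.2) :=
    (hw.comp measurable_fst).mul (hQ.comp hs)
  have ha : Measurable fun z : PhaseSpace α × PhaseSpace α =>
      ENNReal.ofReal ((z.2 k + z.1 k) ^ 2) := by fun_prop
  have hm2 : Measurable fun z : PhaseSpace α × PhaseSpace α =>
      ENNReal.ofReal ((z.2 k + z.1 k) ^ 2) * husimiLeft ρ z.2 := ha.mul (hQ.comp measurable_snd)
  have h1 : ∀ ξ, ENNReal.ofReal (ξ k ^ 2) * husimiLeft (diffuseLeft t ρ) ξ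
      = ∫⁻ η, ENNReal.ofReal (ξ k ^ 2) * husimiLeft ρ (ξ - η) ∂(phaseGaussian α t) := fun ξ => by
    rw [husimiLeft_diffuseLeft hρ, lintegral_const_mul' _ _ ENNReal.ofReal_ne_top]
  simp_rw [h1]
  rw [lintegral_lintegral_swap hm1.aemeasurable]
  have h2 : ∀ η : PhaseSpace α,
      ∫⁻ ξ, ENNReal.ofReal (ξ k ^ 2) * husimiLeft ρ (ξ - η) ∂(phaseVolume α)
      = ∫⁻ ξ, ENNReal.ofReal ((ξ k + η k) ^ 2) * husimiLeft ρ ξ ∂(phaseVolume α) := fun η => by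
    have hm3 : Measurable fun ξ : PhaseSpace α =>
        ENNReal.ofReal (ξ k ^ 2) * husimiLeft ρ (ξ - η) :=
      hw.mul (hQ.comp (measurable_id.sub_const η))
    rw [← (measurePreserving_add_phaseVolume η).lintegral_comp hm3]
    simp only [add_sub_cancel_right, Pi.add_apply]
  simp_rw [h2]
  rw [lintegral_lintegral_swap hm2.aemeasurable]
  have h3 : ∀ ξ : PhaseSpace α,
      ∫⁻ η, ENNReal.ofReal ((ξ k + η k) ^ 2) * husimiLeft ρ ξ ∂(phaseGaussian α t)
      = ENNReal.ofReal (ξ k ^ 2) * husimiLeft ρ ξ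
        + ENNReal.ofReal (t / 2) * husimiLeft ρ ξ := fun ξ => by
    obtain ⟨hi, he⟩ := integral_add_sq_phaseGaussian (ι := α) ht k (ξ k)
    have hm4 : Measurable fun η : PhaseSpace α => ENNReal.ofReal ((ξ k + η k) ^ 2) := by fun_prop
    rw [lintegral_mul_const _ hm4, ← ofReal_integral_eq_lintegral_ofReal hi
      (ae_of_all _ fun η => sq_nonneg _), he, ENNReal.ofReal_add (sq_nonneg _) (by positivity),
      add_mul]
  simp_rw [h3]
  rw [lintegral_add_right _ (hQ.const_mul _), lintegral_const_mul _ hQ, lintegral_husimiLeft hρ,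
    mul_one]

end Marginal

/-! ### The upper bound on the entropy of the diffused state -/

section Upper

lemma gaussDensity_le_one {ι : Type} [Fintype ι] {T : ℝ} (hT : 2 ≤ T) (ξ : PhaseSpace ι) :
    gaussDensity ι T ξ ≤ 1 := by
  have hT0 : 0 < T := by linarith
  refine mul_le_one₀ (pow_le_one₀ (by positivity) ((div_le_one hT0).2 hT)) (Real.exp_pos _).le ?_
  rw [Real.exp_le_one_iff, neg_div]
  have : 0 ≤ ∑ k, ξ k ^ 2 := Finset.sum_nonneg fun k _ => sq_nonneg _
  have : 0 ≤ (∑ k, ξ k ^ 2) / T := by positivity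
  linarith

lemma ofReal_neg_log_gaussDensity {ι : Type} [Fintype ι] {T : ℝ} (hT : 2 ≤ T)
    (ξ : PhaseSpace ι) :
    ENNReal.ofReal (-Real.log (gaussDensity ι T ξ))
      = ENNReal.ofReal (Fintype.card ι * Real.log (T / 2))
        + ENNReal.ofReal T⁻¹ * ∑ k, ENNReal.ofReal (ξ k ^ 2) := by
  have hT0 : 0 < T := by linarith
  have h1 : 0 ≤ Real.log (T / 2) := Real.log_nonneg (by linarith)
  rw [log_gaussDensity hT0, ← ENNReal.ofReal_sum_of_nonneg fun k _ => sq_nonneg (ξ k),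
    ← ENNReal.ofReal_mul (by positivity), ← ENNReal.ofReal_add (by positivity)
      (mul_nonneg (by positivity) (Finset.sum_nonneg fun k _ => sq_nonneg (ξ k)))]
  congr 1
  ring

variable {α β : Type} [Fintype α] [Fintype β] {ρ : ModeOp (α ⊕ β)}

/-- Klein's inequality with the coherent states of `B` and a normal law as reference density. -/
lemma vonNeumannEntropy_partialTraceLeft_ne_top (hρ : IsGaussianState ρ) :
    vonNeumannEntropy (partialTraceLeft ρ) ≠ ∞ := by
  have hd := hρ.isDensityOperator
  have hB := isDensityOperator_partialTraceLeft hd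
  have h2 : (0 : ℝ) < 2 := two_pos
  have h := vonNeumannEntropy_le_lintegral (μ := phaseVolume β) hB
    (v := fun η => displacement η (vacuum β))
    (fun ψ => (continuous_const.inner (continuous_displacement_apply _)).measurable)
    (fun ψ => by
      have h3 := lintegral_phaseVolume_enorm_inner_displacement_sq (vacuum β) ψ
      rw [← ofReal_norm (vacuum β), norm_vacuum, ENNReal.ofReal_one, one_pow, one_mul] at h3
      rw [← h3]
      exact lintegral_congr fun η => by rw [← inner_conj_symm, RCLike.enorm_conj])
    (fun η => by rw [norm_displacement, norm_vacuum])
    (fun η => (gaussDensity_pos h2 η).le) (gaussDensity_le_one le_rfl)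
    (continuous_gaussDensity 2).measurable (lintegral_gaussDensity h2).le
    (fun η h0 => absurd h0 (gaussDensity_pos h2 η).ne')
  refine ne_top_of_le_ne_top ?_ h
  simp_rw [ofReal_neg_log_gaussDensity le_rfl, div_self h2.ne', Real.log_one, mul_zero,
    ENNReal.ofReal_zero, zero_add, mul_left_comm (expect _ _)]
  rw [lintegral_const_mul' _ _ ENNReal.ofReal_ne_top]
  refine ENNReal.mul_ne_top ENNReal.ofReal_ne_top ?_
  simp_rw [mul_comm (expect _ _), Finset.sum_mul]
  have hm : ∀ k : β × Fin 2, Measurable fun η : PhaseSpace β => ENNReal.ofReal (η k ^ 2) *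
      expect (partialTraceLeft ρ) (displacement η (vacuum β)) := fun k =>
    (by fun_prop : Measurable fun η : PhaseSpace β => ENNReal.ofReal (η k ^ 2)).mul
      (measurable_expect_displacement _ _)
  rw [lintegral_finsetSum _ fun k _ => hm k]
  exact ENNReal.sum_ne_top.2 fun k _ => lintegral_sq_mul_expect_partialTraceLeft_ne_top hρ k

/-- The sum of the second moments of the Husimi function of the left subsystem. -/
def husimiMoment (ρ : ModeOp (α ⊕ β)) : ℝ≥0∞ :=
  ∑ k, ∫⁻ ξ, ENNReal.ofReal (ξ k ^ 2) * husimiLeft ρ ξ ∂(phaseVolume α)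

lemma husimiMoment_ne_top (hρ : IsGaussianState ρ) : husimiMoment ρ ≠ ∞ :=
  ENNReal.sum_ne_top.2 fun k _ => lintegral_sq_mul_husimiLeft_ne_top hρ k

lemma husimiMoment_diffuseLeft (hρ : IsDensityOperator ρ) {t : ℝ} (ht : 0 ≤ t) :
    husimiMoment (diffuseLeft t ρ) = husimiMoment ρ + ENNReal.ofReal (Fintype.card α * t) := by
  rw [husimiMoment]
  simp_rw [lintegral_sq_mul_husimiLeft_diffuseLeft hρ ht]
  rw [Finset.sum_add_distrib, husimiMoment, Finset.sum_const, Finset.card_univ, Fintype.card_prod,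
    Fintype.card_fin, nsmul_eq_mul, ← ENNReal.ofReal_natCast, ← ENNReal.ofReal_mul (by positivity)]
  congr 2
  push_cast
  ring

/-- The vectors `W(ξ)|0⟩ ⊗ f_l` resolve the identity of the composite system. -/
lemma lintegral_tsum_enorm_inner_tensorLeft_sq {κ : Type*} [Countable κ]
    (f : HilbertBasis κ ℂ (ModeSpace β)) (ψ : ModeSpace (α ⊕ β)) :
    ∫⁻ ξ, ∑' l, ‖inner ℂ ψ (tensorLeft (displacement ξ (vacuum α)) (f l))‖ₑ ^ 2 ∂(phaseVolume α)
      = ‖ψ‖ₑ ^ 2 := by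
  have h1 : ∀ ξ l, ‖inner ℂ ψ (tensorLeft (displacement ξ (vacuum α)) (f l))‖ₑ ^ 2
      = ‖inner ℂ (displacement ξ (vacuum α)) ((tensorRight (f l)).adjoint ψ)‖ₑ ^ 2 := fun ξ l => by
    rw [← inner_tensorLeft_eq_right, ← inner_conj_symm, RCLike.enorm_conj]
  simp_rw [h1]
  rw [lintegral_tsum fun l =>
    ((continuous_inner_displacement _ _).enorm.measurable.pow_const 2).aemeasurable]
  simp_rw [lintegral_phaseVolume_enorm_inner_displacement_sq]
  let e := stdBasis (ModeSpace α)
  rw [← (tensorBasis e f).tsum_enorm_inner_sq, ENNReal.tsum_prod', ENNReal.tsum_comm]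
  refine tsum_congr fun l => ?_
  rw [← ofReal_norm (vacuum α), norm_vacuum, ENNReal.ofReal_one, one_pow, one_mul,
    ← e.tsum_enorm_inner_sq]
  refine tsum_congr fun i => ?_
  rw [tensorBasis_apply, inner_tensorLeft_eq_right]

lemma expect_tensorLeft_eq_zero (hρ : IsDensityOperator ρ) {y : ModeSpace β}
    (hy : expect (partialTraceLeft ρ) y = 0) (x : ModeSpace α) : expect ρ (tensorLeft x y) = 0 := by
  let T := (tensorRight (α := α) y).adjoint ∘L ρ ∘L tensorRight y
  have hT : T.IsPositive := hρ.1.adjoint_conj _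
  have h0 : posTrace T = 0 := by
    rw [posTrace_eq_tsum_expect hT (stdBasis (ModeSpace α)), ← hy,
      expect_partialTraceLeft hρ (stdBasis (ModeSpace α))]
    simp_rw [T, expect_adjoint_conj, tensorRight_apply]
  have h1 := ofReal_norm_le_posTrace hT
  rw [h0, nonpos_iff_eq_zero, ENNReal.ofReal_eq_zero] at h1
  have h2 : T = 0 := norm_le_zero_iff.1 h1
  rw [← tensorRight_apply, ← expect_adjoint_conj]
  change expect T x = 0
  rw [h2]
  simp [expect]

/-- The entropy of a bipartite state is bounded by that of the reduced state of `B` and by the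
second moments of the Husimi function of `A`. -/
lemma vonNeumannEntropy_le_add_husimiMoment (hρ : IsDensityOperator ρ) {T : ℝ} (hT : 2 ≤ T) :
    vonNeumannEntropy ρ ≤ vonNeumannEntropy (partialTraceLeft ρ)
      + (ENNReal.ofReal (Fintype.card α * Real.log (T / 2))
        + ENNReal.ofReal T⁻¹ * husimiMoment ρ) := by
  have hT0 : 0 < T := by linarith
  have hB := isDensityOperator_partialTraceLeft hρ
  obtain ⟨K, f, q, hq⟩ := exists_isEigenbasis hB.1 (by rw [hB.2]; exact ENNReal.one_ne_top)
  have := f.countable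
  let _ : MeasurableSpace K := ⊤
  have hlin : ∀ F : PhaseSpace α × K → ℝ≥0∞, Measurable F →
      ∫⁻ x, F x ∂((phaseVolume α).prod Measure.count)
        = ∫⁻ ξ, ∑' l, F (ξ, l) ∂(phaseVolume α) := fun F hF => by
    rw [lintegral_prod _ hF.aemeasurable]
    simp_rw [lintegral_count]
  have hcont : ∀ l, Continuous fun ξ : PhaseSpace α => tensorLeft (displacement ξ (vacuum α)) (f l) :=
    fun l => (tensorRight (f l)).continuous.comp (continuous_displacement_apply _)
  have hv : ∀ ψ, Measurable fun x : PhaseSpace α × K =>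
      inner ℂ ψ (tensorLeft (displacement x.1 (vacuum α)) (f x.2)) := fun ψ =>
    measurable_from_prod_countable_left fun l => (continuous_const.inner (hcont l)).measurable
  have hr : Measurable fun x : PhaseSpace α × K => q x.2 * gaussDensity α T x.1 :=
    measurable_from_prod_countable_left fun l =>
      ((continuous_gaussDensity T).measurable.const_mul (q l))
  have he : Measurable fun x : PhaseSpace α × K =>
      expect ρ (tensorLeft (displacement x.1 (vacuum α)) (f x.2)) :=
    measurable_from_prod_countable_left fun l => measurable_expect_tensorLeft_left ρ (f l)
  have hz : ∀ x : PhaseSpace α × K, q x.2 = 0 →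
      expect ρ (tensorLeft (displacement x.1 (vacuum α)) (f x.2)) = 0 := fun x hx =>
    expect_tensorLeft_eq_zero hρ (by rw [hq.expect_self, hx, ENNReal.ofReal_zero]) _
  have h := vonNeumannEntropy_le_lintegral (μ := (phaseVolume α).prod (Measure.count : Measure K)) hρ
    (v := fun x => tensorLeft (displacement x.1 (vacuum α)) (f x.2)) hv
    (fun ψ => by
      rw [hlin _ ((hv ψ).enorm.pow_const 2)]
      exact lintegral_tsum_enorm_inner_tensorLeft_sq f ψ)
    (fun x => by rw [norm_tensorLeft_apply, norm_displacement, norm_vacuum, f.orthonormal.1, one_mul])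
    (r := fun x => q x.2 * gaussDensity α T x.1)
    (fun x => mul_nonneg (hq.nonneg _) (gaussDensity_pos hT0 _).le)
    (fun x => mul_le_one₀ (hq.le_one hB _) (gaussDensity_pos hT0 _).le (gaussDensity_le_one hT _))
    hr
    (by
      rw [hlin _ hr.ennreal_ofReal]
      simp_rw [ENNReal.ofReal_mul (hq.nonneg _), ENNReal.tsum_mul_right, hq.tsum_eq_one hB, one_mul]
      exact (lintegral_gaussDensity hT0).le)
    (fun x hx => hz x ((mul_eq_zero.1 hx).resolve_right (gaussDensity_pos hT0 _).ne'))
  refine h.trans_eq ?_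
  have hpt : ∀ x : PhaseSpace α × K,
      expect ρ (tensorLeft (displacement x.1 (vacuum α)) (f x.2))
        * ENNReal.ofReal (-Real.log (q x.2 * gaussDensity α T x.1))
      = ENNReal.ofReal (-Real.log (q x.2))
          * expect ρ (tensorLeft (displacement x.1 (vacuum α)) (f x.2))
        + ENNReal.ofReal (-Real.log (gaussDensity α T x.1))
          * expect ρ (tensorLeft (displacement x.1 (vacuum α)) (f x.2)) := fun x => by
    rcases eq_or_ne (q x.2) 0 with h0 | h0
    · simp [hz x h0]
    · rw [Real.log_mul h0 (gaussDensity_pos hT0 _).ne', neg_add, ENNReal.ofReal_add, mul_comm,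
        add_mul]
      · exact neg_nonneg.2 (Real.log_nonpos (hq.nonneg _) (hq.le_one hB _))
      · exact neg_nonneg.2 (Real.log_nonpos (gaussDensity_pos hT0 _).le (gaussDensity_le_one hT _))
  have hm1 : Measurable fun x : PhaseSpace α × K => ENNReal.ofReal (-Real.log (q x.2))
      * expect ρ (tensorLeft (displacement x.1 (vacuum α)) (f x.2)) :=
    (measurable_from_prod_countable_left fun l => (measurable_const :
      Measurable fun _ : PhaseSpace α => ENNReal.ofReal (-Real.log (q l)))).mul he
  have hg : Measurable fun ξ : PhaseSpace α => ENNReal.ofReal (-Real.log (gaussDensity α T ξ)) :=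
    ((continuous_gaussDensity T).measurable.log.neg).ennreal_ofReal
  have hm2 : Measurable fun x : PhaseSpace α × K =>
      ENNReal.ofReal (-Real.log (gaussDensity α T x.1))
        * expect ρ (tensorLeft (displacement x.1 (vacuum α)) (f x.2)) :=
    (hg.comp measurable_fst).mul he
  simp_rw [hpt]
  rw [lintegral_add_left hm1, hlin _ hm1, hlin _ hm2]
  congr 1
  · dsimp only
    rw [lintegral_tsum fun l => ((measurable_expect_tensorLeft_left ρ (f l)).const_mul
      _).aemeasurable, hB.vonNeumannEntropy_eq hq]
    refine tsum_congr fun l => ?_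
    rw [lintegral_const_mul _ (measurable_expect_tensorLeft_left ρ (f l)),
      lintegral_expect_tensorLeft_left hρ, hq.expect_self, mul_comm,
      ← ENNReal.ofReal_mul (hq.nonneg l), Real.negMulLog, neg_mul, mul_neg]
  · have hQ := measurable_husimiLeft (ρ := ρ) hρ.1
    have hw : ∀ k : α × Fin 2, Measurable fun ξ : PhaseSpace α =>
        ENNReal.ofReal (ξ k ^ 2) * husimiLeft ρ ξ := fun k =>
      (by fun_prop : Measurable fun ξ : PhaseSpace α => ENNReal.ofReal (ξ k ^ 2)).mul hQ
    dsimp only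
    simp_rw [ENNReal.tsum_mul_left, ← husimiLeft_eq_tsum hρ.1 f, ofReal_neg_log_gaussDensity hT,
      add_mul, mul_assoc, Finset.sum_mul]
    rw [lintegral_add_left (hQ.const_mul _), lintegral_const_mul _ hQ, lintegral_husimiLeft hρ,
      mul_one, lintegral_const_mul' _ _ ENNReal.ofReal_ne_top,
      lintegral_finsetSum _ fun k _ => hw k]
    rfl

lemma vonNeumannEntropy_diffuseLeft_le (hρ : IsDensityOperator ρ) {t T : ℝ} (ht : 0 ≤ t)
    (hT : 2 ≤ T) :
    vonNeumannEntropy (diffuseLeft t ρ) ≤ vonNeumannEntropy (partialTraceLeft ρ)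
      + (ENNReal.ofReal (Fintype.card α * Real.log (T / 2))
        + ENNReal.ofReal T⁻¹ * (husimiMoment ρ + ENNReal.ofReal (Fintype.card α * t))) := by
  have h := vonNeumannEntropy_le_add_husimiMoment (isDensityOperator_diffuseLeft hρ t) hT
  rwa [partialTraceLeft_diffuseLeft hρ, husimiMoment_diffuseLeft hρ ht] at h

lemma vonNeumannEntropy_diffuseLeft_ne_top (hρ : IsGaussianState ρ) {t : ℝ} (ht : 0 ≤ t) :
    vonNeumannEntropy (diffuseLeft t ρ) ≠ ∞ := by
  have hd := hρ.isDensityOperator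
  refine ne_top_of_le_ne_top ?_ (vonNeumannEntropy_diffuseLeft_le hd ht le_rfl)
  refine ENNReal.add_ne_top.2 ⟨vonNeumannEntropy_partialTraceLeft_ne_top hρ,
    ENNReal.add_ne_top.2 ⟨ENNReal.ofReal_ne_top, ENNReal.mul_ne_top ENNReal.ofReal_ne_top
      (ENNReal.add_ne_top.2 ⟨husimiMoment_ne_top hρ, ENNReal.ofReal_ne_top⟩)⟩⟩

lemma conditionalEntropy_diffuseLeft_le (hρ : IsGaussianState ρ) {t : ℝ} (ht : 2 ≤ t) :
    conditionalEntropy (diffuseLeft t ρ)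
      ≤ Fintype.card α * (1 + Real.log (t / 2)) + (husimiMoment ρ).toReal / t := by
  have hd := hρ.isDensityOperator
  have ht0 : 0 < t := by linarith
  have hl : 0 ≤ Real.log (t / 2) := Real.log_nonneg (by linarith)
  have h := vonNeumannEntropy_diffuseLeft_le hd ht0.le ht
  rw [← ENNReal.ofReal_toReal (husimiMoment_ne_top hρ),
    ← ENNReal.ofReal_toReal (vonNeumannEntropy_partialTraceLeft_ne_top hρ),
    ← ENNReal.ofReal_toReal (vonNeumannEntropy_diffuseLeft_ne_top hρ ht0.le),
    ← ENNReal.ofReal_add ENNReal.toReal_nonneg (by positivity),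
    ← ENNReal.ofReal_mul (by positivity), ← ENNReal.ofReal_add (by positivity) (by positivity),
    ← ENNReal.ofReal_add (by positivity) (by positivity),
    ENNReal.ofReal_le_ofReal_iff (by positivity)] at h
  rw [conditionalEntropy, partialTraceLeft_diffuseLeft hd]
  have h2 : t⁻¹ * ((husimiMoment ρ).toReal + Fintype.card α * t)
      = (husimiMoment ρ).toReal / t + Fintype.card α := by field_simp
  rw [h2] at h
  linarith

lemma le_conditionalEntropy_diffuseLeft (hρ : IsGaussianState ρ) {t : ℝ} (ht : 0 < t) :
    Fintype.card α * (1 + Real.log (t / 2)) ≤ conditionalEntropy (diffuseLeft t ρ) := by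
  have hd := hρ.isDensityOperator
  rw [conditionalEntropy, partialTraceLeft_diffuseLeft hd]
  exact le_vonNeumannEntropy_diffuseLeft hd ht (vonNeumannEntropy_diffuseLeft_ne_top hρ ht.le)
    (vonNeumannEntropy_partialTraceLeft_ne_top hρ)

end Upper

/-! ### Asymptotics of the entropy of a thermal mode -/

section Asymptotics

lemma tendsto_gFun_sub :
    Tendsto (fun t : ℝ => gFun ((t - 1) / 2) - (1 + Real.log (t / 2))) atTop (𝓝 0) := by
  -- the bound `log y ≤ y - 1` is applied to the ratios of neighbours among `(t - 1) / 2`, `t / 2`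
  -- and `(t + 1) / 2`
  have hlog : ∀ x y : ℝ, 0 < x → 0 < y → Real.log x - Real.log y ≤ x / y - 1 := fun x y hx hy => by
    rw [← Real.log_div hx.ne' hy.ne']
    exact Real.log_le_sub_one_of_pos (by positivity)
  have hb : ∀ t : ℝ, 1 < t → |gFun ((t - 1) / 2) - (1 + Real.log (t / 2))| ≤ t⁻¹ := fun t ht => by
    have h0 : 0 < t := by linarith
    have hp : 0 < (t + 1) / 2 := by linarith
    have hm : 0 < (t - 1) / 2 := by linarith
    have h1 := mul_le_mul_of_nonneg_left (hlog _ (t / 2) hp (by positivity)) hp.le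
    have h2 := mul_le_mul_of_nonneg_left (hlog (t / 2) _ (by positivity) hp) hp.le
    have h3 := mul_le_mul_of_nonneg_left (hlog _ (t / 2) hm (by positivity)) hm.le
    have h4 := mul_le_mul_of_nonneg_left (hlog (t / 2) _ (by positivity) hm) hm.le
    have e1 : (t + 1) / 2 * ((t + 1) / 2 / (t / 2) - 1) = 1 / 2 + t⁻¹ / 2 := by field_simp; ring
    have e2 : (t + 1) / 2 * (t / 2 / ((t + 1) / 2) - 1) = -(1 / 2) := by field_simp; ring
    have e3 : (t - 1) / 2 * ((t - 1) / 2 / (t / 2) - 1) = -(1 / 2) + t⁻¹ / 2 := by field_simp; ring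
    have e4 : (t - 1) / 2 * (t / 2 / ((t - 1) / 2) - 1) = 1 / 2 := by
      have : t - 1 ≠ 0 := by linarith
      field_simp
      ring
    rw [e1] at h1
    rw [e2] at h2
    rw [e3] at h3
    rw [e4] at h4
    have h5 : 0 < t⁻¹ := inv_pos.2 h0
    have h6 : (t - 1) / 2 + 1 = (t + 1) / 2 := by ring
    rw [gFun, h6, abs_le]
    constructor <;> nlinarith
  exact squeeze_zero_norm' ((eventually_gt_atTop 1).mono hb) tendsto_inv_atTop_zero

end Asymptotics

end

theorem mainTheorem5 (m n : ℕ) (ρ : ModeOp (Fin m ⊕ Fin n)) (hρ : IsGaussianState ρ) :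
    (∀ t : ℝ, 0 ≤ t → vonNeumannEntropy (diffuseLeft t ρ) ≠ ∞ ∧
      vonNeumannEntropy (partialTraceLeft (diffuseLeft t ρ)) ≠ ∞) ∧
    Tendsto (fun t : ℝ => |conditionalEntropy (diffuseLeft t ρ) - m * gFun ((t - 1) / 2)|)
      atTop (𝓝 0) := by
  have hd := hρ.isDensityOperator
  refine ⟨fun t ht => ⟨vonNeumannEntropy_diffuseLeft_ne_top hρ ht, ?_⟩, ?_⟩
  · rw [partialTraceLeft_diffuseLeft hd]
    exact vonNeumannEntropy_partialTraceLeft_ne_top hρ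
  have h1 : Tendsto (fun t : ℝ => conditionalEntropy (diffuseLeft t ρ)
      - m * (1 + Real.log (t / 2))) atTop (𝓝 0) := by
    refine tendsto_of_tendsto_of_tendsto_of_le_of_le' tendsto_const_nhds
      (tendsto_id.const_div_atTop (husimiMoment ρ).toReal) ?_ ?_
    · filter_upwards [eventually_gt_atTop 0] with t ht
      have := le_conditionalEntropy_diffuseLeft hρ ht
      rw [Fintype.card_fin] at this
      linarith
    · filter_upwards [eventually_ge_atTop 2] with t ht
      have := conditionalEntropy_diffuseLeft_le hρ ht
      rw [Fintype.card_fin] at this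
      simp only [id]
      linarith
  have h2 := (h1.sub (tendsto_gFun_sub.const_mul (m : ℝ))).abs
  rw [mul_zero, sub_zero, abs_zero] at h2
  refine h2.congr fun t => ?_
  congr 1
  ring
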